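/- Let $k$ be a unital commutative ring, let $r,s\ge 0$ be integers and let $\delta\in k$ be any element. A Brauer $n$-diagram is a graph on two columns of $n$ vertices in which every vertex is joined by an edge to exactly one other vertex; an edge joining the two columns is called propagating. The Brauer algebra $\mathcal{B}_n(\delta)$ is the $k$-algebra with basis the Brauer $n$-diagrams and product $d_1d_2=\delta^{\alpha}d_3$: place $d_2$ to the right of $d_1$ and identify the right-hand column of $d_1$ with the left-hand column of $d_2$; then $\alpha$ is the number of loops lying entirely in the middle column, and $d_3$ joins two distinct outer vertices exactly when they are connected by a path. The walled Brauer algebra $\mathcal{B}_{r,s}(\delta)$ is the subalgebra of $\mathcal{B}_{r+s}(\delta)$ spanned over $k$ by the diagrams in which each propagating edge joins two of the vertices numbered $1,\dots,r$, or two of those numbered $r+1,\dots,r+s$, and each non-propagating edge joins one of the first $r$ vertices to one of the last $s$ vertices. Let $I_0$ be the two-sided ideal of $\mathcal{B}_{r+s}(\delta)$ spanned over $k$ by the diagrams without propagating edges. Let $\mathbb{1}$ denote the ($\mathcal{B}_{r,s}(\delta)$-)module $k$ on which diagrams with $r+s$ propagating edges act as $1$ and all other diagrams act as $0$; if $r+s>0$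 it is also a module over $\mathcal{B}_{r,s}(\delta)/(\mathcal{B}_{r,s}(\delta)\cap I_0)$. For $\Sigma_r\times\Sigma_s$, $\mathbb{1}$ denotes $k$ with the trivial action. 1. If $r+s$ is odd, there are isomorphisms of graded $k$-modules $$\operatorname{Tor}_\star^{\mathcal{B}_{r,s}(\delta)}(\mathbb{1},\mathbb{1})\cong H_\star(\Sigma_r\times\Sigma_s,\mathbb{1})\quad\text{and}\quad \operatorname{Ext}^\star_{\mathcal{B}_{r,s}(\delta)}(\mathbb{1},\mathbb{1})\cong H^\star(\Sigma_r\times\Sigma_s,\mathbb{1}).$$ 2. If $r+s$ is odd, then $\mathcal{B}_{r,s}(\delta)\cap I_0=0$. 3. If $r+s>0$ (of any parity), then, with $Q=\mathcal{B}_{r,s}(\delta)/(\mathcal{B}_{r,s}(\delta)\cap I_0)$, there are isomorphisms of graded $k$-modules $$\operatorname{Tor}_\star^{Q}(\mathbb{1},\mathbb{1})\cong H_\star(\Sigma_r\times\Sigma_s,\mathbb{1})\quad\text{and}\quad \operatorname{Ext}^\star_{Q}(\mathbb{1},\mathbb{1})\cong H^\star(\Sigma_r\times\Sigma_s,\mathbb{1}).$$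 -/

import Mathlib

open CategoryTheory

universe u

/-- Let `σ` and `θ` be involutions of a finite set, `σ` without fixed points. The orbit of a fixed
point `x` of `θ` under `σ` and `θ` contains exactly one other fixed point of `θ`. -/
theorem BrauerDiagram.exists_unique_end {X : Type*} [Finite X] (σ θ : X → X)
    (hσ : Function.Involutive σ) (hθ : Function.Involutive θ) (hne : ∀ a, σ a ≠ a)
    {x : X} (hx : θ x = x) :
    ∃ y, y ≠ x ∧ θ y = y ∧ Relation.ReflTransGen (fun a b => b = σ a ∨ b = θ a) x y ∧
      (∀ z, Relation.ReflTransGen (fun a b => b = σ a ∨ b = θ a) x z → θ z = z → z = x ∨ z = y) ∧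
      ∀ c : X → Prop, (∀ a, c (σ a) ↔ ¬ c a) → (∀ a, θ a ≠ a → (c (θ a) ↔ ¬ c a)) →
        (c y ↔ ¬ c x) := by
  classical
  let b : ℕ → X := fun i => (θ ∘ σ)^[i] x
  have b0 : b 0 = x := rfl
  have bs : ∀ i, b (i + 1) = θ (σ (b i)) := fun i => Function.iterate_succ_apply' _ _ _
  have hex : ∃ m, θ (σ (b m)) = σ (b m) := by
    have hinj : Function.Injective (θ ∘ σ) := hθ.injective.comp hσ.injective
    obtain ⟨N, hN, hp⟩ := (Function.mem_periodicPts (f := θ ∘ σ) (x := x)).1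
      (hinj.mem_periodicPts x)
    obtain ⟨M, rfl⟩ : ∃ M, N = M + 1 := ⟨N - 1, by omega⟩
    have h1 : b (M + 1) = x := hp
    rw [bs] at h1
    have h2 : σ (b M) = x := by rw [← hθ (σ (b M)), h1, hx]
    exact ⟨M, by rw [h2, hx]⟩
  let m := Nat.find hex
  have hm : θ (σ (b m)) = σ (b m) := Nat.find_spec hex
  have hmin : ∀ i < m, θ (σ (b i)) ≠ σ (b i) := fun i hi => Nat.find_min hex hi
  have hreach : ∀ i, Relation.ReflTransGen (fun a b => b = σ a ∨ b = θ a) x (b i) := by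
    intro i
    induction i with
    | zero => exact .refl
    | succ i ih => rw [bs]; exact (ih.tail (Or.inl rfl)).tail (Or.inr rfl)
  refine ⟨σ (b m), ?_, hm, (hreach m).tail (Or.inl rfl), ?_, ?_⟩
  · intro h
    have key : ∀ i ≤ m, b (m - i) = σ (b i) := by
      intro i
      induction i with
      | zero => intro _; rw [b0, ← h, hσ]; rfl
      | succ i ih =>
        intro hi
        have h1 := ih (by omega)
        have h2 : m - i = (m - (i + 1)) + 1 := by omega
        rw [h2, bs] at h1
        rw [bs, ← h1, hθ, hσ]
    rcases Nat.even_or_odd' m with ⟨t, ht | ht⟩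
    · have := key t (by omega)
      rw [show m - t = t by omega] at this
      exact hne _ this.symm
    · have := key t (by omega)
      rw [show m - t = t + 1 by omega, bs] at this
      exact hmin t (by omega) this
  · have hO : ∀ z, Relation.ReflTransGen (fun a b => b = σ a ∨ b = θ a) x z →
        ∃ i ≤ m, z = b i ∨ z = σ (b i) := by
      intro z hz
      induction hz with
      | refl => exact ⟨0, Nat.zero_le _, Or.inl rfl⟩
      | tail _ hs ih =>
        obtain ⟨i, hi, h | h⟩ := ih <;> subst h <;> obtain rfl | rfl := hs
        · exact ⟨i, hi, Or.inr rfl⟩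
        · rcases i with _ | i
          · exact ⟨0, hi, Or.inl (by rw [b0, hx])⟩
          · exact ⟨i, by omega, Or.inr (by rw [bs, hθ])⟩
        · exact ⟨i, hi, Or.inl (hσ _)⟩
        · rcases hi.lt_or_eq with hi | rfl
          · exact ⟨i + 1, hi, Or.inl (bs i).symm⟩
          · exact ⟨m, le_rfl, Or.inr hm⟩
    intro z hz hfix
    obtain ⟨i, hi, rfl | rfl⟩ := hO z hz
    · rcases i with _ | i
      · exact Or.inl rfl
      · rw [bs, hθ] at hfix
        exact absurd hfix.symm (hmin i (by omega))
    · rcases hi.lt_or_eq with hi | rfl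
      · exact absurd hfix (hmin i hi)
      · exact Or.inr rfl
  · intro c h1 h2
    have : ∀ i ≤ m, c (b i) ↔ c x := by
      intro i
      induction i with
      | zero => intro _; rfl
      | succ i ih =>
        intro hi
        rw [bs, h2 _ (hmin i (by omega)), h1, not_not, ih (by omega)]
    rw [h1, this m le_rfl]

namespace SimpleGraph

theorem Reachable.of_map {V W : Type*} {G : SimpleGraph V} (f : V ↪ W) {a : V} {z : W}
    (h : (G.map f).Reachable (f a) z) : ∃ b, z = f b ∧ G.Reachable a b := by
  rw [reachable_iff_reflTransGen] at h
  induction h with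
  | refl => exact ⟨a, rfl, .refl _⟩
  | tail _ hs ih =>
    obtain ⟨b, rfl, hb⟩ := ih
    obtain ⟨-, u, v, huv, h1, rfl⟩ := hs
    obtain rfl := f.injective h1
    exact ⟨v, rfl, hb.trans huv.reachable⟩

theorem Reachable.map_embedding {V W : Type*} {G : SimpleGraph V} (f : V ↪ W) {a b : V}
    (h : G.Reachable a b) : (G.map f).Reachable (f a) (f b) :=
  h.map (Embedding.map f G).toHom

theorem reachable_map_iff {V W : Type*} {G : SimpleGraph V} (f : V ↪ W) {a b : V} :
    (G.map f).Reachable (f a) (f b) ↔ G.Reachable a b := by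
  refine ⟨fun h => ?_, fun h => h.map_embedding f⟩
  obtain ⟨c, hc, h⟩ := h.of_map f
  rwa [f.injective hc]

theorem reachable_sup_iff {Q W : Type*} {H : SimpleGraph Q} {R S : SimpleGraph W} (g : Q ↪ W)
    (h1 : ∀ a b, H.Adj a b → (R ⊔ S).Reachable (g a) (g b))
    (h2 : ∀ a b, R.Reachable (g a) (g b) → H.Reachable a b)
    (h3 : ∀ x y, S.Adj x y → ∃ a b, x = g a ∧ y = g b ∧ H.Reachable a b) (a b : Q) :
    (R ⊔ S).Reachable (g a) (g b) ↔ H.Reachable a b := by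
  constructor
  · intro h
    have key : ∀ z, (R ⊔ S).Reachable (g a) z → ∃ w, H.Reachable a w ∧ R.Reachable (g w) z := by
      intro z hz
      rw [reachable_iff_reflTransGen] at hz
      induction hz with
      | refl => exact ⟨a, .refl _, .refl _⟩
      | tail _ hs ih =>
        obtain ⟨w, hw, hz⟩ := ih
        rcases hs with hs | hs
        · exact ⟨w, hw, hz.trans hs.reachable⟩
        · obtain ⟨c, d, rfl, rfl, hcd⟩ := h3 _ _ hs
          exact ⟨d, hw.trans ((h2 _ _ hz).trans hcd), .refl _⟩
    obtain ⟨w, hw, hz⟩ := key _ h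
    exact hw.trans (h2 _ _ hz)
  · intro h
    rw [reachable_iff_reflTransGen] at h
    induction h with
    | refl => exact .refl _
    | tail _ hs ih => exact ih.trans (h1 _ _ hs)

theorem map_sup' {V W : Type*} (G H : SimpleGraph V) (f : V ↪ W) :
    (G ⊔ H).map f = G.map f ⊔ H.map f := by
  ext x y
  simp only [map_adj, sup_adj]
  constructor
  · rintro ⟨u, v, h | h, rfl, rfl⟩
    · exact Or.inl ⟨u, v, h, rfl, rfl⟩
    · exact Or.inr ⟨u, v, h, rfl, rfl⟩
  · rintro (⟨u, v, h, rfl, rfl⟩ | ⟨u, v, h, rfl, rfl⟩)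
    · exact ⟨u, v, Or.inl h, rfl, rfl⟩
    · exact ⟨u, v, Or.inr h, rfl, rfl⟩

/-- The number of connected components of `G` all of whose vertices lie in `I`. -/
noncomputable def componentsIn {V : Type*} (G : SimpleGraph V) (I : Set V) : ℕ :=
  {c : G.ConnectedComponent | c.supp ⊆ I}.ncard

theorem componentsIn_map {V W : Type*} (G : SimpleGraph V) (f : V ↪ W) (I : Set V) :
    (G.map f).componentsIn (f '' I) = G.componentsIn I := by
  unfold componentsIn
  symm
  refine Set.ncard_congr (fun c _ => c.map (Embedding.map f G).toHom) ?_ ?_ ?_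
  · intro c hc
    induction c using ConnectedComponent.ind with | _ v =>
    intro z hz
    obtain ⟨b, rfl, hb⟩ := Reachable.of_map f (a := v) (ConnectedComponent.exact hz).symm
    exact ⟨b, hc (ConnectedComponent.sound hb.symm), rfl⟩
  · intro c d _ _ h
    induction c using ConnectedComponent.ind with | _ v =>
    induction d using ConnectedComponent.ind with | _ w =>
    exact ConnectedComponent.sound ((reachable_map_iff f).1 (ConnectedComponent.exact h))
  · intro c hc
    induction c using ConnectedComponent.ind with | _ z =>
    obtain ⟨v, hv, rfl⟩ := hc (ConnectedComponent.sound (.refl _) : z ∈ _)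
    refine ⟨G.connectedComponentMk v, ?_, rfl⟩
    intro w hw
    have h2 := (ConnectedComponent.exact hw).map_embedding f
    obtain ⟨w', hw', h3⟩ := hc (ConnectedComponent.sound h2 : f w ∈ _)
    rwa [← f.injective h3]

theorem componentsIn_sup {Q W : Type*} [Finite W] {H : SimpleGraph Q} {R S : SimpleGraph W}
    (g : Q ↪ W) (h1 : ∀ a b, H.Adj a b → (R ⊔ S).Reachable (g a) (g b))
    (h2 : ∀ a b, R.Reachable (g a) (g b) → H.Reachable a b)
    (h3 : ∀ x y, S.Adj x y → ∃ a b, x = g a ∧ y = g b ∧ H.Reachable a b) (J : Set Q) :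
    (R ⊔ S).componentsIn (g '' J ∪ (Set.range g)ᶜ) =
      H.componentsIn J + R.componentsIn (Set.range g)ᶜ := by
  have hr := reachable_sup_iff g h1 h2 h3
  have hP : ∀ v z, (∀ w, R.Reachable v w → w ∉ Set.range g) → (R ⊔ S).Reachable v z →
      R.Reachable v z := by
    intro v z hv hz
    rw [reachable_iff_reflTransGen] at hz
    induction hz with
    | refl => exact .refl _
    | tail _ hs ih =>
      rcases hs with hs | hs
      · exact ih.trans hs.reachable
      · obtain ⟨c, d, rfl, rfl, -⟩ := h3 _ _ hs
        exact absurd ⟨c, rfl⟩ (hv _ ih)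
  have : Finite Q := Finite.of_injective g g.injective
  let φ : H.ConnectedComponent → (R ⊔ S).ConnectedComponent :=
    ConnectedComponent.lift (fun a => (R ⊔ S).connectedComponentMk (g a))
      (fun a b p _ => ConnectedComponent.sound ((hr a b).2 p.reachable))
  let ψ : R.ConnectedComponent → (R ⊔ S).ConnectedComponent :=
    ConnectedComponent.map (Hom.ofLE le_sup_left)
  have hφ : Function.Injective φ := by
    intro c d h
    induction c using ConnectedComponent.ind with | _ v =>
    induction d using ConnectedComponent.ind with | _ w =>
    exact ConnectedComponent.sound ((hr v w).1 (ConnectedComponent.exact h))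
  have hψ : Set.InjOn ψ {c | c.supp ⊆ (Set.range g)ᶜ} := by
    intro c hc d hd h
    induction c using ConnectedComponent.ind with | _ v =>
    induction d using ConnectedComponent.ind with | _ w =>
    exact ConnectedComponent.sound (hP v w
      (fun z hz => hc (ConnectedComponent.sound hz.symm : z ∈ _)) (ConnectedComponent.exact h))
  have hU : {c : (R ⊔ S).ConnectedComponent | c.supp ⊆ g '' J ∪ (Set.range g)ᶜ} =
      φ '' {c | c.supp ⊆ J} ∪ ψ '' {c | c.supp ⊆ (Set.range g)ᶜ} := by
    ext c
    constructor
    · intro hc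
      by_cases hm : ∃ a, g a ∈ c.supp
      · obtain ⟨a, ha⟩ := hm
        left
        refine ⟨H.connectedComponentMk a, ?_, ha⟩
        intro b hb
        have : g b ∈ c.supp :=
          (ConnectedComponent.sound ((hr b a).2 (ConnectedComponent.exact hb))).trans ha
        rcases hc this with ⟨b', hb', h⟩ | h
        · rwa [← g.injective h]
        · exact absurd ⟨b, rfl⟩ h
      · right
        induction c using ConnectedComponent.ind with | _ v =>
        refine ⟨R.connectedComponentMk v, ?_, rfl⟩
        rintro w hw ⟨a, rfl⟩
        exact hm ⟨a, ConnectedComponent.sound ((ConnectedComponent.exact hw).mono le_sup_left)⟩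
    · rintro (⟨c, hc, rfl⟩ | ⟨c, hc, rfl⟩)
      · induction c using ConnectedComponent.ind with | _ v =>
        intro z hz
        by_cases h : z ∈ Set.range g
        · obtain ⟨b, rfl⟩ := h
          exact Or.inl ⟨b, hc (ConnectedComponent.sound ((hr b v).1 (ConnectedComponent.exact hz))),
            rfl⟩
        · exact Or.inr h
      · induction c using ConnectedComponent.ind with | _ v =>
        intro z hz
        right
        have := hP v z (fun z hz => hc (ConnectedComponent.sound hz.symm : z ∈ _))
          (ConnectedComponent.exact hz).symm
        exact hc (ConnectedComponent.sound this.symm : z ∈ _)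
  unfold componentsIn
  rw [hU, Set.ncard_union_eq, Set.ncard_image_of_injective _ hφ, hψ.ncard_image]
  rw [Set.disjoint_left]
  rintro _ ⟨c, -, rfl⟩ ⟨d, hd, h⟩
  induction c using ConnectedComponent.ind with | _ v =>
  induction d using ConnectedComponent.ind with | _ w =>
  have := hP w (g v) (fun z hz => hd (ConnectedComponent.sound hz.symm : z ∈ _))
    (ConnectedComponent.exact h)
  exact hd (ConnectedComponent.sound this.symm : g v ∈ _) ⟨v, rfl⟩

end SimpleGraph

/-- A Brauer `n`-diagram: a graph on two columns of `n` vertices in which every vertex is joined to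
exactly one other vertex. The vertex `(0, i)` is the `i`-th vertex of the left-hand column and
`(1, i)` is the `i`-th vertex of the right-hand column (counted from the top, starting at `0`).
The graph is recorded by the map sending each vertex to the vertex it is joined to. -/
@[ext]
structure BrauerDiagram (n : ℕ) where
  /-- the other endpoint of the edge at a vertex -/
  mate : Fin 2 × Fin n → Fin 2 × Fin n
  mate_mate : ∀ v, mate (mate v) = v
  mate_ne : ∀ v, mate v ≠ v

namespace BrauerDiagram

variable {n : ℕ}

/-- The underlying graph of a Brauer diagram. -/
def graph (d : BrauerDiagram n) : SimpleGraph (Fin 2 × Fin n) where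
  Adj v w := w = d.mate v
  symm := ⟨fun v w h => by rw [h, d.mate_mate]⟩
  loopless := ⟨fun v h => d.mate_ne v h.symm⟩

/-- Renaming of columns. -/
def onColumns {a b : ℕ} (f : Fin a ↪ Fin b) : Fin a × Fin n ↪ Fin b × Fin n :=
  f.prodMap (Function.Embedding.refl _)

/-- The columns of the first factor in a double diagram: the left and the middle column. -/
def leftCols : Fin 2 ↪ Fin 3 := ⟨![0, 1], by decide⟩

/-- The columns of the second factor in a double diagram: the middle and the right column. -/
def rightCols : Fin 2 ↪ Fin 3 := ⟨![1, 2], by decide⟩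

/-- The outer columns of a double diagram. -/
def outerCols : Fin 2 ↪ Fin 3 := ⟨![0, 2], by decide⟩

/-- The double diagram: `d₂` is placed to the right of `d₁`, and the right-hand column
of `d₁` is identified with the left-hand column of `d₂`. -/
def double (d₁ d₂ : BrauerDiagram n) : SimpleGraph (Fin 3 × Fin n) :=
  d₁.graph.map (onColumns leftCols) ⊔ d₂.graph.map (onColumns rightCols)

/-- The number of loops in the middle column of the double diagram: the number of its connected
components which lie entirely within the middle column. -/
noncomputable def loops (d₁ d₂ : BrauerDiagram n) : ℕ :=
  (double d₁ d₂).componentsIn {v | v.1 = 1}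

instance : Finite (BrauerDiagram n) :=
  Finite.of_injective BrauerDiagram.mate (fun _ _ h => BrauerDiagram.ext h)

theorem adj_mate (d : BrauerDiagram n) (v : Fin 2 × Fin n) : d.graph.Adj v (d.mate v) := rfl

theorem map_adj_iff {a : ℕ} (d : BrauerDiagram n) (f : Fin 2 ↪ Fin a) (x y : Fin a × Fin n) :
    (d.graph.map (onColumns f)).Adj x y ↔ ∃ v, x = onColumns f v ∧ y = onColumns f (d.mate v) := by
  rw [SimpleGraph.map_adj]
  constructor
  · rintro ⟨v, w, h, rfl, rfl⟩
    obtain rfl : w = d.mate v := h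
    exact ⟨v, rfl, rfl⟩
  · rintro ⟨v, rfl, rfl⟩
    exact ⟨v, _, rfl, rfl, rfl⟩

theorem reachable_left (d₁ d₂ : BrauerDiagram n) (v : Fin 2 × Fin n) :
    (double d₁ d₂).Reachable (onColumns leftCols v) (onColumns leftCols (d₁.mate v)) :=
  SimpleGraph.Adj.reachable (Or.inl ((map_adj_iff _ _ _ _).2 ⟨v, rfl, rfl⟩))

theorem reachable_right (d₁ d₂ : BrauerDiagram n) (v : Fin 2 × Fin n) :
    (double d₁ d₂).Reachable (onColumns rightCols v) (onColumns rightCols (d₂.mate v)) :=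
  SimpleGraph.Adj.reachable (Or.inr ((map_adj_iff _ _ _ _).2 ⟨v, rfl, rfl⟩))

/-- Every outer vertex of a double diagram is connected to exactly one other outer vertex. The last
clause says that an orientation of the edges of both diagrams which is consistent along the middle
column is respected by the resulting connections. -/
theorem exists_end (d₁ d₂ : BrauerDiagram n) (x : Fin 2 × Fin n) :
    ∃ y, y ≠ x ∧ (double d₁ d₂).Reachable (onColumns outerCols x) (onColumns outerCols y) ∧
      (∀ z, (double d₁ d₂).Reachable (onColumns outerCols x) (onColumns outerCols z) →
        z = x ∨ z = y) ∧
      ∀ c : Fin 2 × Fin n → Prop, (∀ v, c (d₁.mate v) ↔ ¬ c v) → (∀ v, c (d₂.mate v) ↔ ¬ c v) →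
        (∀ i, c (1, i) ↔ ¬ c (0, i)) → (c y ↔ ¬ c x) := by
  let σ : Fin 2 × (Fin 2 × Fin n) → Fin 2 × (Fin 2 × Fin n) :=
    fun a => (a.1, if a.1 = 0 then d₁.mate a.2 else d₂.mate a.2)
  let θ : Fin 2 × (Fin 2 × Fin n) → Fin 2 × (Fin 2 × Fin n) :=
    fun a => if a.1 = a.2.1 then a else (a.2.1, (a.1, a.2.2))
  let q : Fin 2 × (Fin 2 × Fin n) → Fin 3 × Fin n :=
    fun a => if a.1 = 0 then onColumns leftCols a.2 else onColumns rightCols a.2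
  let l : Fin 2 × Fin n → Fin 2 × (Fin 2 × Fin n) := fun v => (v.1, v)
  have hσ : Function.Involutive σ := by
    rintro ⟨j, v⟩
    by_cases h : j = 0 <;> simp [σ, h, mate_mate]
  have hθ : Function.Involutive θ := by
    rintro ⟨j, c, i⟩
    by_cases h : j = c
    · simp [θ, h]
    · simp [θ, h, Ne.symm h]
  have hne : ∀ a, σ a ≠ a := by
    rintro ⟨j, v⟩
    by_cases h : j = 0 <;> simp [σ, h, mate_ne]
  have hfix : ∀ a, θ a = a → ∃ v, a = l v := by
    rintro ⟨j, c, i⟩ h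
    refine ⟨(c, i), ?_⟩
    by_cases h' : j = c
    · simp [l, h']
    · simp [θ, h', Ne.symm h'] at h
  have hl : ∀ v, θ (l v) = l v := by intro v; simp [θ, l]
  have hql : ∀ v, q (l v) = onColumns outerCols v := by
    rintro ⟨j, i⟩
    fin_cases j <;> simp [q, l, onColumns, leftCols, rightCols, outerCols]
  have hqθ : ∀ a, q (θ a) = q a := by
    rintro ⟨j, c, i⟩
    fin_cases j <;> fin_cases c <;> simp [q, θ, onColumns, leftCols, rightCols]
  have hqq : ∀ a b, q a = q b → b = a ∨ b = θ a := by
    rintro ⟨j, c, i⟩ ⟨j', c', i'⟩ h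
    fin_cases j <;> fin_cases c <;> fin_cases j' <;> fin_cases c' <;>
      simp [q, θ, onColumns, leftCols, rightCols] at h ⊢ <;> exact h.symm
  have hσadj : ∀ a, (double d₁ d₂).Reachable (q a) (q (σ a)) := by
    rintro ⟨j, v⟩
    by_cases h : j = 0
    · simpa [q, σ, h] using reachable_left d₁ d₂ v
    · simpa [q, σ, h] using reachable_right d₁ d₂ v
  have hadj : ∀ a z, (double d₁ d₂).Adj (q a) z →
      ∃ b, z = q b ∧ Relation.ReflTransGen (fun a b => b = σ a ∨ b = θ a) a b := by
    intro a z h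
    have : ∃ b, q a = q b ∧ z = q (σ b) := by
      rcases h with h | h
      · obtain ⟨v, h1, h2⟩ := (map_adj_iff _ _ _ _).1 h
        exact ⟨(0, v), by simpa [q] using h1, by simpa [q, σ] using h2⟩
      · obtain ⟨v, h1, h2⟩ := (map_adj_iff _ _ _ _).1 h
        exact ⟨(1, v), by simpa [q] using h1, by simpa [q, σ] using h2⟩
    obtain ⟨b, hb, rfl⟩ := this
    refine ⟨σ b, rfl, ?_⟩
    obtain rfl | rfl := hqq _ _ hb
    · exact .single (Or.inl rfl)
    · exact .tail (.single (Or.inr rfl)) (Or.inl rfl)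
  obtain ⟨y, hy1, hy2, hy3, hy4, hy5⟩ := exists_unique_end σ θ hσ hθ hne (hl x)
  obtain ⟨y, rfl⟩ := hfix y hy2
  refine ⟨y, fun h => hy1 (by rw [h]), ?_, ?_, ?_⟩
  · rw [← hql, ← hql]
    clear hy1 hy2 hy4 hy5
    generalize l y = w at hy3
    induction hy3 with
    | refl => exact .refl _
    | tail _ hs ih =>
      obtain rfl | rfl := hs
      · exact ih.trans (hσadj _)
      · rw [hqθ]; exact ih
  · intro z hz
    have key : ∀ w, (double d₁ d₂).Reachable (q (l x)) w →
        ∃ b, w = q b ∧ Relation.ReflTransGen (fun a b => b = σ a ∨ b = θ a) (l x) b := by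
      intro w hw
      rw [SimpleGraph.reachable_iff_reflTransGen] at hw
      induction hw with
      | refl => exact ⟨_, rfl, .refl⟩
      | tail _ hs ih =>
        obtain ⟨b, rfl, hb⟩ := ih
        obtain ⟨c, rfl, hc⟩ := hadj _ _ hs
        exact ⟨c, rfl, hb.trans hc⟩
    rw [← hql, ← hql] at hz
    obtain ⟨b, hb1, hb2⟩ := key _ hz
    have hb3 : b = l z := by
      rcases hqq _ _ hb1 with h | h
      · exact h
      · rw [h, hl]
    subst hb3
    have hinj : Function.Injective l := fun a b h => congrArg Prod.snd h
    rcases hy4 _ hb2 (hl z) with h | h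
    · exact Or.inl (hinj h)
    · exact Or.inr (hinj h)
  · intro c hc1 hc2 hc3
    refine hy5 (fun a => c a.2) ?_ ?_
    · rintro ⟨j, v⟩
      by_cases h : j = 0 <;> simp [σ, h, hc1, hc2]
    · rintro ⟨j, k, i⟩ h
      fin_cases j <;> fin_cases k <;> simp [θ, hc3] at h ⊢

/-- The diagram underlying the product of `d₁` and `d₂`: two distinct outer
vertices are joined if and only if there is a path between them in the double diagram. -/
noncomputable def comp (d₁ d₂ : BrauerDiagram n) : BrauerDiagram n where
  mate x := Classical.choose (exists_end d₁ d₂ x)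
  mate_mate x := by
    have h1 := Classical.choose_spec (exists_end d₁ d₂ x)
    have h2 := Classical.choose_spec (exists_end d₁ d₂ (Classical.choose (exists_end d₁ d₂ x)))
    rcases h2.2.2.1 x h1.2.1.symm with h | h
    · exact absurd h.symm h1.1
    · exact h.symm
  mate_ne x := (Classical.choose_spec (exists_end d₁ d₂ x)).1

theorem comp_reachable (d₁ d₂ : BrauerDiagram n) (x : Fin 2 × Fin n) :
    (double d₁ d₂).Reachable (onColumns outerCols x) (onColumns outerCols ((comp d₁ d₂).mate x)) :=
  (Classical.choose_spec (exists_end d₁ d₂ x)).2.1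

theorem comp_mate_of_reachable (d₁ d₂ : BrauerDiagram n) {x y : Fin 2 × Fin n}
    (h : (double d₁ d₂).Reachable (onColumns outerCols x) (onColumns outerCols y)) :
    y = x ∨ y = (comp d₁ d₂).mate x :=
  (Classical.choose_spec (exists_end d₁ d₂ x)).2.2.1 y h

theorem comp_mate_eq_iff (d₁ d₂ : BrauerDiagram n) (x y : Fin 2 × Fin n) :
    (comp d₁ d₂).mate x = y ↔ y ≠ x ∧
      (double d₁ d₂).Reachable (onColumns outerCols x) (onColumns outerCols y) := by
  constructor
  · rintro rfl
    exact ⟨mate_ne _ _, comp_reachable d₁ d₂ x⟩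
  · rintro ⟨h1, h2⟩
    exact ((comp_mate_of_reachable d₁ d₂ h2).resolve_left h1).symm

theorem comp_mate_orientation (d₁ d₂ : BrauerDiagram n) (c : Fin 2 × Fin n → Prop)
    (h1 : ∀ v, c (d₁.mate v) ↔ ¬ c v) (h2 : ∀ v, c (d₂.mate v) ↔ ¬ c v)
    (h3 : ∀ i, c (1, i) ↔ ¬ c (0, i)) (x : Fin 2 × Fin n) :
    c ((comp d₁ d₂).mate x) ↔ ¬ c x :=
  (Classical.choose_spec (exists_end d₁ d₂ x)).2.2.2 c h1 h2 h3

/-- Three diagrams placed next to each other. -/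
def triple (d₁ d₂ d₃ : BrauerDiagram n) : SimpleGraph (Fin 4 × Fin n) :=
  d₁.graph.map (onColumns ⟨![0, 1], by decide⟩) ⊔ d₂.graph.map (onColumns ⟨![1, 2], by decide⟩) ⊔
    d₃.graph.map (onColumns ⟨![2, 3], by decide⟩)

theorem onColumns_trans {a b c : ℕ} (f : Fin a ↪ Fin b) (g : Fin b ↪ Fin c) (v : Fin a × Fin n) :
    onColumns g (onColumns f v) = onColumns (f.trans g) v := rfl

theorem map_map {a b : ℕ} (d : BrauerDiagram n) (f : Fin 2 ↪ Fin a) (g : Fin a ↪ Fin b) :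
    (d.graph.map (onColumns f)).map (onColumns g) = d.graph.map (onColumns (f.trans g)) := by
  rw [SimpleGraph.map_map]; rfl

/-- One half of associativity. `u` is the place of the composite `d₁ d₂` and `w` is the
place of the third diagram. -/
theorem assoc_half (d₁ d₂ d₃ : BrauerDiagram n) (u w : Fin 2 ↪ Fin 3) (g h : Fin 3 ↪ Fin 4)
    (huw : u.trans g = outerCols.trans h)
    (hgh : ∀ a b, g a = h b → ∃ c, a = u c ∧ b = outerCols c) :
    let H : SimpleGraph (Fin 3 × Fin n) :=
      (comp d₁ d₂).graph.map (onColumns u) ⊔ d₃.graph.map (onColumns w)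
    let R := (double d₁ d₂).map (onColumns h)
    let S := d₃.graph.map (onColumns (w.trans g))
    (∀ a b, H.Adj a b → (R ⊔ S).Reachable (onColumns g a) (onColumns g b)) ∧
    (∀ a b, R.Reachable (onColumns g a) (onColumns g b) → H.Reachable a b) ∧
    (∀ x y, S.Adj x y → ∃ a b, x = onColumns g a ∧ y = onColumns g b ∧ H.Reachable a b) := by
  intro H R S
  have hug : ∀ v : Fin 2 × Fin n, onColumns g (onColumns u v) = onColumns h (onColumns outerCols v) := by
    intro v
    rw [onColumns_trans, onColumns_trans, huw]
  refine ⟨?_, ?_, ?_⟩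
  · rintro a b (hab | hab)
    · obtain ⟨v, rfl, rfl⟩ := (map_adj_iff _ _ _ _).1 hab
      rw [hug, hug]
      exact ((comp_reachable d₁ d₂ v).map_embedding (onColumns h)).mono le_sup_left
    · obtain ⟨v, rfl, rfl⟩ := (map_adj_iff _ _ _ _).1 hab
      exact SimpleGraph.Adj.reachable (Or.inr ((map_adj_iff _ _ _ _).2 ⟨v, rfl, rfl⟩))
  · rintro a b hab
    by_cases hne : a = b
    · rw [hne]
    have hrange : ∀ a b : Fin 3 × Fin n, ∀ z, R.Adj (onColumns g a) z → ∃ v, a = onColumns u v := by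
      rintro ⟨a, i⟩ b z hz
      obtain ⟨⟨p, i'⟩, q, -, h1, -⟩ := (SimpleGraph.map_adj _ _ _ _).1 hz
      obtain ⟨c, rfl, -⟩ := hgh a p (congrArg Prod.fst h1).symm
      exact ⟨(c, i), rfl⟩
    have hstart : ∀ a b : Fin 3 × Fin n, a ≠ b → R.Reachable (onColumns g a) (onColumns g b) →
        ∃ v, a = onColumns u v := by
      intro a b hne hab
      rw [SimpleGraph.reachable_iff_reflTransGen] at hab
      rcases hab.cases_head with h | ⟨z, hz, -⟩
      · exact absurd ((onColumns g).injective h) hne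
      · exact hrange a b z hz
    obtain ⟨v, rfl⟩ := hstart a b hne hab
    obtain ⟨v', rfl⟩ := hstart b _ (Ne.symm hne) hab.symm
    rw [hug, hug, SimpleGraph.reachable_map_iff] at hab
    rcases comp_mate_of_reachable d₁ d₂ hab with rfl | rfl
    · exact .refl _
    · exact SimpleGraph.Adj.reachable (Or.inl ((map_adj_iff _ _ _ _).2 ⟨v, rfl, rfl⟩))
  · intro x y hxy
    obtain ⟨v, rfl, rfl⟩ := (map_adj_iff _ _ _ _).1 hxy
    exact ⟨onColumns w v, onColumns w (d₃.mate v), rfl, rfl,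
      SimpleGraph.Adj.reachable (Or.inr ((map_adj_iff _ _ _ _).2 ⟨v, rfl, rfl⟩))⟩

theorem triple_eq_left (d₁ d₂ d₃ : BrauerDiagram n) :
    (double d₁ d₂).map (onColumns ⟨![0, 1, 2], by decide⟩) ⊔
      d₃.graph.map (onColumns (rightCols.trans ⟨![0, 2, 3], by decide⟩)) = triple d₁ d₂ d₃ := by
  unfold double triple
  rw [SimpleGraph.map_sup', map_map, map_map]
  congr 3 <;> congr 2 <;> ext j <;> fin_cases j <;> rfl

theorem triple_eq_right (d₁ d₂ d₃ : BrauerDiagram n) :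
    (double d₂ d₃).map (onColumns ⟨![1, 2, 3], by decide⟩) ⊔
      d₁.graph.map (onColumns (leftCols.trans ⟨![0, 1, 3], by decide⟩)) = triple d₁ d₂ d₃ := by
  unfold double triple
  rw [SimpleGraph.map_sup', map_map, map_map, sup_comm, ← sup_assoc]
  congr 3 <;> congr 2 <;> ext j <;> fin_cases j <;> rfl

theorem reachable_assoc_left (d₁ d₂ d₃ : BrauerDiagram n) (a b : Fin 3 × Fin n) :
    (triple d₁ d₂ d₃).Reachable (onColumns ⟨![0, 2, 3], by decide⟩ a)
      (onColumns ⟨![0, 2, 3], by decide⟩ b) ↔ (double (comp d₁ d₂) d₃).Reachable a b := by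
  have := assoc_half d₁ d₂ d₃ leftCols rightCols ⟨![0, 2, 3], by decide⟩ ⟨![0, 1, 2], by decide⟩
    (by ext j; fin_cases j <;> rfl) (by decide)
  rw [← triple_eq_left]
  exact SimpleGraph.reachable_sup_iff _ this.1 this.2.1 this.2.2 a b

theorem reachable_assoc_right (d₁ d₂ d₃ : BrauerDiagram n) (a b : Fin 3 × Fin n) :
    (triple d₁ d₂ d₃).Reachable (onColumns ⟨![0, 1, 3], by decide⟩ a)
      (onColumns ⟨![0, 1, 3], by decide⟩ b) ↔ (double d₁ (comp d₂ d₃)).Reachable a b := by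
  have := assoc_half d₂ d₃ d₁ rightCols leftCols ⟨![0, 1, 3], by decide⟩ ⟨![1, 2, 3], by decide⟩
    (by ext j; fin_cases j <;> rfl) (by decide)
  rw [← triple_eq_right]
  unfold double
  rw [sup_comm (d₁.graph.map _)]
  exact SimpleGraph.reachable_sup_iff _ this.1 this.2.1 this.2.2 a b

theorem comp_assoc (d₁ d₂ d₃ : BrauerDiagram n) :
    comp (comp d₁ d₂) d₃ = comp d₁ (comp d₂ d₃) := by
  ext1
  funext x
  rw [comp_mate_eq_iff]
  refine ⟨mate_ne _ _, ?_⟩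
  rw [← reachable_assoc_left]
  have := comp_reachable d₁ (comp d₂ d₃) x
  rw [← reachable_assoc_right] at this
  generalize (comp d₁ (comp d₂ d₃)).mate x = y at this
  obtain ⟨j, i⟩ := x
  obtain ⟨j', i'⟩ := y
  fin_cases j <;> fin_cases j' <;> exact this

theorem loops_assoc (d₁ d₂ d₃ : BrauerDiagram n) :
    loops d₁ d₂ + loops (comp d₁ d₂) d₃ = loops d₂ d₃ + loops d₁ (comp d₂ d₃) := by
  have h1 := assoc_half d₁ d₂ d₃ leftCols rightCols ⟨![0, 2, 3], by decide⟩ ⟨![0, 1, 2], by decide⟩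
    (by ext j; fin_cases j <;> rfl) (by decide)
  have h2 := assoc_half d₂ d₃ d₁ rightCols leftCols ⟨![0, 1, 3], by decide⟩ ⟨![1, 2, 3], by decide⟩
    (by ext j; fin_cases j <;> rfl) (by decide)
  have h1' := SimpleGraph.componentsIn_sup _ h1.1 h1.2.1 h1.2.2 {v | v.1 = 1}
  have h2' := SimpleGraph.componentsIn_sup _ h2.1 h2.2.1 h2.2.2 {v | v.1 = 1}
  rw [triple_eq_left] at h1'
  rw [triple_eq_right] at h2'
  have e1 : (Set.range (onColumns (n := n) (⟨![0, 2, 3], by decide⟩ : Fin 3 ↪ Fin 4)))ᶜ =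
      onColumns (⟨![0, 1, 2], by decide⟩ : Fin 3 ↪ Fin 4) '' {v | v.1 = 1} := by
    ext ⟨j, i⟩
    fin_cases j <;> simp [onColumns]
  have e2 : (Set.range (onColumns (n := n) (⟨![0, 1, 3], by decide⟩ : Fin 3 ↪ Fin 4)))ᶜ =
      onColumns (⟨![1, 2, 3], by decide⟩ : Fin 3 ↪ Fin 4) '' {v | v.1 = 1} := by
    ext ⟨j, i⟩
    fin_cases j <;> simp [onColumns]
  have e3 : onColumns (n := n) (⟨![0, 2, 3], by decide⟩ : Fin 3 ↪ Fin 4) '' {v | v.1 = 1} =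
      {v | v.1 = 2} := by
    ext ⟨j, i⟩
    fin_cases j <;> simp [onColumns]
  have e4 : onColumns (n := n) (⟨![0, 1, 3], by decide⟩ : Fin 3 ↪ Fin 4) '' {v | v.1 = 1} =
      {v | v.1 = 1} := by
    ext ⟨j, i⟩
    fin_cases j <;> simp [onColumns]
  have e5 : onColumns (n := n) (⟨![0, 1, 2], by decide⟩ : Fin 3 ↪ Fin 4) '' {v | v.1 = 1} =
      {v | v.1 = 1} := by
    ext ⟨j, i⟩
    fin_cases j <;> simp [onColumns]
  have e6 : onColumns (n := n) (⟨![1, 2, 3], by decide⟩ : Fin 3 ↪ Fin 4) '' {v | v.1 = 1} =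
      {v | v.1 = 2} := by
    ext ⟨j, i⟩
    fin_cases j <;> simp [onColumns]
  rw [e1, SimpleGraph.componentsIn_map, e3, e5] at h1'
  rw [e2, SimpleGraph.componentsIn_map, e4, e6, Set.union_comm,
    sup_comm ((comp d₂ d₃).graph.map _)] at h2'
  unfold loops
  have h3 := h1'.symm.trans h2'
  rw [add_comm]
  refine h3.trans ?_
  rw [add_comm]
  rfl


/-- The diagram with `n` horizontal edges. -/
def idDiagram (n : ℕ) : BrauerDiagram n where
  mate v := (v.1 + 1, v.2)
  mate_mate v := by
    obtain ⟨j, i⟩ := v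
    fin_cases j <;> rfl
  mate_ne v h := by
    obtain ⟨j, i⟩ := v
    fin_cases j <;> simp at h

theorem reachable_id_left (d : BrauerDiagram n) (x : Fin 2 × Fin n) :
    (double (idDiagram n) d).Reachable (onColumns outerCols x) (onColumns rightCols x) := by
  obtain ⟨j, i⟩ := x
  fin_cases j
  · exact reachable_left (idDiagram n) d (0, i)
  · exact .refl _

theorem reachable_id_right (d : BrauerDiagram n) (x : Fin 2 × Fin n) :
    (double d (idDiagram n)).Reachable (onColumns outerCols x) (onColumns leftCols x) := by
  obtain ⟨j, i⟩ := x
  fin_cases j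
  · exact .refl _
  · exact reachable_right d (idDiagram n) (1, i)

theorem id_comp (d : BrauerDiagram n) : comp (idDiagram n) d = d := by
  ext1
  funext x
  rw [comp_mate_eq_iff]
  exact ⟨mate_ne _ _, (reachable_id_left d x).trans
    ((reachable_right _ d x).trans (reachable_id_left d _).symm)⟩

theorem comp_id (d : BrauerDiagram n) : comp d (idDiagram n) = d := by
  ext1
  funext x
  rw [comp_mate_eq_iff]
  exact ⟨mate_ne _ _, (reachable_id_right d x).trans
    ((reachable_left d _ x).trans (reachable_id_right d _).symm)⟩

/-- If every middle vertex is connected to an outer column, then there are no loops. -/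
theorem loops_eq_zero (d₁ d₂ : BrauerDiagram n)
    (h : ∀ i, ∃ w : Fin 3 × Fin n, w.1 ≠ 1 ∧ (double d₁ d₂).Reachable (1, i) w) :
    loops d₁ d₂ = 0 := by
  unfold loops SimpleGraph.componentsIn
  rw [Set.ncard_eq_zero, Set.eq_empty_iff_forall_notMem]
  intro c hc
  induction c using SimpleGraph.ConnectedComponent.ind with | _ v =>
  obtain ⟨j, i⟩ := v
  obtain rfl : j = 1 := hc (rfl : (j, i) ∈ _)
  obtain ⟨w, hw, hr⟩ := h i
  exact hw (hc (SimpleGraph.ConnectedComponent.sound hr.symm : w ∈ _))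

theorem loops_id_left (d : BrauerDiagram n) : loops (idDiagram n) d = 0 :=
  loops_eq_zero _ _ fun i => ⟨(0, i), by simp, reachable_left (idDiagram n) d (1, i)⟩

theorem loops_id_right (d : BrauerDiagram n) : loops d (idDiagram n) = 0 :=
  loops_eq_zero _ _ fun i => ⟨(2, i), by simp, reachable_right d (idDiagram n) (0, i)⟩

/-- The number of propagating edges, that is, of edges between the two columns. -/
def numPropagating (d : BrauerDiagram n) : ℕ :=
  (Finset.univ.filter fun i : Fin n => (d.mate (0, i)).1 = 1).card

theorem numPropagating_eq (d : BrauerDiagram n) :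
    d.numPropagating = (Finset.univ.filter fun i : Fin n => (d.mate (1, i)).1 = 0).card := by
  have key : ∀ a b : Fin 2, ∀ i, (d.mate (a, i)).1 = b → d.mate (b, (d.mate (a, i)).2) = (a, i) := by
    rintro a b i rfl
    exact d.mate_mate (a, i)
  unfold numPropagating
  refine Finset.card_nbij' (fun i => (d.mate (0, i)).2) (fun i => (d.mate (1, i)).2) ?_ ?_ ?_ ?_
  · intro i hi
    simp only [Finset.coe_filter, Finset.mem_univ, true_and, Set.mem_ofPred_eq] at hi ⊢
    rw [key 0 1 i hi]
  · intro i hi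
    simp only [Finset.coe_filter, Finset.mem_univ, true_and, Set.mem_ofPred_eq] at hi ⊢
    rw [key 1 0 i hi]
  · intro i hi
    simp only [Finset.coe_filter, Finset.mem_univ, true_and, Set.mem_ofPred_eq] at hi ⊢
    rw [key 0 1 i hi]
  · intro i hi
    simp only [Finset.coe_filter, Finset.mem_univ, true_and, Set.mem_ofPred_eq] at hi ⊢
    rw [key 1 0 i hi]

theorem comp_mate_left (d₁ d₂ : BrauerDiagram n) (i : Fin n) (h : (d₁.mate (0, i)).1 = 0) :
    (comp d₁ d₂).mate (0, i) = d₁.mate (0, i) := by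
  rw [comp_mate_eq_iff]
  refine ⟨mate_ne _ _, ?_⟩
  have := reachable_left d₁ d₂ (0, i)
  revert this h
  generalize d₁.mate (0, i) = y
  obtain ⟨j, i'⟩ := y
  rintro rfl h
  exact h

theorem comp_mate_right (d₁ d₂ : BrauerDiagram n) (i : Fin n) (h : (d₂.mate (1, i)).1 = 1) :
    (comp d₁ d₂).mate (1, i) = d₂.mate (1, i) := by
  rw [comp_mate_eq_iff]
  refine ⟨mate_ne _ _, ?_⟩
  have := reachable_right d₁ d₂ (1, i)
  revert this h
  generalize d₂.mate (1, i) = y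
  obtain ⟨j, i'⟩ := y
  rintro rfl h
  exact h

theorem numPropagating_comp_le_left (d₁ d₂ : BrauerDiagram n) :
    (comp d₁ d₂).numPropagating ≤ d₁.numPropagating := by
  refine Finset.card_le_card fun i hi => ?_
  simp only [Finset.mem_filter, Finset.mem_univ, true_and] at hi ⊢
  by_contra h
  have h0 : (d₁.mate (0, i)).1 = 0 := by omega
  rw [comp_mate_left d₁ d₂ i h0, h0] at hi
  exact absurd hi (by decide)

theorem numPropagating_comp_le_right (d₁ d₂ : BrauerDiagram n) :
    (comp d₁ d₂).numPropagating ≤ d₂.numPropagating := by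
  rw [numPropagating_eq, numPropagating_eq]
  refine Finset.card_le_card fun i hi => ?_
  simp only [Finset.mem_filter, Finset.mem_univ, true_and] at hi ⊢
  by_contra h
  have h0 : (d₂.mate (1, i)).1 = 1 := by omega
  rw [comp_mate_right d₁ d₂ i h0, h0] at hi
  exact absurd hi (by decide)

theorem numPropagating_le (d : BrauerDiagram n) : d.numPropagating ≤ n :=
  (Finset.card_le_univ _).trans_eq (Fintype.card_fin n)

theorem mate_of_permutation (d : BrauerDiagram n) (h : d.numPropagating = n) (i : Fin n) :
    (d.mate (0, i)).1 = 1 ∧ (d.mate (1, i)).1 = 0 := by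
  have h' := h
  rw [numPropagating_eq] at h'
  unfold numPropagating at h
  have e : (Finset.univ : Finset (Fin n)).card = n := Finset.card_fin n
  have h1 := (Finset.card_filter_eq_iff).1 (h.trans e.symm) i (Finset.mem_univ i)
  have h2 := (Finset.card_filter_eq_iff).1 (h'.trans e.symm) i (Finset.mem_univ i)
  exact ⟨h1, h2⟩

theorem comp_of_permutation (d₁ d₂ : BrauerDiagram n) (h1 : d₁.numPropagating = n)
    (h2 : d₂.numPropagating = n) : (comp d₁ d₂).numPropagating = n ∧ loops d₁ d₂ = 0 := by
  constructor
  · unfold numPropagating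
    rw [Finset.filter_true_of_mem, Finset.card_fin]
    intro i _
    have a1 := (mate_of_permutation d₁ h1 i).1
    have a2 := reachable_left d₁ d₂ (0, i)
    revert a1 a2
    generalize d₁.mate (0, i) = y
    obtain ⟨j, i'⟩ := y
    rintro rfl a2
    have a3 := (mate_of_permutation d₂ h2 i').1
    have a4 := reachable_right d₁ d₂ (0, i')
    revert a3 a4
    generalize d₂.mate (0, i') = y
    obtain ⟨j, i''⟩ := y
    rintro rfl a4
    have : (comp d₁ d₂).mate (0, i) = (1, i'') :=
      (comp_mate_eq_iff _ _ _ _).2 ⟨by simp, a2.trans a4⟩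
    rw [this]
  · refine loops_eq_zero _ _ fun i => ?_
    have a1 := (mate_of_permutation d₁ h1 i).2
    refine ⟨_, ?_, reachable_left d₁ d₂ (1, i)⟩
    revert a1
    generalize d₁.mate (1, i) = y
    obtain ⟨j, i'⟩ := y
    rintro rfl
    simp [onColumns, leftCols]

theorem numPropagating_id : (idDiagram n).numPropagating = n := by
  unfold numPropagating
  rw [Finset.filter_true_of_mem, Finset.card_fin]
  intro i _
  rfl

/-- A walled Brauer diagram, the wall being below the first `r` vertices of each column: a
propagating edge joins vertices on the same side of the wall, a non-propagating edge
joins vertices on different sides. -/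
def IsWalled (r : ℕ) (d : BrauerDiagram n) : Prop :=
  ∀ v, ((d.mate v).1 ≠ v.1 → (((d.mate v).2 : ℕ) < r ↔ (v.2 : ℕ) < r)) ∧
    ((d.mate v).1 = v.1 → (((d.mate v).2 : ℕ) < r ↔ ¬ (v.2 : ℕ) < r))

theorem isWalled_iff (r : ℕ) (d : BrauerDiagram n) : d.IsWalled r ↔
    ∀ v, ((d.mate v).1 = 0 ↔ ((d.mate v).2 : ℕ) < r) ↔ ¬ (v.1 = 0 ↔ (v.2 : ℕ) < r) := by
  refine forall_congr' fun v => ?_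
  generalize d.mate v = w
  obtain ⟨a, i⟩ := v
  obtain ⟨b, j⟩ := w
  fin_cases a <;> fin_cases b <;> simp <;> omega

theorem IsWalled.comp {r : ℕ} {d₁ d₂ : BrauerDiagram n} (h1 : d₁.IsWalled r)
    (h2 : d₂.IsWalled r) : (comp d₁ d₂).IsWalled r := by
  rw [isWalled_iff] at *
  exact comp_mate_orientation d₁ d₂ (fun v => v.1 = 0 ↔ (v.2 : ℕ) < r) h1 h2 (by simp)

theorem isWalled_id (r : ℕ) : (idDiagram n).IsWalled r := by
  rintro ⟨a, i⟩
  fin_cases a <;> simp [idDiagram]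

end BrauerDiagram

/-- The Brauer algebra `B_n(δ)`: the `k`-algebra with basis the Brauer `n`-diagrams, the product of
two diagrams being `d₁ d₂ = δ ^ loops d₁ d₂ • comp d₁ d₂`. -/
def BrauerAlgebra {k : Type u} [CommRing k] (n : ℕ) (_δ : k) : Type u := BrauerDiagram n →₀ k

namespace BrauerAlgebra

open BrauerDiagram

variable {k : Type u} [CommRing k] {n : ℕ} {δ : k}

noncomputable instance : AddCommGroup (BrauerAlgebra n δ) :=
  inferInstanceAs (AddCommGroup (BrauerDiagram n →₀ k))

noncomputable instance : Module k (BrauerAlgebra n δ) :=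
  inferInstanceAs (Module k (BrauerDiagram n →₀ k))

variable (δ) in
/-- A diagram, as an element of the Brauer algebra. -/
noncomputable def diagram (d : BrauerDiagram n) : BrauerAlgebra n δ := Finsupp.single d 1

/-- The diagrams form a basis of the Brauer algebra. -/
noncomputable def basis (n : ℕ) (δ : k) : Module.Basis (BrauerDiagram n) k (BrauerAlgebra n δ) :=
  ⟨LinearEquiv.refl k (BrauerDiagram n →₀ k)⟩

theorem basis_apply (d : BrauerDiagram n) : basis n δ d = diagram δ d := rfl

/-- The product of the Brauer algebra, as a bilinear map. -/
noncomputable def mulLin (n : ℕ) (δ : k) :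
    BrauerAlgebra n δ →ₗ[k] BrauerAlgebra n δ →ₗ[k] BrauerAlgebra n δ :=
  (basis n δ).constr k fun d₁ => (basis n δ).constr k fun d₂ =>
    δ ^ loops d₁ d₂ • diagram δ (comp d₁ d₂)

noncomputable instance : Mul (BrauerAlgebra n δ) := ⟨fun x y => mulLin n δ x y⟩

noncomputable instance : One (BrauerAlgebra n δ) := ⟨diagram δ (idDiagram n)⟩

theorem mul_eq (x y : BrauerAlgebra n δ) : x * y = mulLin n δ x y := rfl

theorem one_eq : (1 : BrauerAlgebra n δ) = diagram δ (idDiagram n) := rfl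

theorem diagram_mul_diagram (d₁ d₂ : BrauerDiagram n) :
    diagram δ d₁ * diagram δ d₂ = δ ^ loops d₁ d₂ • diagram δ (comp d₁ d₂) := by
  rw [mul_eq, ← basis_apply, ← basis_apply, mulLin, Module.Basis.constr_basis,
    Module.Basis.constr_basis]

theorem span_diagram : Submodule.span k (Set.range (diagram (n := n) δ)) = ⊤ :=
  (basis n δ).span_eq

theorem smul_mul' (c : k) (x y : BrauerAlgebra n δ) : (c • x) * y = c • (x * y) := by
  simp only [mul_eq, map_smul, LinearMap.smul_apply]

theorem mul_smul' (c : k) (x y : BrauerAlgebra n δ) : x * (c • y) = c • (x * y) := by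
  simp only [mul_eq, map_smul]

theorem add_mul' (x y z : BrauerAlgebra n δ) : (x + y) * z = x * z + y * z := by
  simp only [mul_eq, map_add, LinearMap.add_apply]

theorem mul_add' (x y z : BrauerAlgebra n δ) : x * (y + z) = x * y + x * z := by
  simp only [mul_eq, map_add]

theorem zero_mul' (x : BrauerAlgebra n δ) : 0 * x = 0 := by
  simp only [mul_eq, map_zero, LinearMap.zero_apply]

theorem mul_zero' (x : BrauerAlgebra n δ) : x * 0 = 0 := by
  simp only [mul_eq, map_zero]

/-- To prove a property of all elements, prove it for diagrams, sums and scalar multiples. -/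
theorem diagram_induction {p : BrauerAlgebra n δ → Prop} (x : BrauerAlgebra n δ)
    (hd : ∀ d, p (diagram δ d)) (h0 : p 0) (ha : ∀ x y, p x → p y → p (x + y))
    (hs : ∀ (c : k) x, p x → p (c • x)) : p x := by
  have hx : x ∈ Submodule.span k (Set.range (diagram (n := n) δ)) := by
    rw [span_diagram]; trivial
  induction hx using Submodule.span_induction with
  | mem x h => obtain ⟨d, rfl⟩ := h; exact hd d
  | zero => exact h0
  | add x y _ _ hx hy => exact ha x y hx hy
  | smul c x _ hx => exact hs c x hx

theorem mul_assoc' (x y z : BrauerAlgebra n δ) : x * y * z = x * (y * z) := by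
  induction x using diagram_induction with
  | h0 => simp only [zero_mul']
  | ha x x' h h' => simp only [add_mul', h, h']
  | hs c x h => simp only [smul_mul', h]
  | hd a =>
    induction y using diagram_induction with
    | h0 => simp only [zero_mul', mul_zero']
    | ha x x' h h' => simp only [add_mul', mul_add', h, h']
    | hs c x h => simp only [smul_mul', mul_smul', h]
    | hd b =>
      induction z using diagram_induction with
      | h0 => simp only [mul_zero']
      | ha x x' h h' => simp only [mul_add', h, h']
      | hs c x h => simp only [mul_smul', h]
      | hd c =>
        simp only [diagram_mul_diagram, smul_mul', mul_smul', smul_smul, ← pow_add, loops_assoc,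
          comp_assoc]

theorem one_mul' (x : BrauerAlgebra n δ) : 1 * x = x := by
  induction x using diagram_induction with
  | h0 => simp only [mul_zero']
  | ha x x' h h' => simp only [mul_add', h, h']
  | hs c x h => simp only [mul_smul', h]
  | hd a => rw [one_eq, diagram_mul_diagram, loops_id_left, id_comp, pow_zero, one_smul]

theorem mul_one' (x : BrauerAlgebra n δ) : x * 1 = x := by
  induction x using diagram_induction with
  | h0 => simp only [zero_mul']
  | ha x x' h h' => simp only [add_mul', h, h']
  | hs c x h => simp only [smul_mul', h]
  | hd a => rw [one_eq, diagram_mul_diagram, loops_id_right, comp_id, pow_zero, one_smul]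

noncomputable instance : Ring (BrauerAlgebra n δ) :=
  { (inferInstance : AddCommGroup (BrauerAlgebra n δ)),
    (inferInstance : Mul (BrauerAlgebra n δ)), (inferInstance : One (BrauerAlgebra n δ)) with
    left_distrib := mul_add'
    right_distrib := add_mul'
    zero_mul := zero_mul'
    mul_zero := mul_zero'
    mul_assoc := mul_assoc'
    one_mul := one_mul'
    mul_one := mul_one' }

noncomputable instance : Algebra k (BrauerAlgebra n δ) :=
  Algebra.ofModule smul_mul' mul_smul'

/-- The augmentation: permutation diagrams (those with `n` propagating edges) are sent to `1`
and all other diagrams to `0`. -/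
noncomputable def augmentation (n : ℕ) (δ : k) : BrauerAlgebra n δ →ₐ[k] k :=
  AlgHom.ofLinearMap ((basis n δ).constr k fun d => if d.numPropagating = n then 1 else 0)
    (by rw [one_eq, ← basis_apply, Module.Basis.constr_basis, if_pos numPropagating_id])
    (by
      intro x y
      induction x using diagram_induction with
      | h0 => simp only [zero_mul, map_zero]
      | ha x x' h h' => simp only [add_mul, map_add, h, h']
      | hs c x h => simp only [smul_mul_assoc, map_smul, h]
      | hd a =>
        induction y using diagram_induction with
        | h0 => simp only [mul_zero, map_zero]
        | ha x x' h h' => simp only [mul_add, map_add, h, h']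
        | hs c x h => simp only [mul_smul_comm, map_smul, h]
        | hd b =>
          rw [diagram_mul_diagram, map_smul]
          simp only [← basis_apply, Module.Basis.constr_basis]
          by_cases ha : a.numPropagating = n
          · by_cases hb : b.numPropagating = n
            · obtain ⟨h1, h2⟩ := comp_of_permutation a b ha hb
              simp [ha, hb, h1, h2]
            · rw [if_neg (c := (comp a b).numPropagating = n), if_neg hb]
              · simp
              · intro h
                exact hb (le_antisymm (numPropagating_le b)
                  (h.symm.le.trans (numPropagating_comp_le_right a b)))
          · rw [if_neg (c := (comp a b).numPropagating = n), if_neg ha]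
            · simp
            · intro h
              exact ha (le_antisymm (numPropagating_le a)
                (h.symm.le.trans (numPropagating_comp_le_left a b))))

theorem augmentation_diagram (d : BrauerDiagram n) :
    augmentation n δ (diagram δ d) = if d.numPropagating = n then 1 else 0 :=
  (basis n δ).constr_basis k _ d

theorem mul_mem_span (S : Set (BrauerDiagram n))
    (hS : ∀ d₁ d₂, d₂ ∈ S → comp d₁ d₂ ∈ S) (x y : BrauerAlgebra n δ)
    (hy : y ∈ Submodule.span k (diagram δ '' S)) : x * y ∈ Submodule.span k (diagram δ '' S) := by
  induction x using diagram_induction with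
  | h0 => rw [zero_mul]; exact zero_mem _
  | ha x x' h h' => rw [add_mul]; exact add_mem h h'
  | hs c x h => rw [smul_mul_assoc]; exact Submodule.smul_mem _ _ h
  | hd a =>
    induction hy using Submodule.span_induction with
    | mem y h =>
      obtain ⟨d, hd, rfl⟩ := h
      rw [diagram_mul_diagram]
      exact Submodule.smul_mem _ _ (Submodule.subset_span ⟨_, hS a d hd, rfl⟩)
    | zero => rw [mul_zero]; exact zero_mem _
    | add x y _ _ hx hy => rw [mul_add]; exact add_mem hx hy
    | smul c x _ hx => rw [mul_smul_comm]; exact Submodule.smul_mem _ _ hx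

theorem mul_mem_span' (S : Set (BrauerDiagram n))
    (hS : ∀ d₁ d₂, d₁ ∈ S → comp d₁ d₂ ∈ S) (x y : BrauerAlgebra n δ)
    (hx : x ∈ Submodule.span k (diagram δ '' S)) : x * y ∈ Submodule.span k (diagram δ '' S) := by
  induction y using diagram_induction with
  | h0 => rw [mul_zero]; exact zero_mem _
  | ha x x' h h' => rw [mul_add]; exact add_mem h h'
  | hs c x h => rw [mul_smul_comm]; exact Submodule.smul_mem _ _ h
  | hd a =>
    induction hx using Submodule.span_induction with
    | mem y h =>
      obtain ⟨d, hd, rfl⟩ := h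
      rw [diagram_mul_diagram]
      exact Submodule.smul_mem _ _ (Submodule.subset_span ⟨_, hS d a hd, rfl⟩)
    | zero => rw [zero_mul]; exact zero_mem _
    | add x y _ _ hx hy => rw [add_mul]; exact add_mem hx hy
    | smul c x _ hx => rw [smul_mul_assoc]; exact Submodule.smul_mem _ _ hx

theorem mul_mem_span_of_mem (S : Set (BrauerDiagram n))
    (hS : ∀ d₁ d₂, d₁ ∈ S → d₂ ∈ S → comp d₁ d₂ ∈ S) (x y : BrauerAlgebra n δ)
    (hx : x ∈ Submodule.span k (diagram δ '' S)) (hy : y ∈ Submodule.span k (diagram δ '' S)) :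
    x * y ∈ Submodule.span k (diagram δ '' S) := by
  induction hx using Submodule.span_induction with
  | zero => rw [zero_mul]; exact zero_mem _
  | add x y _ _ hx hy => rw [add_mul]; exact add_mem hx hy
  | smul c x _ hx => rw [smul_mul_assoc]; exact Submodule.smul_mem _ _ hx
  | mem x h =>
    obtain ⟨d, hd, rfl⟩ := h
    induction hy using Submodule.span_induction with
    | zero => rw [mul_zero]; exact zero_mem _
    | add x y _ _ hx hy => rw [mul_add]; exact add_mem hx hy
    | smul c x _ hx => rw [mul_smul_comm]; exact Submodule.smul_mem _ _ hx
    | mem y h =>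
      obtain ⟨d', hd', rfl⟩ := h
      rw [diagram_mul_diagram]
      exact Submodule.smul_mem _ _ (Submodule.subset_span ⟨_, hS d d' hd hd', rfl⟩)

/-- The two-sided ideal `I_i` spanned `k`-linearly by the diagrams having at most `i`
propagating edges. -/
noncomputable def propagatingIdeal (n : ℕ) (δ : k) (i : ℕ) : Ideal (BrauerAlgebra n δ) :=
  { (Submodule.span k (diagram δ '' {d : BrauerDiagram n | d.numPropagating ≤ i})).toAddSubmonoid with
    smul_mem' := fun x y hy =>
      mul_mem_span {d | d.numPropagating ≤ i}
        (fun d₁ d₂ h => (numPropagating_comp_le_right d₁ d₂).trans h) x y hy }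

theorem mem_propagatingIdeal {i : ℕ} {x : BrauerAlgebra n δ} : x ∈ propagatingIdeal n δ i ↔
    x ∈ Submodule.span k (diagram δ '' {d : BrauerDiagram n | d.numPropagating ≤ i}) := Iff.rfl

instance (i : ℕ) : (propagatingIdeal n δ i).IsTwoSided :=
  ⟨fun y hx =>
    mem_propagatingIdeal.2 (mul_mem_span' {d | d.numPropagating ≤ i}
      (fun d₁ d₂ h => (numPropagating_comp_le_left d₁ d₂).trans h) _ y (mem_propagatingIdeal.1 hx))⟩

theorem augmentation_eq_zero {i : ℕ} (hi : i < n) {x : BrauerAlgebra n δ}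
    (hx : x ∈ propagatingIdeal n δ i) : augmentation n δ x = 0 := by
  rw [mem_propagatingIdeal] at hx
  induction hx using Submodule.span_induction with
  | mem y h =>
    obtain ⟨d, hd, rfl⟩ := h
    rw [augmentation_diagram, if_neg (fun h => by simp at hd; omega)]
  | zero => rw [map_zero]
  | add x y _ _ hx hy => rw [map_add, hx, hy, add_zero]
  | smul c x _ hx => rw [map_smul, hx, smul_zero]

end BrauerAlgebra

/-- The walled Brauer algebra `B_{r,s}(δ)`: the subalgebra of the Brauer algebra `B_{r+s}(δ)`
spanned `k`-linearly by the walled Brauer `(r+s)`-diagrams. -/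
noncomputable def walledBrauerAlgebra {k : Type u} [CommRing k] (r s : ℕ) (δ : k) :
    Subalgebra k (BrauerAlgebra (r + s) δ) :=
  (Submodule.span k (BrauerAlgebra.diagram δ '' {d : BrauerDiagram (r + s) | d.IsWalled r})).toSubalgebra
    (Submodule.subset_span ⟨_, BrauerDiagram.isWalled_id r, rfl⟩)
    (BrauerAlgebra.mul_mem_span_of_mem _ fun _ _ h1 h2 => BrauerDiagram.IsWalled.comp h1 h2)

namespace walledBrauerAlgebra

variable {k : Type u} [CommRing k]

/-- The augmentation of the walled Brauer algebra. -/
noncomputable def augmentation (r s : ℕ) (δ : k) : walledBrauerAlgebra r s δ →ₐ[k] k :=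
  (BrauerAlgebra.augmentation (r + s) δ).comp (walledBrauerAlgebra r s δ).val

/-- The two-sided ideal `B_{r,s}(δ) ∩ I_i` of the walled Brauer algebra. -/
noncomputable abbrev propagatingIdeal (r s : ℕ) (δ : k) (i : ℕ) :
    Ideal (walledBrauerAlgebra r s δ) :=
  (BrauerAlgebra.propagatingIdeal (r + s) δ i).comap (walledBrauerAlgebra r s δ).val

/-- The augmentation of the quotient `B_{r,s}(δ) / (B_{r,s}(δ) ∩ I_i)` for `i < r + s`, induced by
that of the walled Brauer algebra. -/
noncomputable def quotientAugmentation (r s : ℕ) (δ : k) (i : ℕ) (hi : i < r + s) :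
    (walledBrauerAlgebra r s δ ⧸ propagatingIdeal r s δ i) →ₐ[k] k :=
  Ideal.Quotient.liftₐ _ (augmentation r s δ) fun _ hx => BrauerAlgebra.augmentation_eq_zero hi hx

end walledBrauerAlgebra

namespace AugmentedAlgebra

open scoped TensorProduct

variable {k : Type u} [CommRing k] {A : Type u} [Ring A] [Algebra k A]

/-- A module over a `k`-algebra is a `k`-module by restriction of scalars. -/
@[reducible]
def moduleOfAlgebra (k : Type u) [CommRing k] {A : Type u} [Ring A] [Algebra k A]
    (M : ModuleCat.{u} A) : Module k M :=
  Module.restrictScalars k A M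

attribute [local instance] moduleOfAlgebra

theorem isScalarTower_moduleOfAlgebra (k : Type u) [CommRing k] {A : Type u} [Ring A] [Algebra k A]
    (M : ModuleCat.{u} A) : IsScalarTower k A M :=
  IsScalarTower.restrictScalars k A M

attribute [local instance] isScalarTower_moduleOfAlgebra

/-- The category of modules over a `k`-algebra is `k`-linear. -/
@[reducible]
noncomputable def linearModuleCat (k : Type u) [CommRing k] (A : Type u) [Ring A] [Algebra k A] :
    Linear k (ModuleCat.{u} A) where
  homModule _ _ := inferInstance

/-- The submodule of `M ⊗[k] N` generated by the elements `m a ⊗ n - m ⊗ a n`, where `M` is a right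
`A`-module and `N` is a left `A`-module. -/
def balancingSubmodule (k : Type u) [CommRing k] {A : Type u} [Ring A] [Algebra k A]
    (M : ModuleCat.{u} Aᵐᵒᵖ) (N : ModuleCat.{u} A) : Submodule k (M ⊗[k] N) :=
  Submodule.span k {t | ∃ (m : M) (a : A) (n : N),
    t = (MulOpposite.op a • m) ⊗ₜ[k] n - m ⊗ₜ[k] (a • n)}

theorem balancingSubmodule_le_comap (N : ModuleCat.{u} A) {M M' : ModuleCat.{u} Aᵐᵒᵖ}
    (f : M ⟶ M') : balancingSubmodule k M N ≤
      (balancingSubmodule k M' N).comap (LinearMap.rTensor N (f.hom.restrictScalars k)) := by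
  rw [balancingSubmodule, Submodule.span_le]
  rintro _ ⟨m, a, n, rfl⟩
  refine Submodule.subset_span ⟨f.hom m, a, n, ?_⟩
  simp

/-- The functor `M ↦ M ⊗_A N` from right `A`-modules to `k`-modules. -/
noncomputable def tensorFunctor (k : Type u) [CommRing k] {A : Type u} [Ring A] [Algebra k A]
    (N : ModuleCat.{u} A) : ModuleCat.{u} Aᵐᵒᵖ ⥤ ModuleCat.{u} k where
  obj M := ModuleCat.of k ((M ⊗[k] N) ⧸ balancingSubmodule k M N)
  map f := ModuleCat.ofHom (Submodule.mapQ _ _ (LinearMap.rTensor N (f.hom.restrictScalars k))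
    (balancingSubmodule_le_comap N f))
  map_id M := by
    ext x
    simp
  map_comp f g := by
    ext x
    simp

instance (N : ModuleCat.{u} A) : (tensorFunctor k N).Additive where
  map_add {M M'} f g := by
    ext x
    obtain ⟨t, rfl⟩ := Submodule.Quotient.mk_surjective _ x
    change Submodule.Quotient.mk (p := balancingSubmodule k M' N)
        (LinearMap.rTensor N ((f + g).hom.restrictScalars k) t) =
      Submodule.Quotient.mk (p := balancingSubmodule k M' N)
        (LinearMap.rTensor N (f.hom.restrictScalars k) t) +
      Submodule.Quotient.mk (p := balancingSubmodule k M' N)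
        (LinearMap.rTensor N (g.hom.restrictScalars k) t)
    rw [← Submodule.Quotient.mk_add, ← LinearMap.add_apply, ← LinearMap.rTensor_add]
    rfl

/-- `Tor_n^A(M, N)` for a right `A`-module `M` and a left `A`-module `N`: the left derived functors
of `- ⊗_A N`. -/
noncomputable def Tor (k : Type u) [CommRing k] {A : Type u} [Ring A] [Algebra k A] (n : ℕ)
    (M : ModuleCat.{u} Aᵐᵒᵖ) (N : ModuleCat.{u} A) : ModuleCat.{u} k :=
  ((tensorFunctor k N).leftDerived n).obj M

/-- `Ext^n_A(M, N)` for right `A`-modules `M` and `N`. -/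
noncomputable def Ext (k : Type u) [CommRing k] {A : Type u} [Ring A] [Algebra k A] (n : ℕ)
    (M N : ModuleCat.{u} Aᵐᵒᵖ) : ModuleCat.{u} k :=
  letI := linearModuleCat k Aᵐᵒᵖ
  ((_root_.Ext k (ModuleCat.{u} Aᵐᵒᵖ) n).obj (Opposite.op M)).obj N

/-- The trivial left module of an augmented algebra: `A` acts on `k` through the augmentation. -/
noncomputable def trivialLeft (τ : A →ₐ[k] k) : ModuleCat.{u} A :=
  (ModuleCat.restrictScalars τ.toRingHom).obj (ModuleCat.of k k)

/-- The trivial right module of an augmented algebra: `A` acts on `k` through the augmentation. -/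
noncomputable def trivialRight (τ : A →ₐ[k] k) : ModuleCat.{u} Aᵐᵒᵖ :=
  (ModuleCat.restrictScalars (τ.toRingHom.fromOpposite fun _ _ => Commute.all _ _)).obj
    (ModuleCat.of k k)

/-- The homology `Tor_n^A(𝟙, 𝟙)` of an augmented algebra. -/
noncomputable def homology (τ : A →ₐ[k] k) (n : ℕ) : ModuleCat.{u} k :=
  Tor k n (trivialRight τ) (trivialLeft τ)

/-- The cohomology `Ext^n_A(𝟙, 𝟙)` of an augmented algebra. -/
noncomputable def cohomology (τ : A →ₐ[k] k) (n : ℕ) : ModuleCat.{u} k :=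
  Ext k n (trivialRight τ) (trivialRight τ)

end AugmentedAlgebra

/-- The group `Σ_r × Σ_s`, in the universe `u`. -/
abbrev SymProd (r s : ℕ) : Type u :=
  ULift.{u} (Equiv.Perm (Fin r) × Equiv.Perm (Fin s))

/-! Let C be the walled Brauer algebra or its quotient by the diagrams without propagating edges, R
= Cᵐᵒᵖ (so that right C-modules are R-modules), G = Σ_r × Σ_s, and I the two-sided ideal of R
spanned by the diagrams that are not permutations. The permutation diagrams define v : G → R whose
span is a complement of I. This gives a retraction q : R → k[G] with kernel I, and the augmentation
factors through q (`exists_retraction_symProd`).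

Let P be a projective resolution of the trivial R-module. Each P_n / I P_n is projective over k[G],
and both the tensor product of P_n with the trivial module and the maps from P_n to it depend only
on P_n / I P_n. So it suffices that P / I P resolves the trivial representation; by the long exact
sequence of I P → P → P / I P this holds once I P is acyclic (`quotientResolution`).

For a set m of edges of the right-hand column let J_m be the right ideal of R spanned by the
diagrams containing m. Then I is the sum of the J_{p} over single edges p, and J_m ∩ J_m' = J_{m ∪
m'}. A Mayer–Vietoris induction (`AcyclicOn.sup`, `AcyclicOn.biUnion`) reduces the acyclicity of I P
to that of J_m P for nonempty m. If no diagram containing m has a propagating edge, then J_m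
vanishes in C. Otherwise J_m = eR for an idempotent e that is a left identity of J_m, so J_m P = e
P, and its only possible homology is e times the trivial module, which is zero.

The idempotent is built one edge at a time (`exists_right_identity`). A diagram through m with a
propagating edge has a right-hand vertex c that no edge of m meets. The `hook` diagram uses c to
insert an edge x – y, leaves the other edges of m alone, and fixes every diagram already containing
x – y. No loop closes up, so no power of δ appears and δ may be arbitrary. If r + s is odd, every
diagram has a propagating edge, because a column without one would be perfectly matched; the ideal
that is divided out is then zero. -/

/-! ### Subgroups J M of a projective module, described by linear forms. -/

section Coefficients

variable {R : Type*} [Ring R]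

/-- The elements of an `R`-module all of whose coefficients, that is, values under linear forms,
lie in `J`. For a projective module and a right ideal `J` this is `J M`. -/
def coeffSubgroup (J : AddSubgroup R) (M : Type*) [AddCommGroup M] [Module R M] :
    AddSubgroup M where
  carrier := {x | ∀ f : M →ₗ[R] R, f x ∈ J}
  zero_mem' f := by rw [map_zero]; exact J.zero_mem
  add_mem' hx hy f := by rw [map_add]; exact J.add_mem (hx f) (hy f)
  neg_mem' hx f := by rw [map_neg]; exact J.neg_mem (hx f)

variable {M N : Type*} [AddCommGroup M] [Module R M] [AddCommGroup N] [Module R N]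

theorem map_mem_coeffSubgroup {J : AddSubgroup R} (φ : M →ₗ[R] N) {x : M}
    (hx : x ∈ coeffSubgroup J M) : φ x ∈ coeffSubgroup J N := fun f => hx (f ∘ₗ φ)

theorem coeffSubgroup_mono {J K : AddSubgroup R} (h : J ≤ K) :
    coeffSubgroup J M ≤ coeffSubgroup K M := fun _ hx f => h (hx f)

/-- This is the reason for the description by linear forms: compatibility with intersections is
immediate, whereas for J M defined by generators it is a flatness statement. -/
theorem coeffSubgroup_inf (J K : AddSubgroup R) :
    coeffSubgroup (J ⊓ K) M = coeffSubgroup J M ⊓ coeffSubgroup K M := by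
  ext x
  exact ⟨fun h => ⟨fun f => (h f).1, fun f => (h f).2⟩, fun h f => ⟨h.1 f, h.2 f⟩⟩

theorem smul_mem_coeffSubgroup {J : AddSubgroup R} (hJ : ∀ a ∈ J, ∀ b, a * b ∈ J) {a : R}
    (ha : a ∈ J) (x : M) : a • x ∈ coeffSubgroup J M := fun f => by
  rw [map_smul]; exact hJ a ha _

/-- A dual basis of a projective module. -/
theorem exists_dual_basis (R M : Type*) [Ring R] [AddCommGroup M] [Module R M]
    [Module.Projective R M] :
    ∃ s : M →ₗ[R] M →₀ R, ∀ x, x = (s x).sum fun p a => a • p := by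
  obtain ⟨s, hs⟩ := Module.Projective.out (R := R) (P := M)
  exact ⟨s, fun x => (hs x).symm⟩

theorem dual_mem {J : AddSubgroup R} {x : M} (hx : x ∈ coeffSubgroup J M)
    (s : M →ₗ[R] M →₀ R) (p : M) : s x p ∈ J := hx (Finsupp.lapply p ∘ₗ s)

theorem coeffSubgroup_bot [Module.Projective R M] : coeffSubgroup (⊥ : AddSubgroup R) M = ⊥ := by
  obtain ⟨s, hs⟩ := exists_dual_basis R M
  rw [eq_bot_iff]
  intro x hx
  have h : s x = 0 := Finsupp.ext fun p => dual_mem hx s p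
  rw [AddSubgroup.mem_bot, hs x, h, Finsupp.sum_zero_index]

/-- The coordinates in a dual basis can be split one at a time. This is the surjectivity needed for
the Mayer–Vietoris sequence of J M and K M. -/
theorem mem_coeffSubgroup_sup [Module.Projective R M] {J K : AddSubgroup R}
    (hJ : ∀ a ∈ J, ∀ b, a * b ∈ J) (hK : ∀ a ∈ K, ∀ b, a * b ∈ K) {x : M}
    (hx : x ∈ coeffSubgroup (J ⊔ K) M) :
    ∃ y ∈ coeffSubgroup J M, ∃ z ∈ coeffSubgroup K M, y + z = x := by
  obtain ⟨s, hs⟩ := exists_dual_basis R M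
  rw [← AddSubgroup.mem_sup, hs x]
  refine sum_mem fun p _ => ?_
  obtain ⟨a, ha, b, hb, hab⟩ := AddSubgroup.mem_sup.1 (dual_mem hx s p)
  beta_reduce
  rw [← hab, add_smul]
  exact AddSubgroup.add_mem_sup (smul_mem_coeffSubgroup hJ ha p) (smul_mem_coeffSubgroup hK hb p)

theorem smul_eq_of_mem_coeffSubgroup [Module.Projective R M] {J : AddSubgroup R} {e : R}
    (he : ∀ a ∈ J, e * a = a) {x : M} (hx : x ∈ coeffSubgroup J M) : e • x = x := by
  obtain ⟨s, hs⟩ := exists_dual_basis R M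
  conv_rhs => rw [hs x]
  conv_lhs => rw [hs x]
  rw [Finsupp.smul_sum]
  refine Finset.sum_congr rfl fun p _ => ?_
  beta_reduce
  rw [smul_smul, he _ (dual_mem hx s p)]

/-- A dual basis expands an element with coefficients in I as a combination of vectors. Conversely a
linear form sends a y to a f(y), which stays in I because I is also a right ideal. -/
theorem coeffSubgroup_ideal [Module.Projective R M] (I : Ideal R) [I.IsTwoSided] :
    coeffSubgroup I.toAddSubgroup M = (I • (⊤ : Submodule R M)).toAddSubgroup := by
  ext x
  constructor
  · intro hx
    obtain ⟨s, hs⟩ := exists_dual_basis R M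
    rw [hs x]
    exact sum_mem fun p _ => Submodule.smul_mem_smul (dual_mem hx s p) trivial
  · intro hx
    change x ∈ I • (⊤ : Submodule R M) at hx
    exact Submodule.smul_induction_on hx
      (fun a ha y _ => smul_mem_coeffSubgroup (fun a ha b => I.mul_mem_right b ha) ha y)
      fun x y hx hy => add_mem hx hy

/-! ### Acyclicity of J M and Mayer–Vietoris. -/

/-- The subcomplex `J M` of a complex of projective modules is acyclic, `J` being a right ideal. -/
structure AcyclicOn {M : ℕ → Type*} [∀ n, AddCommGroup (M n)] [∀ n, Module R (M n)]
    (d : ∀ n, M (n + 1) →ₗ[R] M n) (J : AddSubgroup R) : Prop where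
  zero : ∀ x ∈ coeffSubgroup J (M 0), ∃ y ∈ coeffSubgroup J (M 1), d 0 y = x
  succ : ∀ n, ∀ x ∈ coeffSubgroup J (M (n + 1)), d n x = 0 →
    ∃ y ∈ coeffSubgroup J (M (n + 2)), d (n + 1) y = x

namespace AcyclicOn

variable {M : ℕ → Type*} [∀ n, AddCommGroup (M n)] [∀ n, Module R (M n)]
  [∀ n, Module.Projective R (M n)] {d : ∀ n, M (n + 1) →ₗ[R] M n}

theorem bot : AcyclicOn d ⊥ where
  zero x hx := by
    rw [coeffSubgroup_bot] at hx
    exact ⟨0, zero_mem _, by rw [map_zero, hx]⟩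
  succ n x hx _ := by
    rw [coeffSubgroup_bot] at hx
    exact ⟨0, zero_mem _, by rw [map_zero, hx]⟩

/-- Here J M = e M, and multiplying a preimage by e moves it into e M. Thus e M inherits exactness
in positive degrees, and `h0` says that e kills the homology in degree zero. -/
theorem of_idempotent {J : AddSubgroup R} (hJ : ∀ a ∈ J, ∀ b, a * b ∈ J) {e : R} (heJ : e ∈ J)
    (he : ∀ a ∈ J, e * a = a) (h0 : ∀ x, ∃ y, d 0 y = e • x)
    (hex : ∀ n x, d n x = 0 → ∃ y, d (n + 1) y = x) : AcyclicOn d J where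
  zero x hx := by
    obtain ⟨y, hy⟩ := h0 x
    refine ⟨e • y, smul_mem_coeffSubgroup hJ heJ y, ?_⟩
    rw [map_smul, hy, smul_smul, he e heJ, smul_eq_of_mem_coeffSubgroup he hx]
  succ n x hx hdx := by
    obtain ⟨y, hy⟩ := hex n x hdx
    refine ⟨e • y, smul_mem_coeffSubgroup hJ heJ y, ?_⟩
    rw [map_smul, hy, smul_eq_of_mem_coeffSubgroup he hx]

/-- Mayer–Vietoris for 0 → (J ∩ K) M → J M ⊕ K M → (J + K) M → 0, carried out on elements. -/
theorem sup {J K : AddSubgroup R} (hJ : ∀ a ∈ J, ∀ b, a * b ∈ J) (hK : ∀ a ∈ K, ∀ b, a * b ∈ K)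
    (hdd : ∀ n x, d n (d (n + 1) x) = 0)
    (aJ : AcyclicOn d J) (aK : AcyclicOn d K) (aJK : AcyclicOn d (J ⊓ K)) :
    AcyclicOn d (J ⊔ K) where
  zero x hx := by
    obtain ⟨y, hy, z, hz, rfl⟩ := mem_coeffSubgroup_sup hJ hK hx
    obtain ⟨y', hy', rfl⟩ := aJ.zero y hy
    obtain ⟨z', hz', rfl⟩ := aK.zero z hz
    exact ⟨y' + z', add_mem (coeffSubgroup_mono le_sup_left hy')
      (coeffSubgroup_mono le_sup_right hz'), map_add _ _ _⟩
  succ n x hx hdx := by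
    obtain ⟨y, hy, z, hz, rfl⟩ := mem_coeffSubgroup_sup hJ hK hx
    have hyz : d n y = - d n z := by rw [map_add] at hdx; exact eq_neg_of_add_eq_zero_left hdx
    -- The connecting map: a cycle y + z has dy = -dz, which lies in both subcomplexes. Bounding it
    -- by w in the intersection makes y - w and z + w cycles.
    have hmem : d n y ∈ coeffSubgroup (J ⊓ K) (M n) := by
      rw [coeffSubgroup_inf]
      refine ⟨map_mem_coeffSubgroup _ hy, ?_⟩
      rw [hyz]
      exact AddSubgroup.neg_mem _ (map_mem_coeffSubgroup _ hz)
    obtain ⟨w, hw, hdw⟩ : ∃ w ∈ coeffSubgroup (J ⊓ K) (M (n + 1)), d n w = d n y := by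
      cases n with
      | zero => exact aJK.zero _ hmem
      | succ n => exact aJK.succ n _ hmem (hdd n y)
    rw [coeffSubgroup_inf] at hw
    obtain ⟨y', hy', h1⟩ := aJ.succ n (y - w) (sub_mem hy hw.1) (by rw [map_sub, hdw, sub_self])
    obtain ⟨z', hz', h2⟩ := aK.succ n (z + w) (add_mem hz hw.2)
      (by rw [map_add, hdw, hyz, add_neg_cancel])
    refine ⟨y' + z', add_mem (coeffSubgroup_mono le_sup_left hy')
      (coeffSubgroup_mono le_sup_right hz'), ?_⟩
    rw [map_add, h1, h2]
    abel

/-- Acyclicity passes from a family of right ideals closed under intersections to finite sums, the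
ideals being those attached to the members of a family of sets. -/
theorem biUnion {X E ι : Type*} [DecidableEq E]
    (J : Set X → AddSubgroup R) (D : Finset E → Set X)
    (hD : ∀ s t, D (s ∪ t) = D s ∩ D t) (J_empty : J ∅ = ⊥)
    (J_union : ∀ U V, J (U ∪ V) = J U ⊔ J V) (J_inter : ∀ U V, J (U ∩ V) = J U ⊓ J V)
    (hJ : ∀ m, ∀ a ∈ J (D m), ∀ b, a * b ∈ J (D m))
    (hdd : ∀ n x, d n (d (n + 1) x) = 0)
    (h : ∀ m : Finset E, m.Nonempty → AcyclicOn d (J (D m)))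
    (s : Finset ι) (m : ι → Finset E) (hm : ∀ i ∈ s, (m i).Nonempty) :
    AcyclicOn d (J (⋃ i ∈ s, D (m i))) := by
  classical
  -- A sum of right ideals is a right ideal, which `sup` requires of both summands.
  have hU : ∀ (s : Finset ι) (m : ι → Finset E), ∀ a ∈ J (⋃ i ∈ s, D (m i)), ∀ b,
      a * b ∈ J (⋃ i ∈ s, D (m i)) := by
    intro s m
    induction s using Finset.induction_on with
    | empty => simp [J_empty]
    | insert i s _ ih =>
      intro a ha b
      rw [Finset.set_biUnion_insert, J_union] at ha ⊢
      obtain ⟨y, hy, z, hz, rfl⟩ := AddSubgroup.mem_sup.1 ha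
      rw [add_mul]
      exact AddSubgroup.add_mem_sup (hJ _ y hy b) (ih z hz b)
  induction s using Finset.induction_on generalizing m with
  | empty => simpa [J_empty] using bot
  | insert i s _ ih =>
    rw [Finset.set_biUnion_insert, J_union]
    refine sup (hJ _) (hU s m) hdd (h _ (hm i (Finset.mem_insert_self _ _)))
      (ih m fun j hj => hm j (Finset.mem_insert_of_mem hj)) ?_
    -- The intersection of D (m i) with the union is the union of the D (m i ∪ m j), j in s. It has
    -- no more terms than before, so the induction hypothesis applies to this new family; hence m is
    -- generalised.
    rw [← J_inter, Set.inter_iUnion₂]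
    simp only [← hD]
    exact ih (fun j => m i ∪ m j) fun j hj =>
      (hm i (Finset.mem_insert_self _ _)).mono Finset.subset_union_left

end AcyclicOn

end Coefficients

/-! ### The functor M ↦ M / I M to representations of G. -/

section QuotientRep

variable {k G : Type u} [CommRing k] [Group G] {R : Type u} [Ring R] [Algebra k R]
  (v : G →* R) (I : Ideal R)

theorem smul_top_le_comap {M N : Type*} [AddCommGroup M] [Module R M] [AddCommGroup N] [Module R N]
    (f : M →ₗ[R] N) : I • (⊤ : Submodule R M) ≤ (I • (⊤ : Submodule R N)).comap f := by
  rw [← Submodule.map_le_iff_le_comap, Submodule.map_smul'']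
  exact Submodule.smul_mono le_rfl le_top

section

variable {M N : Type u} [AddCommGroup M] [Module R M] [Module k M] [IsScalarTower k R M]
  [AddCommGroup N] [Module R N] [Module k N] [IsScalarTower k R N]

variable (k M) in
/-- The action of `G` on `M / I M` through `v : G →* R`. -/
noncomputable def quotientRepresentation :
    Representation k G (M ⧸ I • (⊤ : Submodule R M)) :=
  (MonoidHomClass.toMonoidHom (Algebra.lsmul k k (M ⧸ I • (⊤ : Submodule R M)))).comp v

variable (k) in
/-- The map `M / I M → N / I N` induced by an `R`-linear map `M → N`. -/
noncomputable def quotientRepresentationMap (f : M →ₗ[R] N) :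
    (quotientRepresentation k v I M).IntertwiningMap (quotientRepresentation k v I N) where
  toLinearMap := (Submodule.mapQ _ _ f (smul_top_le_comap I f)).restrictScalars k
  isIntertwining' g := LinearMap.ext fun x =>
    map_smul (Submodule.mapQ _ _ f (smul_top_le_comap I f)) (v g) x

theorem quotientRepresentationMap_id :
    quotientRepresentationMap k v I (LinearMap.id : M →ₗ[R] M) = .id _ :=
  Representation.IntertwiningMap.ext (LinearMap.ext fun x => by
    obtain ⟨x, rfl⟩ := Submodule.Quotient.mk_surjective _ x
    rfl)

theorem quotientRepresentationMap_comp {L : Type u} [AddCommGroup L] [Module R L] [Module k L]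
    [IsScalarTower k R L] (g : N →ₗ[R] L) (f : M →ₗ[R] N) :
    quotientRepresentationMap k v I (g ∘ₗ f) =
      (quotientRepresentationMap k v I g).comp (quotientRepresentationMap k v I f) :=
  Representation.IntertwiningMap.ext (LinearMap.ext fun x => by
    obtain ⟨x, rfl⟩ := Submodule.Quotient.mk_surjective _ x
    rfl)

theorem quotientRepresentationMap_add (f g : M →ₗ[R] N) :
    quotientRepresentationMap k v I (f + g) =
      quotientRepresentationMap k v I f + quotientRepresentationMap k v I g :=
  Representation.IntertwiningMap.ext (LinearMap.ext fun x => by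
    obtain ⟨x, rfl⟩ := Submodule.Quotient.mk_surjective _ x
    rfl)

end

/-- The functor `M ↦ M / I M` from `R`-modules to representations of `G`, where `G` acts through
`v : G →* R`. -/
noncomputable def quotientRep : ModuleCat.{u} R ⥤ Rep.{u} k G where
  obj M :=
    letI := AugmentedAlgebra.moduleOfAlgebra k M
    haveI := AugmentedAlgebra.isScalarTower_moduleOfAlgebra k M
    Rep.of (quotientRepresentation k v I M)
  map {M N} f :=
    letI := AugmentedAlgebra.moduleOfAlgebra k M
    haveI := AugmentedAlgebra.isScalarTower_moduleOfAlgebra k M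
    letI := AugmentedAlgebra.moduleOfAlgebra k N
    haveI := AugmentedAlgebra.isScalarTower_moduleOfAlgebra k N
    Rep.ofHom (quotientRepresentationMap k v I f.hom)
  map_id M :=
    letI := AugmentedAlgebra.moduleOfAlgebra k M
    haveI := AugmentedAlgebra.isScalarTower_moduleOfAlgebra k M
    congrArg Rep.ofHom (quotientRepresentationMap_id v I)
  map_comp {L M N} f g :=
    letI := AugmentedAlgebra.moduleOfAlgebra k L
    haveI := AugmentedAlgebra.isScalarTower_moduleOfAlgebra k L
    letI := AugmentedAlgebra.moduleOfAlgebra k M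
    haveI := AugmentedAlgebra.isScalarTower_moduleOfAlgebra k M
    letI := AugmentedAlgebra.moduleOfAlgebra k N
    haveI := AugmentedAlgebra.isScalarTower_moduleOfAlgebra k N
    congrArg Rep.ofHom (quotientRepresentationMap_comp v I g.hom f.hom)

instance : (quotientRep (k := k) v I).Additive where
  map_add {M N f g} :=
    letI := AugmentedAlgebra.moduleOfAlgebra k M
    haveI := AugmentedAlgebra.isScalarTower_moduleOfAlgebra k M
    letI := AugmentedAlgebra.moduleOfAlgebra k N
    haveI := AugmentedAlgebra.isScalarTower_moduleOfAlgebra k N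
    congrArg Rep.ofHom (quotientRepresentationMap_add v I f.hom g.hom)

variable {v I}

variable (k v I) in
/-- The quotient map `M → M / I M`. -/
noncomputable def quotientRepMk (M : ModuleCat.{u} R) :
    M →+ (quotientRep (k := k) v I).obj M :=
  (Submodule.mkQ (I • (⊤ : Submodule R M))).toAddMonoidHom

theorem quotientRepMk_surjective (M : ModuleCat.{u} R) :
    Function.Surjective (quotientRepMk k v I M) := fun z =>
  Submodule.Quotient.mk_surjective (I • (⊤ : Submodule R M)) z

theorem quotientRepMk_algebraMap_smul {M : ModuleCat.{u} R} (c : k) (x : M) :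
    quotientRepMk k v I M (algebraMap k R c • x) = c • quotientRepMk k v I M x := rfl

theorem quotientRepMk_smul {M : ModuleCat.{u} R} (g : G) (x : M) :
    quotientRepMk k v I M (v g • x) =
      ((quotientRep (k := k) v I).obj M).ρ g (quotientRepMk k v I M x) := rfl

theorem quotientRep_map_mk {M N : ModuleCat.{u} R} (f : M ⟶ N) (x : M) :
    ((quotientRep (k := k) v I).map f).hom (quotientRepMk k v I M x) =
      quotientRepMk k v I N (f.hom x) := rfl

theorem quotientRepMk_eq_zero {M : ModuleCat.{u} R} {x : M} :
    quotientRepMk k v I M x = 0 ↔ x ∈ I • (⊤ : Submodule R M) :=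
  Submodule.Quotient.mk_eq_zero _

/-- An additive map killing `I M` and compatible with the actions of `k` and `G` induces a morphism
on `M / I M`. -/
noncomputable def quotientRepDesc {M : ModuleCat.{u} R} {N : Rep.{u} k G} (f : M →+ N)
    (hI : ∀ a ∈ I, ∀ x, f (a • x) = 0) (hk : ∀ (c : k) x, f (algebraMap k R c • x) = c • f x)
    (hv : ∀ g x, f (v g • x) = N.ρ g (f x)) :
    (quotientRep (k := k) v I).obj M ⟶ N :=
  have hle : (I • (⊤ : Submodule R M)).toAddSubgroup ≤ f.ker := fun _ hx =>
    Submodule.smul_induction_on (p := fun x => f x = 0) hx (fun a ha x _ => hI a ha x)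
      fun x y hx hy => by rw [map_add, hx, hy, add_zero]
  let F : M ⧸ I • (⊤ : Submodule R M) →+ N :=
    QuotientAddGroup.lift (I • (⊤ : Submodule R M)).toAddSubgroup f hle
  letI := AugmentedAlgebra.moduleOfAlgebra k M
  haveI := AugmentedAlgebra.isScalarTower_moduleOfAlgebra k M
  Rep.ofHom (ρ := quotientRepresentation k v I M) (σ := N.ρ)
    { toFun := F
      map_add' := map_add F
      map_smul' := fun c z => by
        obtain ⟨x, rfl⟩ := quotientRepMk_surjective (k := k) (v := v) (I := I) M z
        exact hk c x
      isIntertwining' := fun g => LinearMap.ext fun z => by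
        obtain ⟨x, rfl⟩ := quotientRepMk_surjective (k := k) (v := v) (I := I) M z
        exact hv g x }

theorem quotientRep_hom_ext {M : ModuleCat.{u} R} {N : Rep.{u} k G}
    {f g : (quotientRep (k := k) v I).obj M ⟶ N}
    (h : ∀ x, f.hom (quotientRepMk k v I M x) = g.hom (quotientRepMk k v I M x)) : f = g :=
  Rep.hom_ext (Representation.IntertwiningMap.ext (LinearMap.ext fun z => by
    obtain ⟨x, rfl⟩ := quotientRepMk_surjective M z
    exact h x))

end QuotientRep

/-! ### Projectivity of M / I M over the group algebra. -/

section Projective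

variable {k G : Type u} [CommRing k] [Group G] {R : Type u} [Ring R] [Algebra k R]
  (v : G →* R) (q : R →ₐ[k] MonoidAlgebra k G) (hq : ∀ g, q (v g) = MonoidAlgebra.of k G g)

/-- The `R`-module given by a representation of `G` and an algebra homomorphism `R → k[G]`. -/
noncomputable def modOfRep (N : Rep.{u} k G) : ModuleCat.{u} R :=
  (ModuleCat.restrictScalars q.toRingHom).obj (Rep.toModuleMonoidAlgebra.obj N)

theorem modOfRep_smul (N : Rep.{u} k G) (a : R) (x : N) :
    (a • (show modOfRep q N from x) : modOfRep q N) = (N.ρ.asAlgebraHom (q a) x : N) := rfl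

include hq in
-- The linear extension of v is a section of q, so every element of R is an element of k[G] plus one
-- of ker q. Compatibility with R therefore only has to be checked on k, on G and on ker q.
theorem sub_lift_mem_ker (a : R) :
    a - MonoidAlgebra.lift k R G v (q a) ∈ RingHom.ker q := by
  have : q.comp (MonoidAlgebra.lift k R G v) = AlgHom.id k _ := by
    ext g
    simp [hq]
  rw [RingHom.mem_ker, map_sub, sub_eq_zero]
  exact (DFunLike.congr_fun this (q a)).symm

include hq in
-- One direction of the adjunction between M ↦ M / I M and restriction along q: a morphism out of M
-- / I M is an R-linear map from M to `modOfRep q N`.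
theorem hom_quotientRepMk_smul {M : ModuleCat.{u} R} {N : Rep.{u} k G}
    (f : (quotientRep (k := k) v (RingHom.ker q)).obj M ⟶ N) (a : R) (x : M) :
    f.hom (quotientRepMk k v _ M (a • x)) =
      N.ρ.asAlgebraHom (q a) (f.hom (quotientRepMk k v _ M x)) := by
  have h1 : ∀ y : MonoidAlgebra k G,
      f.hom (quotientRepMk k v _ M (MonoidAlgebra.lift k R G v y • x)) =
      N.ρ.asAlgebraHom y (f.hom (quotientRepMk k v _ M x)) := by
    intro y
    induction y using MonoidAlgebra.induction_on with
    | of g =>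
      rw [MonoidAlgebra.lift_of, quotientRepMk_smul, Rep.hom_comm_apply,
        Representation.asAlgebraHom_of]
    | add y z hy hz => simp only [map_add, add_smul, LinearMap.add_apply, hy, hz]
    | smul c y hy =>
      rw [map_smul (MonoidAlgebra.lift k R G v), Algebra.smul_def, mul_smul,
        quotientRepMk_algebraMap_smul, map_smul, hy, map_smul, LinearMap.smul_apply]
  have h2 : quotientRepMk k v (RingHom.ker q) M
      ((a - MonoidAlgebra.lift k R G v (q a)) • x) = 0 :=
    quotientRepMk_eq_zero.2 (Submodule.smul_mem_smul (sub_lift_mem_ker v q hq a) trivial)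
  rw [← h1, ← sub_eq_zero, ← map_sub, ← map_sub, ← sub_smul, h2, map_zero]

include hq in
-- A left adjoint preserves projectives when its right adjoint preserves epimorphisms. Restriction
-- along q does, since epimorphisms on both sides are the surjections: transpose the lifting problem
-- to R-modules, lift there, and descend the lift.
theorem quotientRep_projective (P : ModuleCat.{u} R) [Projective P] :
    Projective ((quotientRep (k := k) v (RingHom.ker q)).obj P) where
  factors {E X} f e he := by
    have hP : Module.Projective R P := (IsProjective.iff_projective P).2 inferInstance
    let f' : P →ₗ[R] modOfRep q X :=
      { toFun := fun x => f.hom (quotientRepMk k v _ P x)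
        map_add' := fun x y => by rw [map_add, map_add]; rfl
        map_smul' := fun a x => hom_quotientRepMk_smul v q hq f a x }
    let e' : modOfRep q E →ₗ[R] modOfRep q X :=
      ((ModuleCat.restrictScalars q.toRingHom).map (Rep.toModuleMonoidAlgebra.map e)).hom
    obtain ⟨l, hl⟩ := Module.projective_lifting_property e' f' ((Rep.epi_iff_surjective e).1 he)
    refine ⟨quotientRepDesc (l.toAddMonoidHom : P →+ E) (fun a ha x => ?_) (fun c x => ?_)
      (fun g x => ?_), ?_⟩
    · refine (map_smul l a x).trans ((modOfRep_smul q E _ _).trans ?_)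
      rw [(RingHom.mem_ker).1 ha, map_zero]
      rfl
    · refine (map_smul l _ x).trans ((modOfRep_smul q E _ _).trans ?_)
      rw [AlgHom.commutes, AlgHom.commutes]
      rfl
    · refine (map_smul l (v g) x).trans ((modOfRep_smul q E _ _).trans ?_)
      rw [hq, Representation.asAlgebraHom_of]
      rfl
    · exact quotientRep_hom_ext fun x => DFunLike.congr_fun hl x

end Projective

/-! ### Projective resolutions in terms of elements. -/

section Resolution

variable {R : Type u} [Ring R] {T : ModuleCat.{u} R} (P : ProjectiveResolution T)

/-- The differentials of a projective resolution, as linear maps. -/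
noncomputable def resolutionD (n : ℕ) : P.complex.X (n + 1) →ₗ[R] P.complex.X n :=
  (P.complex.d (n + 1) n).hom

/-- The augmentation of a projective resolution, as a linear map. -/
noncomputable def resolutionAug : P.complex.X 0 →ₗ[R] T := ModuleCat.Hom.hom (P.π.f 0)

instance (n : ℕ) : Module.Projective R (P.complex.X n) :=
  (IsProjective.iff_projective (R := R) (P.complex.X n)).2 (P.projective n)

theorem resolutionD_comp (n : ℕ) (x : P.complex.X (n + 2)) :
    resolutionD P n (resolutionD P (n + 1) x) = 0 :=
  DFunLike.congr_fun (congrArg ModuleCat.Hom.hom (P.complex.d_comp_d (n + 2) (n + 1) n)) x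

theorem resolutionAug_comp (x : P.complex.X 1) : resolutionAug P (resolutionD P 0 x) = 0 :=
  DFunLike.congr_fun (congrArg ModuleCat.Hom.hom P.complex_d_comp_π_f_zero) x

theorem resolutionD_exact (n : ℕ) (x : P.complex.X (n + 1)) (hx : resolutionD P n x = 0) :
    ∃ y, resolutionD P (n + 1) y = x :=
  (ShortComplex.moduleCat_exact_iff _).1 (P.exact_succ n) x hx

theorem resolutionAug_exact (x : P.complex.X 0) (hx : resolutionAug P x = 0) :
    ∃ y, resolutionD P 0 y = x :=
  (ShortComplex.moduleCat_exact_iff _).1 P.exact₀ x hx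

theorem resolutionAug_surjective : Function.Surjective (resolutionAug P) :=
  (ModuleCat.epi_iff_surjective (P.π.f 0)).1 inferInstance

end Resolution

/-! ### P / I P as a resolution of the trivial representation. -/

section QuotientResolution

variable {k G : Type u} [CommRing k] [Group G] {R : Type u} [Ring R] [Algebra k R]
  (v : G →* R) (q : R →ₐ[k] MonoidAlgebra k G) (hq : ∀ g, q (v g) = MonoidAlgebra.of k G g)
  {T : ModuleCat.{u} R} (P : ProjectiveResolution T) (t : T ≃+ k)
  (ht : ∀ (c : k) x, t (algebraMap k R c • x) = c * t x)
  (htv : ∀ g x, t (v g • x) = t x) (htI : ∀ a ∈ RingHom.ker q, ∀ x, t (a • x) = 0)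
  (hP : AcyclicOn (M := fun n => P.complex.X n) (resolutionD P) (RingHom.ker q).toAddSubgroup)

/-- The augmentation of the complex `P / I P`. -/
noncomputable def quotientResolutionAug :
    (quotientRep (k := k) v (RingHom.ker q)).obj (P.complex.X 0) ⟶ Rep.trivial k G k :=
  quotientRepDesc (N := Rep.trivial k G k) (t.toAddMonoidHom.comp (resolutionAug P).toAddMonoidHom)
    (fun a ha x => (congrArg t (map_smul (resolutionAug P) a x)).trans (htI a ha _))
    (fun c x => (congrArg t (map_smul (resolutionAug P) _ x)).trans (ht c _))
    (fun g x => (congrArg t (map_smul (resolutionAug P) _ x)).trans (htv g _))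

theorem quotientResolutionAug_mk (x : P.complex.X 0) :
    (quotientResolutionAug v q P t ht htv htI).hom (quotientRepMk k v _ _ x) =
      t (resolutionAug P x) := rfl

theorem quotientResolution_d_comp_aug :
    (quotientRep (k := k) v (RingHom.ker q)).map (P.complex.d 1 0) ≫
      quotientResolutionAug v q P t ht htv htI = 0 :=
  quotientRep_hom_ext fun x => (congrArg t (resolutionAug_comp P x)).trans (map_zero t)

theorem rep_exact {X Y Z : Rep.{u} k G} (f : X ⟶ Y) (g : Y ⟶ Z) (w : f ≫ g = 0)
    (h : ∀ y, g.hom y = 0 → ∃ x, f.hom x = y) : (ShortComplex.mk f g w).Exact :=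
  (forget₂ (Rep.{u} k G) (ModuleCat.{u} k)).reflects_exact_of_faithful _ <|
    (ShortComplex.moduleCat_exact_iff _).2 h

include hP in
-- This is the vanishing of H_{n+1}(P / I P) in the long exact sequence of I P → P → P / I P: P has
-- no homology in positive degrees, and I P has none at all.
theorem quotientResolution_exact_succ (n : ℕ)
    (y : (quotientRep (k := k) v (RingHom.ker q)).obj (P.complex.X (n + 1)))
    (hy : ((quotientRep (k := k) v (RingHom.ker q)).map (P.complex.d (n + 1) n)).hom y = 0) :
    ∃ x, ((quotientRep (k := k) v (RingHom.ker q)).map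
      (P.complex.d (n + 2) (n + 1))).hom x = y := by
  obtain ⟨y, rfl⟩ := quotientRepMk_surjective _ y
  rw [quotientRep_map_mk, quotientRepMk_eq_zero] at hy
  change resolutionD P n y ∈ (RingHom.ker q • (⊤ : Submodule R _)).toAddSubgroup at hy
  rw [← coeffSubgroup_ideal] at hy
  -- A cycle modulo I P has its boundary dy in I P. Acyclicity there gives z in I P with dz = dy, so
  -- y - z is a cycle of P with the same class as y.
  obtain ⟨z, hz, hdz⟩ : ∃ z ∈ coeffSubgroup (RingHom.ker q).toAddSubgroup (P.complex.X (n + 1)),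
      resolutionD P n z = resolutionD P n y := by
    cases n with
    | zero => exact hP.zero _ hy
    | succ n => exact hP.succ n _ hy (resolutionD_comp P n y)
  obtain ⟨x, hx⟩ := resolutionD_exact P n (y - z) (by rw [map_sub, hdz, sub_self])
  refine ⟨quotientRepMk k v _ _ x, ?_⟩
  rw [quotientRep_map_mk]
  change quotientRepMk k v _ _ (resolutionD P (n + 1) x) = _
  rw [hx, map_sub, sub_eq_self, quotientRepMk_eq_zero]
  rw [coeffSubgroup_ideal] at hz
  exact hz

/-- Acyclicity of I P plays no role here: the augmentation of P / I P pulls back to that of P, whose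
kernel is already the image of P_1. -/
theorem quotientResolution_exact_zero
    (y : (quotientRep (k := k) v (RingHom.ker q)).obj (P.complex.X 0))
    (hy : (quotientResolutionAug v q P t ht htv htI).hom y = 0) :
    ∃ x, ((quotientRep (k := k) v (RingHom.ker q)).map (P.complex.d 1 0)).hom x = y := by
  obtain ⟨y, rfl⟩ := quotientRepMk_surjective _ y
  rw [quotientResolutionAug_mk] at hy
  obtain ⟨x, rfl⟩ := resolutionAug_exact P y (t.injective (hy.trans (map_zero t).symm))
  exact ⟨quotientRepMk k v _ _ x, rfl⟩

/-- The augmentation of the complex `P / I P`, as a chain map. -/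
noncomputable def quotientResolutionπ :
    ((quotientRep (k := k) v (RingHom.ker q)).mapHomologicalComplex _).obj P.complex ⟶
      (ChainComplex.single₀ (Rep.{u} k G)).obj (Rep.trivial k G k) :=
  (ChainComplex.toSingle₀Equiv _ _).symm ⟨quotientResolutionAug v q P t ht htv htI,
    quotientResolution_d_comp_aug v q P t ht htv htI⟩

theorem quotientResolutionπ_f_zero : (quotientResolutionπ v q P t ht htv htI).f 0 =
    quotientResolutionAug v q P t ht htv htI :=
  ChainComplex.toSingle₀Equiv_symm_apply_f_zero
    (C := ((quotientRep (k := k) v (RingHom.ker q)).mapHomologicalComplex _).obj P.complex)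
    (quotientResolutionAug v q P t ht htv htI)
    (quotientResolution_d_comp_aug v q P t ht htv htI)

/-- The complex `P / I P` as a projective resolution of the trivial representation. -/
noncomputable def quotientResolution : ProjectiveResolution (Rep.trivial k G k) where
  complex := ((quotientRep (k := k) v (RingHom.ker q)).mapHomologicalComplex _).obj P.complex
  projective n := quotientRep_projective v q hq (P.complex.X n)
  π := quotientResolutionπ v q P t ht htv htI
  quasiIso := ⟨fun n => by
    cases n with
    | zero =>
      -- In degree 0 the condition is exactness of P_1 / I P_1 → P_0 / I P_0 → k together with
      -- surjectivity of the last map.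
      rw [ChainComplex.quasiIsoAt₀_iff, ShortComplex.quasiIso_iff_of_zeros']
      · refine (ShortComplex.exact_and_epi_g_iff_of_iso ?_).2
          ⟨rep_exact _ _ (quotientResolution_d_comp_aug v q P t ht htv htI)
            (quotientResolution_exact_zero v q P t ht htv htI),
            (Rep.epi_iff_surjective _).2 fun z => ?_⟩
        · exact ShortComplex.isoMk (Iso.refl _) (Iso.refl _) (Iso.refl _)
            ((Category.id_comp _).trans (Category.comp_id _).symm)
            ((Category.id_comp _).trans ((Category.comp_id _).trans
              (quotientResolutionπ_f_zero v q P t ht htv htI)).symm)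
        · obtain ⟨x, hx⟩ := resolutionAug_surjective P (t.symm z)
          refine ⟨quotientRepMk k v _ _ x, ?_⟩
          refine (quotientResolutionAug_mk v q P t ht htv htI x).trans ?_
          rw [hx]
          exact t.apply_symm_apply z
      · exact HomologicalComplex.shape
          (((quotientRep (k := k) v (RingHom.ker q)).mapHomologicalComplex _).obj P.complex)
          0 0 (Nat.succ_ne_zero 0)
      all_goals rfl
    | succ n =>
      -- In positive degrees the target complex is exact, so only exactness of P / I P remains.
      rw [quasiIsoAt_iff_exactAt']
      · rw [HomologicalComplex.exactAt_iff' _ (n + 2) (n + 1) n (by simp) (by simp)]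
        exact rep_exact _ _ _ (quotientResolution_exact_succ v q P hP n)
      · apply ChainComplex.exactAt_succ_single_obj⟩

end QuotientResolution

/-! ### Maps through which R acts by the augmentation. -/

section Comparison

open scoped TensorProduct

variable {k G : Type u} [CommRing k] [Group G] {A : Type u} [Ring A] [Algebra k A]
  (v : G →* Aᵐᵒᵖ) (q : Aᵐᵒᵖ →ₐ[k] MonoidAlgebra k G)
  (hq : ∀ g, q (v g) = MonoidAlgebra.of k G g) (τ : A →ₐ[k] k)
  (hv : ∀ g, τ (v g).unop = 1) (hI : ∀ a, q a = 0 → τ a.unop = 0)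

include hq hv hI in
-- Both sides agree for a in the span of v(G) and for a in ker q, and these together span. It turns
-- "G-invariant and zero on I M" into "linear for the augmentation".
theorem map_smul_of_invariant {M X : Type*} [AddCommGroup M] [Module Aᵐᵒᵖ M] [AddCommGroup X]
    [Module k X] (f : M →+ X) (fk : ∀ (c : k) x, f (algebraMap k Aᵐᵒᵖ c • x) = c • f x)
    (fv : ∀ g x, f (v g • x) = f x) (fI : ∀ a, q a = 0 → ∀ x, f (a • x) = 0) (a : Aᵐᵒᵖ) (x : M) :
    f (a • x) = τ a.unop • f x := by
  have h1 : ∀ y : MonoidAlgebra k G, f (MonoidAlgebra.lift k Aᵐᵒᵖ G v y • x) =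
      τ (MonoidAlgebra.lift k Aᵐᵒᵖ G v y).unop • f x := by
    intro y
    induction y using MonoidAlgebra.induction_on with
    | of g => rw [MonoidAlgebra.lift_of, fv, hv, one_smul]
    | add y z hy hz => simp only [map_add, add_smul, MulOpposite.unop_add, hy, hz]
    | smul c y hy =>
      rw [map_smul (MonoidAlgebra.lift k Aᵐᵒᵖ G v), MulOpposite.unop_smul, map_smul τ,
        Algebra.smul_def, mul_smul, fk, hy, smul_eq_mul, mul_smul]
  have h2 := sub_lift_mem_ker v q hq a
  rw [RingHom.mem_ker] at h2
  have h3 := fI _ h2 x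
  have h4 := hI _ h2
  rw [sub_smul, map_sub, sub_eq_zero, h1] at h3
  rw [MulOpposite.unop_sub, map_sub, sub_eq_zero] at h4
  rw [h3, h4]

/-- The trivial right module as an additive group. -/
def trivialRightEquiv : AugmentedAlgebra.trivialRight τ ≃+ k := AddEquiv.refl k

theorem trivialRightEquiv_smul (a : Aᵐᵒᵖ) (x : AugmentedAlgebra.trivialRight τ) :
    trivialRightEquiv τ (a • x) = τ a.unop * trivialRightEquiv τ x := rfl

/-- The trivial left module as an additive group. -/
def trivialLeftEquiv : AugmentedAlgebra.trivialLeft τ ≃+ k := AddEquiv.refl k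

theorem trivialLeftEquiv_smul (a : A) (x : AugmentedAlgebra.trivialLeft τ) :
    trivialLeftEquiv τ (a • x) = τ a * trivialLeftEquiv τ x := rfl

end Comparison

/-! ### Elements of M ⊗_A N. -/

section Tensor

open scoped TensorProduct
open AugmentedAlgebra

variable {k : Type u} [CommRing k] {A : Type u} [Ring A] [Algebra k A]

variable (k) in
/-- The class of a pure tensor in `M ⊗_A N`. -/
noncomputable def balancedMk (M : ModuleCat.{u} Aᵐᵒᵖ) (N : ModuleCat.{u} A) (m : M) (n : N) :
    (tensorFunctor k N).obj M :=
  letI := moduleOfAlgebra k M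
  letI := moduleOfAlgebra k N
  Submodule.Quotient.mk (p := balancingSubmodule k M N) (m ⊗ₜ[k] n)

variable {M M' : ModuleCat.{u} Aᵐᵒᵖ} {N : ModuleCat.{u} A}

theorem balancedMk_smul (a : A) (m : M) (n : N) :
    balancedMk k M N (MulOpposite.op a • m) n = balancedMk k M N m (a • n) := by
  let := moduleOfAlgebra k M
  let := moduleOfAlgebra k N
  exact (Submodule.Quotient.eq (balancingSubmodule k M N)).2
    (Submodule.subset_span ⟨m, a, n, rfl⟩)

theorem balancedMk_add_left (m m' : M) (n : N) :
    balancedMk k M N (m + m') n = balancedMk k M N m n + balancedMk k M N m' n := by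
  let := moduleOfAlgebra k M
  let := moduleOfAlgebra k N
  exact congrArg (Submodule.Quotient.mk (p := balancingSubmodule k M N))
    (TensorProduct.add_tmul m m' n)

theorem smul_balancedMk (c : k) (m : M) (n : N) :
    c • balancedMk k M N m n = balancedMk k M N m (algebraMap k A c • n) := by
  let := moduleOfAlgebra k M
  let := moduleOfAlgebra k N
  exact congrArg (Submodule.Quotient.mk (p := balancingSubmodule k M N))
    (TensorProduct.tmul_smul c m n).symm

theorem balancedMk_map (f : M ⟶ M') (m : M) (n : N) :
    ((tensorFunctor k N).map f).hom (balancedMk k M N m n) = balancedMk k M' N (f.hom m) n := rfl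

theorem balanced_induction {p : (tensorFunctor k N).obj M → Prop}
    (x : (tensorFunctor k N).obj M) (hmk : ∀ m n, p (balancedMk k M N m n))
    (hadd : ∀ x y, p x → p y → p (x + y)) : p x := by
  let := moduleOfAlgebra k M
  let := moduleOfAlgebra k N
  obtain ⟨t, rfl⟩ := Submodule.Quotient.mk_surjective (balancingSubmodule k M N) x
  induction t using TensorProduct.induction_on with
  | zero =>
    have := hmk 0 0
    rwa [balancedMk, TensorProduct.zero_tmul] at this
  | tmul m n => exact hmk m n
  | add x y hx hy => exact hadd _ _ hx hy

/-- A balanced map induces a linear map on `M ⊗_A N`. -/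
theorem exists_balanced_desc {X : Type u} [AddCommGroup X] [Module k X] (f : M → N → X)
    (h1 : ∀ m m' n, f (m + m') n = f m n + f m' n) (h2 : ∀ m n n', f m (n + n') = f m n + f m n')
    (h3 : ∀ (a : A) m n, f (MulOpposite.op a • m) n = f m (a • n))
    (h4 : ∀ (c : k) m n, f m (algebraMap k A c • n) = c • f m n) :
    ∃ F : (tensorFunctor k N).obj M →ₗ[k] X, ∀ m n, F (balancedMk k M N m n) = f m n := by
  let := moduleOfAlgebra k M
  let := moduleOfAlgebra k N
  -- Scalars in the first variable are moved to the second by balancedness, since k acts on both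
  -- modules through `algebraMap k A`.
  let B : M →ₗ[k] N →ₗ[k] X := LinearMap.mk₂ k f h1
    (fun c m n => (h3 (algebraMap k A c) m n).trans (h4 c m n)) h2 (fun c m n => h4 c m n)
  refine ⟨(balancingSubmodule k M N).liftQ (TensorProduct.lift B) ?_, fun m n => ?_⟩
  · rw [balancingSubmodule, Submodule.span_le]
    rintro _ ⟨m, a, n, rfl⟩
    rw [SetLike.mem_coe, LinearMap.mem_ker, map_sub, sub_eq_zero]
    exact h3 a m n
  · rfl

end Tensor

/-! ### M ⊗_A k as the coinvariants of M / I M. -/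

section TensorComparison

open AugmentedAlgebra Representation

variable {k G : Type u} [CommRing k] [Group G] {A : Type u} [Ring A] [Algebra k A]
  (v : G →* Aᵐᵒᵖ) (q : Aᵐᵒᵖ →ₐ[k] MonoidAlgebra k G)
  (hq : ∀ g, q (v g) = MonoidAlgebra.of k G g) (τ : A →ₐ[k] k)
  (hv : ∀ g, τ (v g).unop = 1) (hI : ∀ a, q a = 0 → τ a.unop = 0)

/-- The functor `M ↦ (k ⊗ M / I M)_G`. -/
noncomputable abbrev quotientCoinvariants : ModuleCat.{u} Aᵐᵒᵖ ⥤ ModuleCat.{u} k :=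
  quotientRep (k := k) v (RingHom.ker q) ⋙
    (Rep.coinvariantsTensor k G).obj (Rep.trivial k G k)

/-- The class of `1 ⊗ m`. -/
noncomputable def quotientCoinvariantsMk (M : ModuleCat.{u} Aᵐᵒᵖ) :
    M →+ (quotientCoinvariants v q).obj M :=
  (Rep.coinvariantsTensorMk (Rep.trivial k G k)
    ((quotientRep (k := k) v (RingHom.ker q)).obj M) (1 : k)).toAddMonoidHom.comp
    (quotientRepMk k v (RingHom.ker q) M)

theorem quotientCoinvariants_map {M M' : ModuleCat.{u} Aᵐᵒᵖ} (f : M ⟶ M') (m : M) :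
    ((quotientCoinvariants v q).map f).hom (quotientCoinvariantsMk v q M m) =
      quotientCoinvariantsMk v q M' (f.hom m) := rfl

include hq hv hI in
-- Coinvariants of k ⊗ (M / I M), with G trivial on k, identify v(g) m with m, and ker q is already
-- killed in the quotient; the preceding principle gives the rest.
theorem quotientCoinvariantsMk_smul {M : ModuleCat.{u} Aᵐᵒᵖ} (a : Aᵐᵒᵖ) (m : M) :
    quotientCoinvariantsMk v q M (a • m) = τ a.unop • quotientCoinvariantsMk v q M m := by
  refine map_smul_of_invariant v q hq τ hv hI (quotientCoinvariantsMk v q M)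
    (fun c x => ?_) (fun g x => ?_) (fun a ha x => ?_) a m
  · exact map_smul (Rep.coinvariantsTensorMk (Rep.trivial k G k)
      ((quotientRep (k := k) v (RingHom.ker q)).obj M) (1 : k)) c
      (quotientRepMk k v (RingHom.ker q) M x)
  · exact Coinvariants.mk_self_apply ((Rep.trivial k G k).ρ.tprod
      ((quotientRep (k := k) v (RingHom.ker q)).obj M).ρ) g
      ((1 : k) ⊗ₜ (quotientRepMk k v (RingHom.ker q) M x))
  · have : quotientRepMk k v (RingHom.ker q) M (a • x) = 0 :=
      quotientRepMk_eq_zero.2 (Submodule.smul_mem_smul ha trivial)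
    exact (congrArg (Rep.coinvariantsTensorMk (Rep.trivial k G k) _ (1 : k)) this).trans
      (map_zero _)

theorem quotientCoinvariants_hom_ext {M : ModuleCat.{u} Aᵐᵒᵖ} {X : Type*} [AddCommGroup X]
    [Module k X] {f g : (quotientCoinvariants v q).obj M →ₗ[k] X}
    (h : ∀ m, f (quotientCoinvariantsMk v q M m) = g (quotientCoinvariantsMk v q M m)) :
    f = g := by
  refine Coinvariants.hom_ext (TensorProduct.ext (LinearMap.ext_ring (LinearMap.ext fun z => ?_)))
  obtain ⟨m, rfl⟩ := quotientRepMk_surjective M z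
  exact h m

include hq hv hI in
-- The map is balanced because A acts through τ on both the trivial module and the class of 1 ⊗ m.
theorem exists_tensorToCoinvariants (M : ModuleCat.{u} Aᵐᵒᵖ) :
    ∃ F : (tensorFunctor k (trivialLeft τ)).obj M →ₗ[k] (quotientCoinvariants v q).obj M,
      ∀ m n, F (balancedMk k M _ m n) =
        trivialLeftEquiv τ n • quotientCoinvariantsMk v q M m := by
  refine exists_balanced_desc _ (fun m m' n => ?_) (fun m n n' => ?_) (fun a m n => ?_)
    (fun c m n => ?_)
  · rw [map_add, smul_add]
  · rw [map_add, add_smul]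
  · rw [quotientCoinvariantsMk_smul v q hq τ hv hI, trivialLeftEquiv_smul, smul_smul, mul_comm]
    rfl
  · rw [trivialLeftEquiv_smul, AlgHom.commutes, Algebra.algebraMap_self_apply, mul_smul]

theorem balancedMk_trivialLeft_smul {M : ModuleCat.{u} Aᵐᵒᵖ} (a : Aᵐᵒᵖ) (m : M)
    (n : trivialLeft τ) :
    balancedMk k M (trivialLeft τ) (a • m) n = τ a.unop • balancedMk k M (trivialLeft τ) m n := by
  rw [smul_balancedMk]
  refine (balancedMk_smul a.unop m n).trans
    (congrArg (balancedMk k M _ m) ((trivialLeftEquiv τ).injective ?_))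
  rw [trivialLeftEquiv_smul, trivialLeftEquiv_smul, AlgHom.commutes, Algebra.algebraMap_self_apply]

include hv hI in
-- The map m ↦ m ⊗ 1 turns the action of a into multiplication by τ(a). Hence it kills I M and is
-- G-invariant, so it descends first to M / I M and then to coinvariants.
theorem exists_coinvariantsToTensor (M : ModuleCat.{u} Aᵐᵒᵖ) :
    ∃ F : (quotientCoinvariants v q).obj M →ₗ[k] (tensorFunctor k (trivialLeft τ)).obj M,
      ∀ m, F (quotientCoinvariantsMk v q M m) =
        balancedMk k M (trivialLeft τ) m ((trivialLeftEquiv τ).symm 1) := by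
  let f : M →+ (tensorFunctor k (trivialLeft τ)).obj M :=
    AddMonoidHom.mk' (fun m => balancedMk k M (trivialLeft τ) m ((trivialLeftEquiv τ).symm 1))
      fun m m' => balancedMk_add_left m m' _
  have hf : ∀ (a : Aᵐᵒᵖ) m, f (a • m) = τ a.unop • f m := fun a m => balancedMk_trivialLeft_smul τ a m _
  let D : (quotientRep (k := k) v (RingHom.ker q)).obj M ⟶
      Rep.trivial k G ((tensorFunctor k (trivialLeft τ)).obj M) := quotientRepDesc
    (N := Rep.trivial k G ((tensorFunctor k (trivialLeft τ)).obj M)) f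
    (fun a ha m => (hf a m).trans (by rw [hI a ha, zero_smul]))
    (fun c m => (hf _ m).trans (by
      rw [MulOpposite.algebraMap_apply, MulOpposite.unop_op, AlgHom.commutes,
        Algebra.algebraMap_self_apply]))
    (fun g m => (hf _ m).trans (by rw [hv, one_smul]; rfl))
  let B : k →ₗ[k] ((quotientRep (k := k) v (RingHom.ker q)).obj M) →ₗ[k]
      (tensorFunctor k (trivialLeft τ)).obj M := LinearMap.toSpanSingleton k _ D.hom.toLinearMap
  refine ⟨Coinvariants.lift ((Rep.trivial k G k).ρ.tprod
      ((quotientRep (k := k) v (RingHom.ker q)).obj M).ρ) (TensorProduct.lift B) fun g => ?_,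
    fun m => ?_⟩
  · refine TensorProduct.ext (LinearMap.ext₂ fun c z => ?_)
    exact congrArg (c • ·) (Rep.hom_comm_apply D g z)
  · exact one_smul k (f m)

include hq hv hI in
/-- The functors `M ↦ M ⊗_A k` and `M ↦ (k ⊗ M / I M)_G` are isomorphic. -/
theorem nonempty_tensorFunctor_iso :
    Nonempty (tensorFunctor k (trivialLeft τ) ≅ quotientCoinvariants v q) := by
  choose F hF using exists_tensorToCoinvariants v q hq τ hv hI
  choose H hH using exists_coinvariantsToTensor v q τ hv hI
  have hFH : ∀ M y, F M (H M y) = y := fun M => DFunLike.congr_fun <|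
    quotientCoinvariants_hom_ext v q (f := (F M).comp (H M)) (g := LinearMap.id) fun m => by
      change F M (H M _) = _
      rw [hH, hF, AddEquiv.apply_symm_apply, one_smul]
      rfl
  have hHF : ∀ M x, H M (F M x) = x := fun M x => by
    induction x using balanced_induction with
    | hadd x y hx hy => rw [map_add, map_add, hx, hy]
    | hmk m n =>
      rw [hF, map_smul, hH, smul_balancedMk]
      refine congrArg (balancedMk k M _ m) ((trivialLeftEquiv τ).injective ?_)
      rw [trivialLeftEquiv_smul, AlgHom.commutes, Algebra.algebraMap_self_apply,
        AddEquiv.apply_symm_apply, mul_one]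
  let e : ∀ M, (tensorFunctor k (trivialLeft τ)).obj M ≃ₗ[k] (quotientCoinvariants v q).obj M :=
    fun M => { F M with invFun := H M, left_inv := hHF M, right_inv := hFH M }
  refine ⟨NatIso.ofComponents (fun M => (e M).toModuleIso) ?_⟩
  · intro M M' f
    refine ModuleCat.hom_ext (LinearMap.ext fun x => ?_)
    change F M' (((tensorFunctor k (trivialLeft τ)).map f).hom x) =
      ((quotientCoinvariants v q).map f).hom (F M x)
    induction x using balanced_induction with
    | hadd x y hx hy => rw [map_add, map_add, map_add, map_add, hx, hy]
    | hmk m n => rw [balancedMk_map, hF, hF, map_smul, quotientCoinvariants_map]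

end TensorComparison

/-! ### Tor and Ext as group homology and cohomology. -/

section AugmentedComparison

open AugmentedAlgebra

variable {k G : Type u} [CommRing k] [Group G] {A : Type u} [Ring A] [Algebra k A]
  (v : G →* Aᵐᵒᵖ) (q : Aᵐᵒᵖ →ₐ[k] MonoidAlgebra k G)
  (hq : ∀ g, q (v g) = MonoidAlgebra.of k G g) (τ : A →ₐ[k] k)
  (hv : ∀ g, τ (v g).unop = 1) (hI : ∀ a, q a = 0 → τ a.unop = 0)

/-- The complex `P / I P` as a projective resolution of the trivial representation, for a projective
resolution `P` of the trivial right module. -/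
noncomputable def trivialQuotientResolution (P : ProjectiveResolution (trivialRight τ))
    (hP : AcyclicOn (M := fun n => P.complex.X n) (resolutionD P) (RingHom.ker q).toAddSubgroup) :
    ProjectiveResolution (Rep.trivial k G k) :=
  quotientResolution v q hq P (trivialRightEquiv τ)
    (fun c x => by
      rw [trivialRightEquiv_smul, MulOpposite.algebraMap_apply, MulOpposite.unop_op,
        AlgHom.commutes, Algebra.algebraMap_self_apply])
    (fun g x => by rw [trivialRightEquiv_smul, hv, one_mul])
    (fun a ha x => by rw [trivialRightEquiv_smul, hI a ha, zero_mul]) hP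

include hq hv hI in
-- One complex computes both sides: tensoring P with the trivial left module gives the coinvariants
-- complex of P / I P, and P / I P is a projective resolution of the trivial representation.
theorem nonempty_homology_iso_groupHomology
    (hP : ∀ P : ProjectiveResolution (trivialRight τ),
      AcyclicOn (M := fun n => P.complex.X n) (resolutionD P) (RingHom.ker q).toAddSubgroup)
    (n : ℕ) : Nonempty (homology τ n ≅ groupHomology (Rep.trivial k G k) n) := by
  classical
  obtain ⟨P⟩ : Nonempty (ProjectiveResolution (trivialRight τ)) := HasProjectiveResolution.out
  obtain ⟨e⟩ := nonempty_tensorFunctor_iso v q hq τ hv hI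
  let Q := trivialQuotientResolution v q hq τ hv hI P (hP P)
  let c : ((tensorFunctor k (trivialLeft τ)).mapHomologicalComplex _).obj P.complex ≅
      Q.complex.coinvariantsTensorObj (Rep.trivial k G k) :=
    (NatIso.mapHomologicalComplex e (ComplexShape.down ℕ)).app P.complex
  exact ⟨P.isoLeftDerivedObj _ n ≪≫ (HomologicalComplex.homologyFunctor _ _ n).mapIso c ≪≫
    (groupHomologyIso (Rep.trivial k G k) n Q).symm⟩

attribute [local instance] linearModuleCat

include hq hv hI in
-- An R-linear map to the trivial module is the same as a G-invariant k-linear map vanishing on I M.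
-- The formula on classes is kept because it gives naturality in M.
theorem exists_quotientRep_homEquiv (M : ModuleCat.{u} Aᵐᵒᵖ) :
    ∃ e : (M ⟶ trivialRight τ) ≃ₗ[k]
        ((quotientRep (k := k) v (RingHom.ker q)).obj M ⟶ Rep.trivial k G k),
      ∀ f m, (e f).hom (quotientRepMk k v (RingHom.ker q) M m) =
        trivialRightEquiv τ (f.hom m) := by
  let F : (M ⟶ trivialRight τ) →
      ((quotientRep (k := k) v (RingHom.ker q)).obj M ⟶ Rep.trivial k G k) := fun f =>
    quotientRepDesc (N := Rep.trivial k G k)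
      ((trivialRightEquiv τ).toAddMonoidHom.comp f.hom.toAddMonoidHom)
      (fun a ha x => (congrArg (trivialRightEquiv τ) (map_smul f.hom a x)).trans (by
        rw [trivialRightEquiv_smul, hI a ha, zero_mul]))
      (fun c x => (congrArg (trivialRightEquiv τ) (map_smul f.hom _ x)).trans (by
        rw [trivialRightEquiv_smul, MulOpposite.algebraMap_apply, MulOpposite.unop_op,
          AlgHom.commutes, Algebra.algebraMap_self_apply]
        rfl))
      (fun g x => (congrArg (trivialRightEquiv τ) (map_smul f.hom _ x)).trans (by
        rw [trivialRightEquiv_smul, hv, one_mul]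
        rfl))
  have hF : ∀ f m, (F f).hom (quotientRepMk k v (RingHom.ker q) M m) =
      trivialRightEquiv τ (f.hom m) := fun f m => rfl
  let H : ((quotientRep (k := k) v (RingHom.ker q)).obj M ⟶ Rep.trivial k G k) →
      (M ⟶ trivialRight τ) := fun g => ModuleCat.ofHom (Y := trivialRight τ)
    { toFun := fun m => (trivialRightEquiv τ).symm
        (g.hom (quotientRepMk k v (RingHom.ker q) M m))
      map_add' := fun m m' => by rw [map_add, map_add]; exact map_add _ _ _
      map_smul' := fun a m => by
        change g.hom (quotientRepMk k v (RingHom.ker q) M (a • m)) =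
          τ a.unop • g.hom (quotientRepMk k v (RingHom.ker q) M m)
        let g' : M →+ k := AddMonoidHom.mk'
          (fun m => g.hom (quotientRepMk k v (RingHom.ker q) M m))
          (fun m m' => by rw [map_add, map_add])
        refine map_smul_of_invariant v q hq τ hv hI g' (fun c x => ?_) (fun h x => ?_)
          (fun b hb x => ?_) a m
        · change g.hom (quotientRepMk k v _ M _) = c • g.hom (quotientRepMk k v _ M _)
          rw [quotientRepMk_algebraMap_smul, map_smul]
        · exact Rep.hom_comm_apply g h (quotientRepMk k v (RingHom.ker q) M x)
        · change g.hom (quotientRepMk k v _ M _) = 0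
          rw [quotientRepMk_eq_zero.2 (Submodule.smul_mem_smul hb trivial), map_zero] }
  refine ⟨{ toFun := F
            map_add' := fun f g => quotientRep_hom_ext fun m => ?_
            map_smul' := fun c f => quotientRep_hom_ext fun m => ?_
            invFun := H
            left_inv := fun f => ?_
            right_inv := fun g => quotientRep_hom_ext fun m => rfl }, hF⟩
  · exact map_add (trivialRightEquiv τ) (f.hom m) (g.hom m)
  · refine (hF _ m).trans (Eq.trans ?_ (congrArg (c • ·) (hF f m)).symm)
    change trivialRightEquiv τ (algebraMap k Aᵐᵒᵖ c • f.hom m) = _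
    rw [trivialRightEquiv_smul, MulOpposite.algebraMap_apply, MulOpposite.unop_op,
      AlgHom.commutes, Algebra.algebraMap_self_apply]
    rfl
  · exact ModuleCat.hom_ext (LinearMap.ext fun m => rfl)

include hq hv hI in
theorem nonempty_cohomology_iso_groupCohomology
    (hP : ∀ P : ProjectiveResolution (trivialRight τ),
      AcyclicOn (M := fun n => P.complex.X n) (resolutionD P) (RingHom.ker q).toAddSubgroup)
    (n : ℕ) : Nonempty (cohomology τ n ≅ groupCohomology (Rep.trivial k G k) n) := by
  obtain ⟨P⟩ : Nonempty (ProjectiveResolution (trivialRight τ)) := HasProjectiveResolution.out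
  choose e he using exists_quotientRep_homEquiv v q hq τ hv hI
  let Q := trivialQuotientResolution v q hq τ hv hI P (hP P)
  let c : P.complex.linearYonedaObj k (trivialRight τ) ≅
      Q.complex.linearYonedaObj k (Rep.trivial k G k) :=
    HomologicalComplex.Hom.isoOfComponents (fun i => (e (P.complex.X i)).toModuleIso) (by
      rintro i j -
      refine ModuleCat.hom_ext (LinearMap.ext fun f => quotientRep_hom_ext fun m => ?_)
      exact (he _ f _).trans (he _ (P.complex.d j i ≫ f) m).symm)
  exact ⟨P.isoExt n (trivialRight τ) ≪≫ (HomologicalComplex.homologyFunctor _ _ n).mapIso c ≪≫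
    (groupCohomologyIso (Rep.trivial k G k) n Q).symm⟩

end AugmentedComparison

/-- A group mapping to an algebra whose span is a complement of a two-sided ideal defines a
retraction of the algebra to the group algebra. -/
theorem exists_retraction_of_isCompl {k G R : Type*} [CommRing k] [Group G] [Ring R] [Algebra k R]
    (v : G →* R) (I : Ideal R) [I.IsTwoSided]
    (hinj : ∀ y, MonoidAlgebra.lift k R G v y ∈ I → y = 0)
    (hsurj : ∀ a, ∃ y, a - MonoidAlgebra.lift k R G v y ∈ I) :
    ∃ q : R →ₐ[k] MonoidAlgebra k G, (∀ g, q (v g) = MonoidAlgebra.of k G g) ∧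
      RingHom.ker q = I := by
  -- The two hypotheses say that k[G] → R / I is injective and surjective; q is the projection to R
  -- / I followed by the inverse.
  let f := (Ideal.Quotient.mkₐ k I).comp (MonoidAlgebra.lift k R G v)
  have hf : Function.Bijective f := by
    constructor
    · refine (injective_iff_map_eq_zero f).2 fun y hy => hinj y ?_
      exact Ideal.Quotient.eq_zero_iff_mem.1 hy
    · intro z
      obtain ⟨a, rfl⟩ := Ideal.Quotient.mk_surjective z
      obtain ⟨y, hy⟩ := hsurj a
      exact ⟨y, ((Ideal.Quotient.mk_eq_mk_iff_sub_mem _ _).2 hy).symm⟩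
  let e := AlgEquiv.ofBijective f hf
  refine ⟨(e.symm : _ →ₐ[k] _).comp (Ideal.Quotient.mkₐ k I), fun g => ?_, ?_⟩
  · refine e.injective ((e.apply_symm_apply _).trans ?_)
    change _ = Ideal.Quotient.mk I (MonoidAlgebra.lift k R G v (MonoidAlgebra.of k G g))
    rw [MonoidAlgebra.lift_of]
    rfl
  · ext a
    rw [RingHom.mem_ker, ← Ideal.Quotient.eq_zero_iff_mem]
    exact map_eq_zero_iff e.symm e.symm.injective

/-! ### Hook diagrams and permutation diagrams. -/

namespace BrauerDiagram

variable {n : ℕ}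

/-- The diagram with edge `y – c` on the left, edge `x – y` on the right, an edge joining the left
`x` to the right `c`, and horizontal edges elsewhere. -/
def hook (x y c : Fin n) (hxy : x ≠ y) (hxc : x ≠ c) (hyc : y ≠ c) : BrauerDiagram n where
  mate w :=
    if w.1 = 0 then
      if w.2 = y then (0, c) else if w.2 = c then (0, y) else if w.2 = x then (1, c) else (1, w.2)
    else
      if w.2 = c then (0, x) else if w.2 = x then (1, y) else if w.2 = y then (1, x) else (0, w.2)
  mate_mate := by
    have := hxy.symm
    have := hxc.symm
    have := hyc.symm
    rintro ⟨j, i⟩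
    by_cases hx : i = x
    · subst hx; fin_cases j <;> simp [*]
    by_cases hy : i = y
    · subst hy; fin_cases j <;> simp [*]
    by_cases hc : i = c
    · subst hc; fin_cases j <;> simp [*]
    fin_cases j <;> simp [*]
  mate_ne := by
    have := hxy.symm
    have := hxc.symm
    have := hyc.symm
    rintro ⟨j, i⟩
    by_cases hx : i = x
    · subst hx; fin_cases j <;> simp [*]
    by_cases hy : i = y
    · subst hy; fin_cases j <;> simp [*]
    by_cases hc : i = c
    · subst hc; fin_cases j <;> simp [*]
    fin_cases j <;> simp [*]

section Hook

variable {x y c : Fin n} {hxy : x ≠ y} {hxc : x ≠ c} {hyc : y ≠ c}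

theorem hook_mate_left_y : (hook x y c hxy hxc hyc).mate (0, y) = (0, c) := by simp [hook]

theorem hook_mate_left_x : (hook x y c hxy hxc hyc).mate (0, x) = (1, c) := by
  simp [hook, hxy, hxc]

theorem hook_mate_right_x : (hook x y c hxy hxc hyc).mate (1, x) = (1, y) := by simp [hook, hxc]

theorem hook_mate_right_y : (hook x y c hxy hxc hyc).mate (1, y) = (1, x) := by
  simp [hook, hyc, hxy.symm]

theorem hook_mate_left {i : Fin n} (hx : i ≠ x) (hy : i ≠ y) (hc : i ≠ c) :
    (hook x y c hxy hxc hyc).mate (0, i) = (1, i) := by simp [hook, hx, hy, hc]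

theorem hook_mate_right {i : Fin n} (hx : i ≠ x) (hy : i ≠ y) (hc : i ≠ c) :
    (hook x y c hxy hxc hyc).mate (1, i) = (0, i) := by simp [hook, hx, hy, hc]

theorem hook_mate_left_c : (hook x y c hxy hxc hyc).mate (0, c) = (0, y) := by
  simp [hook, hyc.symm]

theorem hook_mate_right_c : (hook x y c hxy hxc hyc).mate (1, c) = (0, x) := by simp [hook]

/-- The propagating edge x – c needs its ends on one side of the wall; the edges y – c and x – y
need theirs on opposite sides. -/
theorem isWalled_hook {r : ℕ} (h1 : (x : ℕ) < r ↔ (c : ℕ) < r) (h2 : (y : ℕ) < r ↔ ¬ (c : ℕ) < r) :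
    (hook x y c hxy hxc hyc).IsWalled r := by
  rintro ⟨j, i⟩
  by_cases hx : i = x
  · subst hx
    fin_cases j
    · simp [hook_mate_left_x, h1]
    · simp [hook_mate_right_x, h1, h2]
  by_cases hy : i = y
  · subst hy
    fin_cases j
    · simp [hook_mate_left_y, h2]
    · simp [hook_mate_right_y, h1, h2]
  by_cases hc : i = c
  · subst hc
    fin_cases j
    · simp [hook_mate_left_c, h2]
    · simp [hook_mate_right_c, h1]
  fin_cases j
  · simp [hook_mate_left hx hy hc]
  · simp [hook_mate_right hx hy hc]

variable {d : BrauerDiagram n}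

theorem reachable_hook_of_ne (i : Fin n) (hx : i ≠ x) (hy : i ≠ y) (hc : i ≠ c) :
    (double d (hook x y c hxy hxc hyc)).Reachable (1, i) (2, i) := by
  have := reachable_right d (hook x y c hxy hxc hyc) (0, i)
  rwa [hook_mate_left hx hy hc] at this

theorem reachable_hook_x :
    (double d (hook x y c hxy hxc hyc)).Reachable (1, x) (2, c) := by
  have := reachable_right d (hook x y c hxy hxc hyc) (0, x)
  rwa [hook_mate_left_x] at this

theorem reachable_hook_y :
    (double d (hook x y c hxy hxc hyc)).Reachable (1, y) (1, c) := by
  have := reachable_right d (hook x y c hxy hxc hyc) (0, y)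
  rwa [hook_mate_left_y] at this

/-- The detour that replaces a horizontal edge at c: from c to y in the hook, from y to x by the
edge of d, and from x to the right-hand c in the hook. -/
theorem reachable_hook_c (h : d.mate (1, x) = (1, y)) :
    (double d (hook x y c hxy hxc hyc)).Reachable (1, c) (2, c) := by
  have := reachable_left d (hook x y c hxy hxc hyc) (1, x)
  rw [h] at this
  exact (reachable_hook_y.symm.trans this.symm).trans reachable_hook_x

theorem reachable_hook (h : d.mate (1, x) = (1, y)) (i : Fin n) :
    (double d (hook x y c hxy hxc hyc)).Reachable (1, i) (2, c) ∨
      (double d (hook x y c hxy hxc hyc)).Reachable (1, i) (2, i) := by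
  by_cases hx : i = x
  · exact Or.inl (hx ▸ reachable_hook_x)
  by_cases hy : i = y
  · subst hy
    exact Or.inl (reachable_hook_y.trans (reachable_hook_c h))
  by_cases hc : i = c
  · exact Or.inl (hc ▸ reachable_hook_c h)
  exact Or.inr (reachable_hook_of_ne i hx hy hc)

/-- Every middle vertex escapes to the right-hand column, so the product with a hook carries no
factor δ. -/
theorem loops_hook (h : d.mate (1, x) = (1, y)) : loops d (hook x y c hxy hxc hyc) = 0 :=
  loops_eq_zero _ _ fun i => by
    rcases reachable_hook (hxy := hxy) (hxc := hxc) (hyc := hyc) h i with h | h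
    · exact ⟨_, by simp, h⟩
    · exact ⟨_, by simp, h⟩

theorem comp_hook_mate_right_x : (comp d (hook x y c hxy hxc hyc)).mate (1, x) = (1, y) := by
  rw [comp_mate_right _ _ _ (by rw [hook_mate_right_x]), hook_mate_right_x]

theorem comp_hook_mate_right_y : (comp d (hook x y c hxy hxc hyc)).mate (1, y) = (1, x) := by
  rw [comp_mate_right _ _ _ (by rw [hook_mate_right_y]), hook_mate_right_y]

/-- The hook supplies the right-hand edge x – y, and every other right-hand vertex is connected
straight through to its middle copy, with the detour at c. -/
theorem comp_hook (h : d.mate (1, x) = (1, y)) : comp d (hook x y c hxy hxc hyc) = d := by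
  have hy' : d.mate (1, y) = (1, x) := by rw [← h, mate_mate]
  have key : ∀ w : Fin 2 × Fin n, w ≠ (1, x) → w ≠ (1, y) →
      (double d (hook x y c hxy hxc hyc)).Reachable (onColumns leftCols w)
        (onColumns outerCols w) := by
    rintro ⟨j, i⟩ hx hy
    fin_cases j
    · exact .refl _
    · have hx : i ≠ x := fun h => hx (by rw [h]; rfl)
      have hy : i ≠ y := fun h => hy (by rw [h]; rfl)
      by_cases hc : i = c
      · exact hc ▸ reachable_hook_c h
      · exact reachable_hook_of_ne i hx hy hc
  ext1
  funext w
  by_cases hx : w = (1, x)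
  · rw [hx, comp_hook_mate_right_x, h]
  by_cases hy : w = (1, y)
  · rw [hy, comp_hook_mate_right_y, hy']
  rw [comp_mate_eq_iff]
  refine ⟨mate_ne _ _, (key w hx hy).symm.trans ((reachable_left d _ w).trans (key _ ?_ ?_))⟩
  · intro h'
    exact hy (by rw [← d.mate_mate w, h', h])
  · intro h'
    exact hx (by rw [← d.mate_mate w, h', hy'])

/-- An edge of d avoiding x, y and c only meets horizontal edges of the hook. -/
theorem comp_hook_mate_right {a b : Fin n} (h : d.mate (1, a) = (1, b)) (hax : a ≠ x) (hay : a ≠ y)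
    (hac : a ≠ c) (hbx : b ≠ x) (hby : b ≠ y) (hbc : b ≠ c) :
    (comp d (hook x y c hxy hxc hyc)).mate (1, a) = (1, b) := by
  rw [comp_mate_eq_iff]
  refine ⟨h ▸ d.mate_ne _, ?_⟩
  have := reachable_left d (hook x y c hxy hxc hyc) (1, a)
  rw [h] at this
  exact (reachable_hook_of_ne a hax hay hac).symm.trans
    (this.trans (reachable_hook_of_ne b hbx hby hbc))

end Hook

/-! ### Permutation diagrams. -/

/-- The diagram joining the left `i` to the right `σ i`. -/
def ofPerm (σ : Equiv.Perm (Fin n)) : BrauerDiagram n where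
  mate w := if w.1 = 0 then (1, σ w.2) else (0, σ.symm w.2)
  mate_mate := by
    rintro ⟨j, i⟩
    fin_cases j <;> simp
  mate_ne := by
    rintro ⟨j, i⟩
    fin_cases j <;> simp

theorem ofPerm_mate_left (σ : Equiv.Perm (Fin n)) (i : Fin n) :
    (ofPerm σ).mate (0, i) = (1, σ i) := rfl

theorem ofPerm_mate_right (σ : Equiv.Perm (Fin n)) (i : Fin n) :
    (ofPerm σ).mate (1, i) = (0, σ.symm i) := rfl

theorem ofPerm_injective : Function.Injective (ofPerm (n := n)) := fun σ τ h =>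
  Equiv.ext fun i => by
    have := congrArg (fun d => (d.mate (0, i)).2) h
    exact this

theorem numPropagating_ofPerm (σ : Equiv.Perm (Fin n)) : (ofPerm σ).numPropagating = n := by
  unfold numPropagating
  rw [Finset.filter_true_of_mem, Finset.card_fin]
  intro i _
  rfl

theorem ext_left {d d' : BrauerDiagram n} (hd : d.numPropagating = n)
    (h : ∀ i, d.mate (0, i) = d'.mate (0, i)) : d = d' := by
  ext1
  funext ⟨j, i⟩
  fin_cases j
  · exact h i
  · have h0 := (mate_of_permutation d hd i).2
    obtain ⟨i', hi'⟩ : ∃ i', d.mate (1, i) = (0, i') := ⟨_, Prod.ext h0 rfl⟩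
    have h1 : d'.mate (0, i') = (1, i) := by rw [← h, ← hi', mate_mate]
    change d.mate (1, i) = d'.mate (1, i)
    rw [hi', ← h1, mate_mate]

/-- Diagrams are read from left to right, so σ is applied before τ and the order of multiplication
is reversed. -/
theorem ofPerm_comp (σ τ : Equiv.Perm (Fin n)) :
    comp (ofPerm σ) (ofPerm τ) = ofPerm (τ * σ) := by
  refine ext_left (comp_of_permutation _ _ (numPropagating_ofPerm σ)
    (numPropagating_ofPerm τ)).1 fun i => ?_
  rw [comp_mate_eq_iff]
  refine ⟨mate_ne _ _, ?_⟩
  exact (reachable_left (ofPerm σ) (ofPerm τ) (0, i)).trans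
    (reachable_right (ofPerm σ) (ofPerm τ) (0, σ i))

theorem loops_ofPerm (σ τ : Equiv.Perm (Fin n)) : loops (ofPerm σ) (ofPerm τ) = 0 :=
  (comp_of_permutation _ _ (numPropagating_ofPerm σ) (numPropagating_ofPerm τ)).2

theorem ofPerm_one : ofPerm (1 : Equiv.Perm (Fin n)) = idDiagram n :=
  ext_left (numPropagating_ofPerm 1) fun _ => rfl

theorem exists_ofPerm (d : BrauerDiagram n) (hd : d.numPropagating = n) :
    ∃ σ, d = ofPerm σ := by
  have h0 : ∀ i, d.mate (0, i) = (1, (d.mate (0, i)).2) := fun i =>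
    Prod.ext (mate_of_permutation d hd i).1 rfl
  have h1 : ∀ i, d.mate (1, i) = (0, (d.mate (1, i)).2) := fun i =>
    Prod.ext (mate_of_permutation d hd i).2 rfl
  exact ⟨⟨fun i => (d.mate (0, i)).2, fun i => (d.mate (1, i)).2,
    fun i => by simp only [← h0, mate_mate], fun i => by simp only [← h1, mate_mate]⟩,
    ext_left hd h0⟩

theorem isWalled_ofPerm_iff {r : ℕ} {σ : Equiv.Perm (Fin n)} :
    (ofPerm σ).IsWalled r ↔ ∀ i, (σ i : ℕ) < r ↔ (i : ℕ) < r := by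
  constructor
  · intro h i
    exact (h (0, i)).1 (by simp [ofPerm_mate_left])
  · rintro h ⟨j, i⟩
    fin_cases j
    · simpa [ofPerm_mate_left] using h i
    · simpa [ofPerm_mate_right] using (h (σ.symm i)).symm

theorem exists_propagating_right {d : BrauerDiagram n} (h : d.numPropagating ≠ 0) :
    ∃ c, (d.mate (1, c)).1 = 0 := by
  rw [numPropagating_eq, Finset.card_ne_zero] at h
  obtain ⟨c, hc⟩ := h
  exact ⟨c, (Finset.mem_filter.1 hc).2⟩

theorem numPropagating_lt_iff {d : BrauerDiagram n} :
    d.numPropagating < n ↔ ∃ a b, d.mate (1, a) = (1, b) := by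
  constructor
  · intro h
    by_contra! hne
    refine h.ne ?_
    rw [numPropagating_eq, Finset.filter_true_of_mem, Finset.card_fin]
    intro i _
    by_contra h0
    exact hne i (d.mate (1, i)).2 (Prod.ext (Fin.eq_one_of_ne_zero _ h0) rfl)
  · rintro ⟨a, b, h⟩
    refine lt_of_le_of_ne (numPropagating_le d) fun hd => ?_
    have := (mate_of_permutation d hd a).2
    rw [h] at this
    exact one_ne_zero this

end BrauerDiagram

/-! ### Walled diagrams with prescribed right-hand edges. -/

/-- The walled Brauer diagrams. -/
abbrev WalledBrauerDiagram (r s : ℕ) : Type := {d : BrauerDiagram (r + s) // d.IsWalled r}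

namespace WalledBrauerDiagram

variable {r s : ℕ}

/-- The composite of two walled Brauer diagrams. -/
noncomputable def comp (d₁ d₂ : WalledBrauerDiagram r s) : WalledBrauerDiagram r s :=
  ⟨BrauerDiagram.comp d₁.1 d₂.1, d₁.2.comp d₂.2⟩

/-- The walled diagrams containing given edges of the right-hand column. -/
def withEdges (m : Finset (Fin (r + s) × Fin (r + s))) : Set (WalledBrauerDiagram r s) :=
  {d | ∀ p ∈ m, d.1.mate (1, p.1) = (1, p.2)}

theorem withEdges_union (m m' : Finset (Fin (r + s) × Fin (r + s))) :
    withEdges (m ∪ m') = withEdges m ∩ withEdges m' := by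
  ext d
  simp only [withEdges, Finset.mem_union, Set.mem_inter_iff, Set.mem_ofPred_eq]
  exact ⟨fun h => ⟨fun p hp => h p (Or.inl hp), fun p hp => h p (Or.inr hp)⟩,
    fun h p hp => hp.elim (h.1 p) (h.2 p)⟩

/-- Right-hand edges of the second factor survive in a composite, so these diagrams span a left
ideal of the algebra and a right ideal of its opposite. -/
theorem comp_mem_withEdges {m : Finset (Fin (r + s) × Fin (r + s))}
    (d₁ d₂ : WalledBrauerDiagram r s) (h : d₂ ∈ withEdges m) : comp d₁ d₂ ∈ withEdges m :=
  fun p hp => (BrauerDiagram.comp_mate_right _ _ _ (by rw [h p hp])).trans (h p hp)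

/-- The walled diagrams with a non-propagating edge. -/
def nonPermutations (r s : ℕ) : Set (WalledBrauerDiagram r s) :=
  {d | d.1.numPropagating < r + s}

theorem withEdges_subset {m : Finset (Fin (r + s) × Fin (r + s))} (hm : m.Nonempty) :
    withEdges m ⊆ nonPermutations r s := fun _ hd =>
  BrauerDiagram.numPropagating_lt_iff.2 ⟨_, _, hd _ hm.choose_spec⟩

theorem nonPermutations_eq : nonPermutations r s = ⋃ p ∈ Finset.univ, withEdges {p} := by
  ext d
  simp [nonPermutations, withEdges, BrauerDiagram.numPropagating_lt_iff]

theorem comp_mem_nonPermutations_left {d₁ : WalledBrauerDiagram r s} (d₂ : WalledBrauerDiagram r s)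
    (h : d₁ ∈ nonPermutations r s) : comp d₁ d₂ ∈ nonPermutations r s :=
  (BrauerDiagram.numPropagating_comp_le_left _ _).trans_lt h

theorem comp_mem_nonPermutations_right (d₁ : WalledBrauerDiagram r s) {d₂ : WalledBrauerDiagram r s}
    (h : d₂ ∈ nonPermutations r s) : comp d₁ d₂ ∈ nonPermutations r s :=
  (BrauerDiagram.numPropagating_comp_le_right _ _).trans_lt h

/-- If a walled diagram contains the edges `m` and `p` of the right-hand column and has a
propagating edge, then composition with some walled diagram inserts the edge `p`, keeps the edges
`m` and fixes the diagrams which contain `p`. -/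
theorem exists_insert_edge {m : Finset (Fin (r + s) × Fin (r + s))} {p : Fin (r + s) × Fin (r + s)}
    {d₀ : WalledBrauerDiagram r s} (h₀ : d₀ ∈ withEdges (insert p m))
    (hd₀ : d₀.1.numPropagating ≠ 0) :
    ∃ h : WalledBrauerDiagram r s, (∀ d ∈ withEdges m, comp d h ∈ withEdges (insert p m)) ∧
      ∀ d ∈ withEdges {p}, BrauerDiagram.loops d.1 h.1 = 0 ∧ comp d h = d := by
  -- Since c is on a propagating edge of d₀, no edge of m or p ends at c.
  obtain ⟨c, hc⟩ := BrauerDiagram.exists_propagating_right hd₀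
  have hp : d₀.1.mate (1, p.1) = (1, p.2) := h₀ p (Finset.mem_insert_self _ _)
  have hp' : d₀.1.mate (1, p.2) = (1, p.1) := by rw [← hp, BrauerDiagram.mate_mate]
  have hne : ∀ a b, d₀.1.mate (1, a) = (1, b) → a ≠ c := by
    rintro a b h rfl
    rw [h] at hc
    exact one_ne_zero hc
  have hmate : ∀ a b, d₀.1.mate (1, a) = (1, b) → d₀.1.mate (1, b) = (1, a) := fun a b h => by
    rw [← h, BrauerDiagram.mate_mate]
  have hwall : ∀ a b, d₀.1.mate (1, a) = (1, b) → ((b : ℕ) < r ↔ ¬ (a : ℕ) < r) := fun a b h => by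
    have := (d₀.2 (1, a)).2
    rw [h] at this
    exact this rfl
  -- The ends of p lie on opposite sides of the wall; x is the one on the side of c, which makes the
  -- hook walled.
  obtain ⟨x, y, hxy, hxc, hpxy⟩ : ∃ x y, d₀.1.mate (1, x) = (1, y) ∧
      ((x : ℕ) < r ↔ (c : ℕ) < r) ∧ (p = (x, y) ∨ p = (y, x)) := by
    by_cases h : (p.1 : ℕ) < r ↔ (c : ℕ) < r
    · exact ⟨p.1, p.2, hp, h, Or.inl rfl⟩
    · refine ⟨p.2, p.1, hp', ?_, Or.inr rfl⟩
      have := hwall _ _ hp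
      tauto
  have ne1 : x ≠ y := by
    rintro rfl
    exact d₀.1.mate_ne _ hxy
  have ne2 := hne _ _ hxy
  have ne3 := hne _ _ (hmate _ _ hxy)
  let h : WalledBrauerDiagram r s := ⟨BrauerDiagram.hook x y c ne1 ne2 ne3,
    BrauerDiagram.isWalled_hook hxc ((hwall _ _ hxy).trans (not_congr hxc))⟩
  have hx : ∀ d : WalledBrauerDiagram r s, (comp d h).1.mate (1, x) = (1, y) := fun d =>
    BrauerDiagram.comp_hook_mate_right_x (hxy := ne1) (hxc := ne2) (hyc := ne3)
  have hy : ∀ d : WalledBrauerDiagram r s, (comp d h).1.mate (1, y) = (1, x) := fun d =>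
    BrauerDiagram.comp_hook_mate_right_y (hxy := ne1) (hxc := ne2) (hyc := ne3)
  refine ⟨h, fun d hd e he => ?_, fun d hd => ?_⟩
  · rcases Finset.mem_insert.1 he with rfl | hem
    · rcases hpxy with rfl | rfl
      · exact hx d
      · exact hy d
    -- An edge of m through x or y must be p, possibly reversed, because d₀ contains both. Any other
    -- edge avoids x, y and c.
    obtain ⟨a, b⟩ := e
    have h1 : d₀.1.mate (1, a) = (1, b) := h₀ _ he
    by_cases hax : a = x
    · subst hax
      obtain rfl : y = b := congrArg Prod.snd (hxy.symm.trans h1)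
      exact hx d
    by_cases hay : a = y
    · subst hay
      obtain rfl : x = b := congrArg Prod.snd ((hmate _ _ hxy).symm.trans h1)
      exact hy d
    refine BrauerDiagram.comp_hook_mate_right (hxy := ne1) (hxc := ne2) (hyc := ne3) (hd _ hem) hax hay
      (hne _ _ h1) ?_ ?_ (hne _ _ (hmate _ _ h1))
    · rintro rfl
      exact hay (congrArg Prod.snd ((hmate _ _ h1).symm.trans hxy))
    · rintro rfl
      exact hax (congrArg Prod.snd ((hmate _ _ h1).symm.trans (hmate _ _ hxy)))
  · have hdp : d.1.mate (1, p.1) = (1, p.2) := hd p (Finset.mem_singleton_self p)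
    have hd' : d.1.mate (1, x) = (1, y) := by
      rcases hpxy with rfl | rfl
      · exact hdp
      · rw [← hdp, BrauerDiagram.mate_mate]
    exact ⟨BrauerDiagram.loops_hook (hxy := ne1) (hxc := ne2) (hyc := ne3) hd', Subtype.ext
      (BrauerDiagram.comp_hook (hxy := ne1) (hxc := ne2) (hyc := ne3) hd')⟩

end WalledBrauerDiagram

/-! ### Diagram bases and right identities. -/

namespace walledBrauerAlgebra

open WalledBrauerDiagram

variable {k : Type u} [CommRing k] {r s : ℕ} {δ : k}

variable (δ) in
/-- A walled diagram, as an element of the walled Brauer algebra. -/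
noncomputable def diagram (d : WalledBrauerDiagram r s) : walledBrauerAlgebra r s δ :=
  ⟨BrauerAlgebra.diagram δ d.1, Submodule.subset_span ⟨_, d.2, rfl⟩⟩

theorem diagram_mul_diagram (d₁ d₂ : WalledBrauerDiagram r s) :
    diagram δ d₁ * diagram δ d₂ =
      δ ^ BrauerDiagram.loops d₁.1 d₂.1 • diagram δ (WalledBrauerDiagram.comp d₁ d₂) :=
  Subtype.ext (BrauerAlgebra.diagram_mul_diagram d₁.1 d₂.1)

theorem augmentation_diagram (d : WalledBrauerDiagram r s) :
    augmentation r s δ (diagram δ d) = if d.1.numPropagating = r + s then 1 else 0 :=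
  BrauerAlgebra.augmentation_diagram d.1

/-- In the diagram basis of the whole Brauer algebra, b is supported on walled diagrams and on S,
hence on their intersection. -/
theorem mem_span_diagram {S : Set (BrauerDiagram (r + s))} {b : walledBrauerAlgebra r s δ}
    (hb : (b : BrauerAlgebra (r + s) δ) ∈ Submodule.span k (BrauerAlgebra.diagram δ '' S)) :
    b ∈ Submodule.span k (diagram δ '' {d : WalledBrauerDiagram r s | d.1 ∈ S}) := by
  have h1 : (b : BrauerAlgebra (r + s) δ) ∈
      Submodule.span k (BrauerAlgebra.basis (r + s) δ '' {d | d.IsWalled r}) := b.2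
  have h2 : (b : BrauerAlgebra (r + s) δ) ∈
      Submodule.span k (BrauerAlgebra.basis (r + s) δ '' S) := hb
  rw [Module.Basis.mem_span_image] at h1 h2
  have h3 := ((BrauerAlgebra.basis (r + s) δ).mem_span_image).2 (Set.subset_inter h1 h2)
  have h4 : BrauerAlgebra.basis (r + s) δ '' ({d | d.IsWalled r} ∩ S) ⊆
      (walledBrauerAlgebra r s δ).val.toLinearMap ''
        (diagram δ '' {d : WalledBrauerDiagram r s | d.1 ∈ S}) := by
    rintro _ ⟨d, ⟨hd, hS⟩, rfl⟩
    exact ⟨_, ⟨⟨d, hd⟩, hS, rfl⟩, rfl⟩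
  have h5 := Submodule.span_mono (R := k) h4 h3
  rw [← Submodule.map_span] at h5
  obtain ⟨b', hb', h⟩ := h5
  obtain rfl : b' = b := Subtype.ext h
  exact hb'

variable (r s δ) in
theorem linearIndependent_diagram :
    LinearIndependent k (diagram (r := r) (s := s) δ) := by
  have h := (BrauerAlgebra.basis (r + s) δ).linearIndependent.comp
    (Subtype.val : WalledBrauerDiagram r s → _) Subtype.val_injective
  have e : BrauerAlgebra.basis (r + s) δ ∘ (Subtype.val : WalledBrauerDiagram r s → _) =
      (walledBrauerAlgebra r s δ).val.toLinearMap ∘ diagram δ := rfl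
  rw [e] at h
  exact LinearIndependent.of_comp (walledBrauerAlgebra r s δ).val.toLinearMap h

variable (r s δ) in
/-- The walled diagrams form a basis of the walled Brauer algebra. -/
noncomputable def basis :
    Module.Basis (WalledBrauerDiagram r s) k (walledBrauerAlgebra r s δ) :=
  Module.Basis.mk (v := diagram δ)
    (linearIndependent_diagram r s δ)
    (fun b _ => by
      have := mem_span_diagram (S := Set.univ) (b := b) (by
        rw [Set.image_univ, BrauerAlgebra.span_diagram]
        trivial)
      rwa [show {d : WalledBrauerDiagram r s | d.1 ∈ Set.univ} = Set.univ from
        Set.eq_univ_of_forall fun _ => trivial, Set.image_univ] at this)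

theorem basis_apply (d : WalledBrauerDiagram r s) : basis r s δ d = diagram δ d :=
  Module.Basis.mk_apply _ _ d

theorem span_diagram :
    Submodule.span k (Set.range (diagram (r := r) (s := s) δ)) = ⊤ := by
  rw [← (basis r s δ).span_eq]
  exact congrArg _ (congrArg _ (funext fun d => (basis_apply d).symm))

theorem mem_propagatingIdeal {i : ℕ} {b : walledBrauerAlgebra r s δ} :
    b ∈ propagatingIdeal r s δ i ↔ b ∈ Submodule.span k
      (diagram δ '' {d : WalledBrauerDiagram r s | d.1.numPropagating ≤ i}) := by
  constructor
  · intro h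
    exact mem_span_diagram (S := {d | d.numPropagating ≤ i})
      (BrauerAlgebra.mem_propagatingIdeal.1 h)
  · intro h
    refine BrauerAlgebra.mem_propagatingIdeal.2 ?_
    have h' := Submodule.mem_map_of_mem (f := (walledBrauerAlgebra r s δ).val.toLinearMap) h
    rw [Submodule.map_span] at h'
    refine Submodule.span_mono ?_ h'
    rintro _ ⟨_, ⟨d, hd, rfl⟩, rfl⟩
    exact ⟨d.1, hd, rfl⟩

theorem mul_mem_span_left {U : Set (WalledBrauerDiagram r s)}
    (hU : ∀ d₁, ∀ d₂ ∈ U, WalledBrauerDiagram.comp d₁ d₂ ∈ U) (a : walledBrauerAlgebra r s δ)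
    {b : walledBrauerAlgebra r s δ} (hb : b ∈ Submodule.span k (diagram δ '' U)) :
    a * b ∈ Submodule.span k (diagram δ '' U) := by
  have ha : a ∈ Submodule.span k (Set.range (diagram δ)) := span_diagram.ge trivial
  have h := Submodule.mul_mem_mul ha hb
  rw [Submodule.span_mul_span] at h
  refine Submodule.span_le.2 ?_ h
  rintro _ ⟨_, ⟨d₁, rfl⟩, _, ⟨d₂, h₂, rfl⟩, rfl⟩
  change diagram δ d₁ * diagram δ d₂ ∈ _
  rw [diagram_mul_diagram]
  exact Submodule.smul_mem _ _ (Submodule.subset_span ⟨_, hU _ _ h₂, rfl⟩)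

theorem mul_mem_span_right {U V : Set (WalledBrauerDiagram r s)} {d₂ : WalledBrauerDiagram r s}
    (hU : ∀ d₁ ∈ U, WalledBrauerDiagram.comp d₁ d₂ ∈ V)
    {b : walledBrauerAlgebra r s δ} (hb : b ∈ Submodule.span k (diagram δ '' U)) :
    b * diagram δ d₂ ∈ Submodule.span k (diagram δ '' V) := by
  have h := Submodule.mul_mem_mul hb (Submodule.mem_span_singleton_self (R := k) (diagram δ d₂))
  rw [Submodule.span_mul_span] at h
  refine Submodule.span_le.2 ?_ h
  rintro _ ⟨_, ⟨d₁, h₁, rfl⟩, _, rfl, rfl⟩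
  change diagram δ d₁ * diagram δ d₂ ∈ _
  rw [diagram_mul_diagram]
  exact Submodule.smul_mem _ _ (Submodule.subset_span ⟨_, hU _ h₁, rfl⟩)

/-- Right multiplication by a suitable element in the span of the diagrams containing the edges `m`
fixes all such diagrams, provided one of them has a propagating edge. -/
theorem exists_right_identity (m : Finset (Fin (r + s) × Fin (r + s)))
    {d₀ : WalledBrauerDiagram r s} (h₀ : d₀ ∈ withEdges m) (hd₀ : d₀.1.numPropagating ≠ 0) :
    ∃ e ∈ Submodule.span k (diagram δ '' withEdges m),
      ∀ b ∈ Submodule.span k (diagram δ '' withEdges m), b * e = b := by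
  suffices h : ∃ e ∈ Submodule.span k (diagram δ '' withEdges m),
      ∀ d ∈ withEdges m, diagram δ d * e = diagram δ d by
    obtain ⟨e, he, h⟩ := h
    refine ⟨e, he, fun b hb => ?_⟩
    have key : Submodule.span k (diagram δ '' withEdges m) ≤
        LinearMap.eqLocus (LinearMap.mulRight k e) LinearMap.id := by
      refine Submodule.span_le.2 ?_
      rintro _ ⟨d, hd, rfl⟩
      exact h d hd
    exact key hb
  induction m using Finset.induction_on with
  | empty =>
    refine ⟨1, ?_, fun d _ => mul_one _⟩
    have h : (1 : walledBrauerAlgebra r s δ) ∈ Submodule.span k (Set.range (diagram δ)) :=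
      span_diagram.ge trivial
    refine Submodule.span_mono ?_ h
    rintro _ ⟨d, rfl⟩
    exact ⟨d, fun p hp => absurd hp (Finset.notMem_empty p), rfl⟩
  | insert p m _ ih =>
    obtain ⟨e, he, hid⟩ := ih fun q hq => h₀ q (Finset.mem_insert_of_mem hq)
    obtain ⟨h, h1, h2⟩ := exists_insert_edge h₀ hd₀
    -- Right multiplication by h inserts p into every diagram of e. For d containing m and p, d e h
    -- = d h = d: e fixes d because of m, and h fixes it because of p.
    refine ⟨e * diagram δ h, mul_mem_span_right h1 he, fun d hd => ?_⟩
    obtain ⟨h3, h4⟩ := h2 d fun q hq => hd q (Finset.mem_singleton.1 hq ▸ Finset.mem_insert_self _ _)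
    rw [← mul_assoc, hid d fun q hq => hd q (Finset.mem_insert_of_mem hq), diagram_mul_diagram, h3,
      h4, pow_zero, one_smul]

theorem augmentation_eq_zero {b : walledBrauerAlgebra r s δ}
    (hb : b ∈ Submodule.span k (diagram δ '' nonPermutations r s)) : augmentation r s δ b = 0 := by
  refine Submodule.span_le (p := LinearMap.ker (augmentation r s δ).toLinearMap).2 ?_ hb
  rintro _ ⟨d, hd, rfl⟩
  exact (augmentation_diagram d).trans (if_neg (ne_of_lt hd))

end walledBrauerAlgebra

/-! ### Parity of diagrams without propagating edges. -/

namespace BrauerDiagram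

/-- The edges restrict to a fixed-point-free involution of the left column, so its vertices cancel
in pairs modulo 2. -/
theorem even_of_numPropagating_eq_zero {n : ℕ} {d : BrauerDiagram n} (h : d.numPropagating = 0) :
    Even n := by
  have h0 : ∀ i, d.mate (0, i) = (0, (d.mate (0, i)).2) := fun i => by
    refine Prod.ext ?_ rfl
    by_contra h1
    refine (Finset.filter_eq_empty_iff.1 (Finset.card_eq_zero.1 h)) (Finset.mem_univ i) ?_
    exact Fin.eq_one_of_ne_zero _ h1
  have hs : ∑ _i : Fin n, (1 : ZMod 2) = 0 :=
    Finset.sum_involution (fun i _ => (d.mate (0, i)).2) (fun _ _ => by decide)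
      (fun i _ _ hi => d.mate_ne (0, i) ((h0 i).trans (by rw [hi]))) (fun _ _ => Finset.mem_univ _)
      (fun i _ => by simp only [← h0, mate_mate])
  rw [Finset.sum_const, Finset.card_univ, Fintype.card_fin, nsmul_eq_mul, mul_one] at hs
  exact (ZMod.natCast_eq_zero_iff_even).1 hs

end BrauerDiagram

/-! ### Spans of diagrams in an image of the algebra, and their acyclicity. -/

namespace walledBrauerAlgebra

open WalledBrauerDiagram AugmentedAlgebra

variable {k : Type u} [CommRing k] {r s : ℕ} {δ : k}

theorem propagatingIdeal_zero_eq_bot (h : Odd (r + s)) : propagatingIdeal r s δ 0 = ⊥ := by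
  rw [eq_bot_iff]
  intro b hb
  have e : {d : WalledBrauerDiagram r s | d.1.numPropagating ≤ 0} = ∅ :=
    Set.eq_empty_of_forall_notMem fun d hd => Nat.not_even_iff_odd.2 h
      (BrauerDiagram.even_of_numPropagating_eq_zero (Nat.le_zero.1 hd))
  rw [mem_propagatingIdeal, e, Set.image_empty, Submodule.span_empty] at hb
  exact hb

theorem mem_span_diagram_inter {U V : Set (WalledBrauerDiagram r s)}
    {b : walledBrauerAlgebra r s δ} (hU : b ∈ Submodule.span k (diagram δ '' U))
    (hV : b ∈ Submodule.span k (diagram δ '' V)) :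
    b ∈ Submodule.span k (diagram δ '' (U ∩ V)) := by
  have e : diagram δ = basis r s δ := funext fun d => (basis_apply d).symm
  rw [e] at hU hV ⊢
  exact (basis r s δ).mem_span_image.2 (Set.subset_inter ((basis r s δ).mem_span_image.1 hU)
    ((basis r s δ).mem_span_image.1 hV))

section Surjection

variable {C : Type u} [Ring C] [Algebra k C] (π : walledBrauerAlgebra r s δ →ₐ[k] C)

/-- The additive subgroup of the opposite of an image of the walled Brauer algebra spanned by the
classes of the diagrams in a given set. -/
noncomputable def opSpan (U : Set (WalledBrauerDiagram r s)) : AddSubgroup Cᵐᵒᵖ :=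
  ((Submodule.span k (diagram δ '' U)).map
    ((MulOpposite.opLinearEquiv k).toLinearMap ∘ₗ π.toLinearMap)).toAddSubgroup

variable {π}

theorem opSpan_empty : opSpan π ∅ = ⊥ := by
  rw [opSpan, Set.image_empty, Submodule.span_empty, Submodule.map_bot]
  rfl

theorem opSpan_union (U V : Set (WalledBrauerDiagram r s)) :
    opSpan π (U ∪ V) = opSpan π U ⊔ opSpan π V := by
  rw [opSpan, Set.image_union, Submodule.span_union, Submodule.map_sup, Submodule.sup_toAddSubgroup]
  rfl

theorem map_eq_zero_of_mem_span (hπ : ∀ b, π b = 0 ↔ b ∈ propagatingIdeal r s δ 0)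
    {U : Set (WalledBrauerDiagram r s)} (hU : ∀ d ∈ U, d.1.numPropagating = 0)
    {b : walledBrauerAlgebra r s δ} (hb : b ∈ Submodule.span k (diagram δ '' U)) : π b = 0 := by
  rw [hπ, mem_propagatingIdeal]
  exact Submodule.span_mono (Set.image_mono fun d hd => (hU d hd).le) hb

/-- A linear map need not respect intersections; π does on spans of diagrams because its kernel is
itself spanned by diagrams. -/
theorem opSpan_inter (hπ : ∀ b, π b = 0 ↔ b ∈ propagatingIdeal r s δ 0)
    (U V : Set (WalledBrauerDiagram r s)) : opSpan π (U ∩ V) = opSpan π U ⊓ opSpan π V := by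
  ext a
  constructor
  · rintro ⟨b, hb, rfl⟩
    exact ⟨⟨b, Submodule.span_mono (Set.image_mono Set.inter_subset_left) hb, rfl⟩,
      ⟨b, Submodule.span_mono (Set.image_mono Set.inter_subset_right) hb, rfl⟩⟩
  · rintro ⟨⟨b, hb, rfl⟩, c, hc, hbc⟩
    have h1 : π (b - c) = 0 := by
      rw [map_sub, sub_eq_zero]
      exact (MulOpposite.op_injective hbc).symm
    rw [hπ, mem_propagatingIdeal] at h1
    -- b = (b - c) + c is supported on U and on V together with the diagrams without propagating
    -- edges. Its part on the latter dies under π, leaving a part on U ∩ V.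
    have h2 := Submodule.add_mem_sup h1 hc
    rw [sub_add_cancel, ← Submodule.span_union, ← Set.image_union] at h2
    have h3 := mem_span_diagram_inter hb h2
    rw [Set.inter_union_distrib_left, Set.image_union, Submodule.span_union] at h3
    obtain ⟨y, hy, z, hz, rfl⟩ := Submodule.mem_sup.1 h3
    refine ⟨z, hz, ?_⟩
    change MulOpposite.op (π z) = MulOpposite.op (π (y + z))
    rw [map_add, map_eq_zero_of_mem_span hπ (fun d hd => Nat.le_zero.1 hd.2) hy, zero_add]

theorem mul_mem_opSpan (hsurj : Function.Surjective π) {U : Set (WalledBrauerDiagram r s)}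
    (hU : ∀ d₁, ∀ d₂ ∈ U, comp d₁ d₂ ∈ U) (a : Cᵐᵒᵖ) (ha : a ∈ opSpan π U) (c : Cᵐᵒᵖ) :
    a * c ∈ opSpan π U := by
  obtain ⟨b, hb, rfl⟩ := ha
  obtain ⟨b', hb'⟩ := hsurj c.unop
  refine ⟨b' * b, mul_mem_span_left hU b' hb, ?_⟩
  change MulOpposite.op (π (b' * b)) = MulOpposite.op (π b) * c
  rw [map_mul, MulOpposite.op_mul, hb', MulOpposite.op_unop]

theorem mul_mem_opSpan_nonPermutations (hsurj : Function.Surjective π) (c : Cᵐᵒᵖ) {a : Cᵐᵒᵖ}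
    (ha : a ∈ opSpan π (nonPermutations r s)) : c * a ∈ opSpan π (nonPermutations r s) := by
  obtain ⟨b, hb, rfl⟩ := ha
  obtain ⟨b', hb'⟩ := hsurj c.unop
  refine ⟨b * b', ?_, ?_⟩
  · have hb1 : b' ∈ Submodule.span k (Set.range (diagram δ)) := span_diagram.ge trivial
    clear hb'
    induction hb1 using Submodule.span_induction with
    | mem x hx =>
      obtain ⟨d, rfl⟩ := hx
      exact mul_mem_span_right (fun d₁ h₁ => comp_mem_nonPermutations_left d h₁) hb
    | zero => rw [mul_zero]; exact zero_mem _
    | add x y _ _ hx hy => rw [mul_add]; exact add_mem hx hy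
    | smul c x _ hx => rw [mul_smul_comm]; exact Submodule.smul_mem _ _ hx
  · change MulOpposite.op (π (b * b')) = c * MulOpposite.op (π b)
    rw [map_mul, MulOpposite.op_mul, hb', MulOpposite.op_unop]

/-- The ideal of the opposite algebra spanned by the diagrams which are not permutations. -/
noncomputable def nonPermutationIdeal (hsurj : Function.Surjective π) : Ideal Cᵐᵒᵖ :=
  { (opSpan π (nonPermutations r s)).toAddSubmonoid with
    smul_mem' := fun c _ ha => mul_mem_opSpan_nonPermutations hsurj c ha }

instance (hsurj : Function.Surjective π) : (nonPermutationIdeal hsurj).IsTwoSided :=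
  ⟨fun c ha => mul_mem_opSpan hsurj
    (fun d₁ _ h => comp_mem_nonPermutations_right d₁ h) _ ha c⟩

section Acyclic

variable (hsurj : Function.Surjective π) (hπ : ∀ b, π b = 0 ↔ b ∈ propagatingIdeal r s δ 0)
  (τ : C →ₐ[k] k) (hτ : ∀ b, τ (π b) = augmentation r s δ b)
  (P : ProjectiveResolution (trivialRight τ))

include hsurj hπ hτ in
-- If no diagram containing m propagates, the ideal is zero in C. Otherwise the right identity, read
-- in the opposite algebra, is a left identity, and it acts by zero on the trivial module because m
-- is nonempty.
theorem acyclicOn_opSpan_withEdges {m : Finset (Fin (r + s) × Fin (r + s))} (hm : m.Nonempty) :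
    AcyclicOn (M := fun n => P.complex.X n) (resolutionD P) (opSpan π (withEdges m)) := by
  by_cases h : ∀ d ∈ withEdges (r := r) m, d.1.numPropagating = 0
  · have : opSpan π (withEdges m) = ⊥ := by
      rw [eq_bot_iff]
      rintro _ ⟨b, hb, rfl⟩
      exact congrArg MulOpposite.op (map_eq_zero_of_mem_span hπ h hb)
    rw [this]
    exact AcyclicOn.bot
  push Not at h
  obtain ⟨d₀, h₀, hd₀⟩ := h
  obtain ⟨e, he, hid⟩ := exists_right_identity (k := k) (δ := δ) m h₀ hd₀
  refine AcyclicOn.of_idempotent (e := MulOpposite.op (π e))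
    (mul_mem_opSpan hsurj fun d₁ d₂ h => comp_mem_withEdges d₁ d₂ h) ⟨e, he, rfl⟩ ?_ (fun x => ?_)
    (resolutionD_exact P)
  · rintro _ ⟨b, hb, rfl⟩
    change MulOpposite.op (π e) * MulOpposite.op (π b) = MulOpposite.op (π b)
    rw [← MulOpposite.op_mul, ← map_mul, hid b hb]
  -- The augmentation of e x is τ(e) times that of x, hence zero, so e x is a boundary.
  · refine resolutionAug_exact P _ ((trivialRightEquiv τ).injective ?_)
    rw [map_smul, trivialRightEquiv_smul, MulOpposite.unop_op, hτ, augmentation_eq_zero, zero_mul,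
      map_zero]
    exact Submodule.span_mono (Set.image_mono (withEdges_subset hm)) he

include hsurj hπ hτ in
theorem acyclicOn_opSpan_nonPermutations :
    AcyclicOn (M := fun n => P.complex.X n) (resolutionD P) (opSpan π (nonPermutations r s)) := by
  rw [nonPermutations_eq]
  exact AcyclicOn.biUnion (opSpan π) withEdges withEdges_union opSpan_empty opSpan_union
    (opSpan_inter hπ) (fun m => mul_mem_opSpan hsurj fun d₁ d₂ h => comp_mem_withEdges d₁ d₂ h)
    (resolutionD_comp P) (fun m hm => acyclicOn_opSpan_withEdges hsurj hπ τ hτ P hm)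
    Finset.univ _ fun p _ => Finset.singleton_nonempty p

end Acyclic

end Surjection

end walledBrauerAlgebra

/-! ### Walled permutation diagrams and Σ_r × Σ_s. -/

namespace WalledBrauerDiagram

variable {r s : ℕ}

variable (r s) in
/-- The action of `Σ_r × Σ_s` on the vertices of a column. -/
def columnPerm : SymProd.{u} r s →* Equiv.Perm (Fin (r + s)) :=
  (finSumFinEquiv.permCongrHom.toMonoidHom.comp (Equiv.Perm.sumCongrHom (Fin r) (Fin s))).comp
    MulEquiv.ulift.toMonoidHom

theorem columnPerm_injective : Function.Injective (columnPerm.{u} r s) :=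
  (finSumFinEquiv.permCongrHom.injective.comp Equiv.Perm.sumCongrHom_injective).comp
    MulEquiv.ulift.injective

theorem columnPerm_castAdd (g : SymProd.{u} r s) (i : Fin r) :
    columnPerm r s g (Fin.castAdd s i) = Fin.castAdd s (g.down.1 i) := by
  change finSumFinEquiv (Equiv.Perm.sumCongr g.down.1 g.down.2
    (finSumFinEquiv.symm (Fin.castAdd s i))) = _
  rw [finSumFinEquiv_symm_apply_castAdd]
  rfl

theorem columnPerm_natAdd (g : SymProd.{u} r s) (i : Fin s) :
    columnPerm r s g (Fin.natAdd r i) = Fin.natAdd r (g.down.2 i) := by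
  change finSumFinEquiv (Equiv.Perm.sumCongr g.down.1 g.down.2
    (finSumFinEquiv.symm (Fin.natAdd r i))) = _
  rw [finSumFinEquiv_symm_apply_natAdd]
  rfl

theorem columnPerm_lt_iff (g : SymProd.{u} r s) (i : Fin (r + s)) :
    (columnPerm r s g i : ℕ) < r ↔ (i : ℕ) < r := by
  induction i using Fin.addCases with
  | left i => simp [columnPerm_castAdd]
  | right i => simp [columnPerm_natAdd]

/-- On a finite set, a permutation preserving the first block also preserves its complement, so it
splits as a pair. -/
theorem exists_columnPerm {σ : Equiv.Perm (Fin (r + s))}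
    (hσ : ∀ i, (σ i : ℕ) < r ↔ (i : ℕ) < r) : ∃ g, columnPerm.{u} r s g = σ := by
  have hmaps : Set.MapsTo (finSumFinEquiv.permCongrHom.symm σ) (Set.range (Sum.inl (β := Fin s)))
      (Set.range (Sum.inl (α := Fin r))) := by
    rintro _ ⟨i, rfl⟩
    have h : ((σ (Fin.castAdd s i) : Fin (r + s)) : ℕ) < r := (hσ _).2 i.2
    refine ⟨⟨_, h⟩, finSumFinEquiv.injective ?_⟩
    change _ = finSumFinEquiv (finSumFinEquiv.symm (σ (finSumFinEquiv (Sum.inl i))))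
    rw [Equiv.apply_symm_apply]
    rfl
  obtain ⟨g, hg⟩ := Equiv.Perm.mem_sumCongrHom_range_of_perm_mapsTo_inl hmaps
  refine ⟨ULift.up g, ?_⟩
  change finSumFinEquiv.permCongrHom (Equiv.Perm.sumCongrHom (Fin r) (Fin s) g) = σ
  rw [hg, MulEquiv.apply_symm_apply]

/-- The walled diagram of an element of `Σ_r × Σ_s`. -/
def ofSymProd (g : SymProd.{u} r s) : WalledBrauerDiagram r s :=
  ⟨BrauerDiagram.ofPerm (columnPerm r s g),
    BrauerDiagram.isWalled_ofPerm_iff.2 (columnPerm_lt_iff g)⟩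

theorem ofSymProd_injective : Function.Injective (ofSymProd.{u} (r := r) (s := s)) := fun _ _ h =>
  columnPerm_injective (BrauerDiagram.ofPerm_injective (congrArg Subtype.val h))

theorem comp_ofSymProd (g h : SymProd.{u} r s) :
    comp (ofSymProd g) (ofSymProd h) = ofSymProd (h * g) :=
  Subtype.ext ((BrauerDiagram.ofPerm_comp _ _).trans
    (congrArg BrauerDiagram.ofPerm (map_mul (columnPerm r s) h g).symm))

theorem numPropagating_ofSymProd (g : SymProd.{u} r s) :
    (ofSymProd g).1.numPropagating = r + s := BrauerDiagram.numPropagating_ofPerm _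

theorem notMem_nonPermutations_iff {d : WalledBrauerDiagram r s} :
    d ∉ nonPermutations r s ↔ ∃ g : SymProd.{u} r s, d = ofSymProd g := by
  constructor
  · intro h
    obtain ⟨σ, hσ⟩ := BrauerDiagram.exists_ofPerm d.1
      (le_antisymm (BrauerDiagram.numPropagating_le _) (not_lt.1 h))
    obtain ⟨g, rfl⟩ := exists_columnPerm.{u} (BrauerDiagram.isWalled_ofPerm_iff.1 (hσ ▸ d.2))
    exact ⟨g, Subtype.ext hσ⟩
  · rintro ⟨g, rfl⟩ h
    exact h.ne (numPropagating_ofSymProd g)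

end WalledBrauerDiagram

/-! ### Splitting off the group algebra. -/

namespace walledBrauerAlgebra

open WalledBrauerDiagram AugmentedAlgebra

variable {k : Type u} [CommRing k] {r s : ℕ} {δ : k} {C : Type u} [Ring C] [Algebra k C]
  (π : walledBrauerAlgebra r s δ →ₐ[k] C)

/-- The homomorphism from `Σ_r × Σ_s` to the opposite of an image of the walled Brauer algebra. -/
noncomputable def symProdHom : SymProd.{u} r s →* Cᵐᵒᵖ where
  toFun g := MulOpposite.op (π (diagram δ (ofSymProd g)))
  map_one' := by
    rw [← MulOpposite.op_one, ← map_one π]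
    refine congrArg (fun x => MulOpposite.op (π x)) (Subtype.ext ?_)
    change BrauerAlgebra.diagram δ (BrauerDiagram.ofPerm (columnPerm.{u} r s 1)) = _
    rw [map_one, BrauerDiagram.ofPerm_one]
    rfl
  -- The passage to the opposite algebra compensates for the reversed order in `comp_ofSymProd`.
  map_mul' g h := by
    rw [← MulOpposite.op_mul, ← map_mul, diagram_mul_diagram, comp_ofSymProd]
    change _ = MulOpposite.op (π (δ ^ BrauerDiagram.loops (BrauerDiagram.ofPerm _)
      (BrauerDiagram.ofPerm _) • _))
    rw [BrauerDiagram.loops_ofPerm, pow_zero, one_smul]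

theorem lift_symProdHom (y : MonoidAlgebra k (SymProd.{u} r s)) :
    MonoidAlgebra.lift k Cᵐᵒᵖ _ (symProdHom π) y = MulOpposite.op
      (π (Finsupp.linearCombination k (fun g => diagram δ (ofSymProd g)) y.coeff)) := by
  rw [MonoidAlgebra.lift_apply, Finsupp.linearCombination_apply, Finsupp.sum, Finsupp.sum, map_sum]
  refine Eq.trans (Finset.sum_congr rfl fun g _ => ?_)
    (map_sum (MulOpposite.opAddEquiv : C ≃+ Cᵐᵒᵖ) _ _).symm
  change _ = MulOpposite.op _
  rw [map_smul, MulOpposite.op_smul]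
  rfl

variable {π} (hsurj : Function.Surjective π) (hπ : ∀ b, π b = 0 ↔ b ∈ propagatingIdeal r s δ 0)
  (h0 : 0 < r + s)

include hπ h0 in
-- Lifted to the walled Brauer algebra, the element is supported both on permutations and on
-- non-permutations, so it vanishes by linear independence.
theorem eq_zero_of_lift_symProdHom_mem (y : MonoidAlgebra k (SymProd.{u} r s))
    (hy : MonoidAlgebra.lift k Cᵐᵒᵖ _ (symProdHom π) y ∈ opSpan π (nonPermutations r s)) :
    y = 0 := by
  obtain ⟨b, hb, hby⟩ := hy
  have hli : LinearIndependent k (fun g : SymProd.{u} r s => diagram δ (ofSymProd g)) :=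
    (linearIndependent_diagram r s δ).comp _ ofSymProd_injective
  rw [lift_symProdHom] at hby
  generalize hc : Finsupp.linearCombination k (fun g => diagram δ (ofSymProd g)) y.coeff = c at hby
  have hbc : π (c - b) = 0 := by
    rw [map_sub, sub_eq_zero]
    exact (MulOpposite.op_injective hby).symm
  rw [hπ, mem_propagatingIdeal] at hbc
  -- The ambiguity c - b of the lift has no propagating edges; as r + s > 0, it too is supported on
  -- non-permutations.
  have hcn : c ∈ Submodule.span k (diagram δ '' nonPermutations r s) := by
    rw [← sub_add_cancel c b]
    exact add_mem (Submodule.span_mono (Set.image_mono fun d hd => lt_of_le_of_lt hd h0) hbc) hb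
  have hcp : c ∈ Submodule.span k (diagram δ '' (nonPermutations r s)ᶜ) := by
    rw [← hc, Finsupp.linearCombination_apply]
    exact Submodule.sum_mem _ fun g _ => Submodule.smul_mem _ _ (Submodule.subset_span
      ⟨_, notMem_nonPermutations_iff.2 ⟨g, rfl⟩, rfl⟩)
  have hc0 := Submodule.disjoint_def.1 ((linearIndependent_diagram r s δ).disjoint_span_image
    disjoint_compl_right) c hcn hcp
  exact MonoidAlgebra.ext (linearIndependent_iff.1 hli _ (hc.trans hc0))

include hsurj in
theorem exists_sub_lift_symProdHom_mem (a : Cᵐᵒᵖ) : ∃ y,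
    a - MonoidAlgebra.lift k Cᵐᵒᵖ (SymProd.{u} r s) (symProdHom π) y ∈
      opSpan π (nonPermutations r s) := by
  obtain ⟨b, hb⟩ := hsurj a.unop
  obtain rfl : MulOpposite.op (π b) = a := by rw [hb, MulOpposite.op_unop]
  clear hb
  have hb : b ∈ Submodule.span k (Set.range (diagram δ)) := span_diagram.ge trivial
  induction hb using Submodule.span_induction with
  | mem x hx =>
    obtain ⟨d, rfl⟩ := hx
    by_cases hd : d ∈ nonPermutations r s
    · refine ⟨0, ?_⟩
      rw [map_zero, sub_zero]
      exact ⟨_, Submodule.subset_span ⟨d, hd, rfl⟩, rfl⟩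
    · obtain ⟨g, rfl⟩ := notMem_nonPermutations_iff.1 hd
      refine ⟨MonoidAlgebra.of k _ g, ?_⟩
      rw [MonoidAlgebra.lift_of]
      exact (sub_self (symProdHom π g)).symm ▸ zero_mem _
  | zero => exact ⟨0, by rw [map_zero, map_zero, MulOpposite.op_zero, sub_zero]; exact zero_mem _⟩
  | add x x' _ _ hx hx' =>
    obtain ⟨y, hy⟩ := hx
    obtain ⟨y', hy'⟩ := hx'
    refine ⟨y + y', ?_⟩
    rw [map_add, map_add, MulOpposite.op_add, add_sub_add_comm]
    exact add_mem hy hy'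
  | smul c x _ hx =>
    obtain ⟨y, b, hb, hy⟩ := hx
    refine ⟨c • y, c • b, Submodule.smul_mem _ _ hb, ?_⟩
    rw [map_smul, hy, map_smul, map_smul, MulOpposite.op_smul, smul_sub]

include hsurj hπ h0 in
theorem exists_retraction_symProd :
    ∃ q : Cᵐᵒᵖ →ₐ[k] MonoidAlgebra k (SymProd.{u} r s),
      (∀ g, q (symProdHom π g) = MonoidAlgebra.of k _ g) ∧
      (RingHom.ker q).toAddSubgroup = opSpan π (nonPermutations r s) := by
  obtain ⟨q, hq, hker⟩ := exists_retraction_of_isCompl (symProdHom π) (nonPermutationIdeal hsurj)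
    (eq_zero_of_lift_symProdHom_mem hπ h0) (exists_sub_lift_symProdHom_mem hsurj)
  exact ⟨q, hq, by rw [hker]; rfl⟩

include hsurj hπ h0 in
-- Only the kernel of the surjection π matters, so the algebra itself for odd r + s and the quotient
-- for r + s > 0 are treated together.
theorem nonempty_iso_symProd (τ : C →ₐ[k] k) (hτ : ∀ b, τ (π b) = augmentation r s δ b) :
    (∀ n, Nonempty (homology τ n ≅ groupHomology (Rep.trivial k (SymProd.{u} r s) k) n)) ∧
    (∀ n, Nonempty (cohomology τ n ≅ groupCohomology (Rep.trivial k (SymProd.{u} r s) k) n)) := by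
  obtain ⟨q, hq, hker⟩ := exists_retraction_symProd hsurj hπ h0
  have hv : ∀ g, τ (symProdHom π g).unop = 1 := fun g =>
    (hτ _).trans ((augmentation_diagram _).trans (if_pos (numPropagating_ofSymProd g)))
  have hI : ∀ a, q a = 0 → τ a.unop = 0 := fun a ha => by
    obtain ⟨b, hb, rfl⟩ : a ∈ opSpan π (nonPermutations r s) := hker ▸ ha
    exact (hτ b).trans (augmentation_eq_zero hb)
  have hP : ∀ P : ProjectiveResolution (trivialRight τ),
      AcyclicOn (M := fun n => P.complex.X n) (resolutionD P) (RingHom.ker q).toAddSubgroup :=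
    fun P => hker ▸ acyclicOn_opSpan_nonPermutations hsurj hπ τ hτ P
  exact ⟨nonempty_homology_iso_groupHomology _ q hq τ hv hI hP,
    nonempty_cohomology_iso_groupCohomology _ q hq τ hv hI hP⟩

end walledBrauerAlgebra

/-! ### The main theorem. -/

theorem corollary8p6 {k : Type u} [CommRing k] (r s : ℕ) (δ : k) :
    (Odd (r + s) →
      (∀ n : ℕ, Nonempty
        (AugmentedAlgebra.homology (walledBrauerAlgebra.augmentation r s δ) n ≅
          groupHomology (Rep.trivial k (SymProd.{u} r s) k) n)) ∧
      (∀ n : ℕ, Nonempty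
        (AugmentedAlgebra.cohomology (walledBrauerAlgebra.augmentation r s δ) n ≅
          groupCohomology (Rep.trivial k (SymProd.{u} r s) k) n))) ∧
    (Odd (r + s) → walledBrauerAlgebra.propagatingIdeal r s δ 0 = ⊥) ∧
    (∀ h : 0 < r + s,
      (∀ n : ℕ, Nonempty
        (AugmentedAlgebra.homology (walledBrauerAlgebra.quotientAugmentation r s δ 0 h) n ≅
          groupHomology (Rep.trivial k (SymProd.{u} r s) k) n)) ∧
      (∀ n : ℕ, Nonempty
        (AugmentedAlgebra.cohomology (walledBrauerAlgebra.quotientAugmentation r s δ 0 h) n ≅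
          groupCohomology (Rep.trivial k (SymProd.{u} r s) k) n))) := by
  refine ⟨fun h => ?_, walledBrauerAlgebra.propagatingIdeal_zero_eq_bot, fun h => ?_⟩
  -- For odd r + s the ideal is zero, so the identity map has the required kernel; oddness also
  -- gives r + s > 0.
  · exact walledBrauerAlgebra.nonempty_iso_symProd (π := AlgHom.id k _) Function.surjective_id
      (fun b => by
        rw [walledBrauerAlgebra.propagatingIdeal_zero_eq_bot h]
        exact (Ideal.mem_bot).symm) h.pos _ fun _ => rfl
  · exact walledBrauerAlgebra.nonempty_iso_symProd
      (π := Ideal.Quotient.mkₐ k (walledBrauerAlgebra.propagatingIdeal r s δ 0))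
      (Ideal.Quotient.mkₐ_surjective _ _) (fun b => Ideal.Quotient.eq_zero_iff_mem) h _
      fun _ => rfl
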